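/- **Setting.** Let $D,L\ge 1$ be integers, $\Lambda=\{0,\dots,L\}^D$ with the Manhattan distance (with or without periodic boundary condition), and $N=(L+1)^D$. On $(\mathbb C^2)^{\otimes\Lambda}$ consider $$H=-\sum_{i\in\Lambda}Z_i+\varepsilon\sum_{j\in\Lambda}h_j,\qquad h_j=h_j^\dagger,\quad \|h_j\|\le 1,$$ where $(h_j)$ is $(r_0,l)$-geometrically local with integers $r_0,l\ge1$: $h_j$ is supported on the ball of radius $r_0$ around $j$, and each site is acted on non-trivially by at most $l$ of the $h_j$. Let $\hat f(\omega)=\hat u(\omega/8)\,\hat v(2\omega)$, where for some $\alpha>1$ and $A_{1,u},A_{2,u},A_{1,v},A_{2,v}>0$ the functions $\hat u:\mathbb R\to[0,\infty)$ and $\hat v:\mathbb R\to\mathbb C$ are smooth with $|\hat u^{(n)}(\omega)|\le A_{1,u}A_{2,u}^n n^{n\alpha}$ and $|\hat v^{(n)}(\omega)|\le A_{1,v}A_{2,v}^n n^{n\alpha}$ for all $n\ge 0$, $\omega\in\mathbb R$ (with $0^0=1$); $\operatorname{supp}\hat u\subset[-1,1]$, $\hat u$ is bounded below by a positive constant on $[-\frac12,\frac12]$,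 $\hat u(-\frac14)=1$; $\hat v'\in L^1(\mathbb R)$, $\operatorname{supp}\hat v\subset(-\infty,0]$, $\hat v(-4)=1$. Put $$f(s)=\frac1{2\pi}\int_{\mathbb R}\hat f(\omega)e^{-i\omega s}\,d\omega,\qquad K_i=\int_{\mathbb R} f(s)\,e^{iHs}X_ie^{-iHs}\,ds,\qquad \mathcal L[\rho]=\sum_{i\in\Lambda}\Big(K_i\rho K_i^\dagger-\tfrac12\{K_i^\dagger K_i,\rho\}\Big).$$ **Theorem.** There are absolute constants $a,C>0$ and, for all $\alpha,A_{1,u},A_{2,u},A_{1,v},A_{2,v}$ and $D$ as above, a constant $c>0$ depending only on these, such that the following holds with $$\varepsilon^*=c\,(r_0l)^{-aD},$$ which is independent of $N$. For all $r_0,l,L$, all $(h_j)$ and all $\hat u,\hat v$ as above, if $|\varepsilon|<\varepsilon^*$ and $\psi_0$ is a normalized ground state of $H$ (an eigenvector for the lowest eigenvalue), then for every $0<\eta\le1$, every $t\ge C\log(N/\eta)$ and every density matrix $\rho$, $$\big\|e^{t\mathcal L}\rho-|\psi_0\rangle\langle\psi_0|\big\|_1\le\eta ,$$ where $\|A\|_1=\operatorname{Tr}\sqrt{A^\dagger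 A}$. (In particular the ground state is unique up to a phase.) -/

import Mathlib

open scoped Matrix Matrix.Norms.L2Operator MatrixOrder ComplexOrder

noncomputable section

namespace GroundStatePrep

/-! ### The lattice -/

/-- The sites of the lattice `[0, L]^D`. -/
abbrev Site (D L : ℕ) : Type := Fin D → Fin (L + 1)

/-- Distance of two coordinates in `{0, …, L}`, on a segment or (if `periodic`) on a cycle of
length `L + 1`. -/
def coordDist (periodic : Bool) {L : ℕ} (a b : Fin (L + 1)) : ℕ :=
  if periodic then min ((a : ℤ) - (b : ℤ)).natAbs (L + 1 - ((a : ℤ) - (b : ℤ)).natAbs)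
  else ((a : ℤ) - (b : ℤ)).natAbs

/-- The Manhattan distance on the lattice, with or without periodic boundary condition. -/
def manhattanDist (periodic : Bool) {D L : ℕ} (i j : Site D L) : ℕ :=
  ∑ k, coordDist periodic (i k) (j k)

/-- The ball of radius `r` around the site `j`. -/
def siteBall (periodic : Bool) {D L : ℕ} (j : Site D L) (r : ℕ) : Set (Site D L) :=
  {i | manhattanDist periodic i j ≤ r}

/-! ### Operators on the spin system -/

/-- Operators on `(ℂ²)^{⊗ Λ}` as matrices in the computational basis, which is indexed by the
configurations `Λ → {0, 1}`. The norm `‖·‖` is the operator norm for the Euclidean norm. -/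
abbrev Op (Λ : Type) : Type := Matrix (Λ → Fin 2) (Λ → Fin 2) ℂ

section Spin

variable {Λ : Type} [Fintype Λ] [DecidableEq Λ]

open Classical in
/-- `A = B ⊗ 1` with `B` an operator on the spins in `S` and `1` the identity on the others. -/
def IsSupportedOn (S : Set Λ) (A : Op Λ) : Prop :=
  ∃ B : Op S, ∀ x y : Λ → Fin 2,
    A x y = if ∀ i, i ∉ S → x i = y i then B (fun i => x i) (fun i => y i) else 0

/-- The site `i` appears in `A`: the operator `A` acts non-trivially on the spin at `i`. -/
def ActsOn (i : Λ) (A : Op Λ) : Prop := ¬ IsSupportedOn {i}ᶜ A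

/-- The single-spin operator `M` at site `i`, tensored with the identity on all other sites. -/
def onSite (i : Λ) (M : Matrix (Fin 2) (Fin 2) ℂ) : Op Λ :=
  Matrix.of fun x y => if ∀ k, k ≠ i → x k = y k then M (x i) (y i) else 0

def pauliX (i : Λ) : Op Λ := onSite i !![0, 1; 1, 0]

def pauliZ (i : Λ) : Op Λ := onSite i !![1, 0; 0, -1]

/-- `H_ε = - ∑ Z_i + ε ∑ h_j`. -/
def hamiltonian (ε : ℝ) (h : Λ → Op Λ) : Op Λ :=
  -∑ i, pauliZ i + (ε : ℂ) • ∑ j, h j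

/-- `ψ` is a normalized eigenvector of `H` for its lowest eigenvalue. -/
def IsGroundState (H : Op Λ) (ψ : (Λ → Fin 2) → ℂ) : Prop :=
  star ψ ⬝ᵥ ψ = 1 ∧ ∃ E : ℝ, H *ᵥ ψ = (E : ℂ) • ψ ∧
    ∀ (μ : ℝ) (φ : (Λ → Fin 2) → ℂ), φ ≠ 0 → H *ᵥ φ = (μ : ℂ) • φ → E ≤ μ

/-- The rank-one operator `|ψ⟩⟨ψ|`. -/
def pureState (ψ : (Λ → Fin 2) → ℂ) : Op Λ := Matrix.vecMulVec ψ (star ψ)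

/-- Density matrices. -/
def IsState (ρ : Op Λ) : Prop := ρ.PosSemidef ∧ ρ.trace = 1

/-- The trace norm `‖A‖₁ = Tr √(A† A)`. -/
def traceNorm (A : Op Λ) : ℝ := (CFC.sqrt (Aᴴ * A)).trace.re

/-! ### The Lindblad dynamics -/

/-- The jump operator `K = ∫ f(s) e^{iHs} A e^{-iHs} ds`. -/
def jumpOp (f : ℝ → ℂ) (H A : Op Λ) : Op Λ :=
  ∫ s : ℝ, f s • (NormedSpace.exp ((Complex.I * (s : ℂ)) • H) * A *
    NormedSpace.exp ((-(Complex.I * (s : ℂ))) • H))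

/-- The dissipator `ρ ↦ K ρ K† - ½ {K† K, ρ}`. -/
def dissipator (K : Op Λ) : Op Λ →ₗ[ℂ] Op Λ :=
  LinearMap.mulLeftRight ℂ (K, Kᴴ) -
    (1 / 2 : ℂ) • (LinearMap.mulLeft ℂ (Kᴴ * K) + LinearMap.mulRight ℂ (Kᴴ * K))

/-- The Lindbladian without coherent term, with one jump operator for each coupling operator
`X_i`. -/
def lindbladian (f : ℝ → ℂ) (H : Op Λ) : Op Λ →L[ℂ] Op Λ :=
  LinearMap.toContinuousLinearMap (∑ i : Λ, dissipator (jumpOp f H (pauliX i)))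

/-- The evolved state `e^{t𝓛} ρ`. -/
def evolve (f : ℝ → ℂ) (H : Op Λ) (t : ℝ) (ρ : Op Λ) : Op Λ :=
  NormedSpace.exp ((t : ℂ) • lindbladian f H) ρ

end Spin

/-- The family `(h_j)` of self-adjoint terms is `(r, l)`-geometrically local: `h_j` is supported on
the ball of radius `r` around `j`, and each site appears in at most `l` of the terms. -/
structure IsGeometricallyLocal (periodic : Bool) {D L : ℕ} (r l : ℕ)
    (h : Site D L → Op (Site D L)) : Prop where
  hermitian : ∀ j, (h j).IsHermitian
  supported : ∀ j, IsSupportedOn (siteBall periodic j r) (h j)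
  overlap : ∀ i, {j | ActsOn i (h j)}.ncard ≤ l

/-! ### The filter function -/

/-- The Gevrey class `𝒢^s_{C₁,C₂}(ℝ)`; here `0 ^ 0 = 1`. -/
def IsGevrey {E : Type*} [NormedAddCommGroup E] [NormedSpace ℝ E] (s C₁ C₂ : ℝ) (g : ℝ → E) :
    Prop :=
  ContDiff ℝ (⊤ : ℕ∞) g ∧ ∀ (n : ℕ) (ω : ℝ), ‖iteratedDeriv n g ω‖ ≤ C₁ * C₂ ^ n * (n : ℝ) ^ (n * s)

/-- The frequency-domain filter `f̂(ω) = û(ω/8) v̂(2ω)`. -/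
def filterHat (u : ℝ → ℝ) (v : ℝ → ℂ) (ω : ℝ) : ℂ := (u (ω / 8) : ℂ) * v (2 * ω)

/-- The time-domain filter `f(s) = (2π)⁻¹ ∫ f̂(ω) e^{-iωs} dω`. -/
def filterTime (u : ℝ → ℝ) (v : ℝ → ℂ) (s : ℝ) : ℂ :=
  (1 / (2 * Real.pi) : ℂ) * ∫ ω : ℝ, filterHat u v ω * Complex.exp (-(Complex.I * ω * s))

/-- The conditions on the two factors `û`, `v̂` of the filter function. -/
structure FilterAssumption (α A₁u A₂u A₁v A₂v : ℝ) (u : ℝ → ℝ) (v : ℝ → ℂ) : Prop where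
  gevrey_u : IsGevrey α A₁u A₂u u
  nonneg_u : ∀ ω, 0 ≤ u ω
  supp_u : tsupport u ⊆ Set.Icc (-1) 1
  lower_u : ∃ c > 0, ∀ ω ∈ Set.Icc (-(1 / 2) : ℝ) (1 / 2), c ≤ u ω
  value_u : u (-(1 / 4)) = 1
  gevrey_v : IsGevrey α A₁v A₂v v
  deriv_v : MeasureTheory.Integrable (deriv v)
  supp_v : tsupport v ⊆ Set.Iic 0
  value_v : v (-4) = 1

end GroundStatePrep

end

/-!
The vacuum `|0⟩` is the ground state at `ε = 0`, where the jump operators are exactly the lowering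
operators: the Heisenberg evolution of `X_i` then oscillates at frequencies `∓2` only, and the
filter is normalised to keep the energy-lowering one and to kill the other. For small `ε` the jump
operators are quasi-local perturbations of the lowering operators, because `f` decays faster than
any power (its Fourier transform is smooth) while Lieb–Robinson bounds control the spreading of
`X_i` in time.

An observable `O` is measured by its oscillation, the sum over the sites `i` of
`‖O - (⟨0|_i O |0⟩_i) ⊗ 1_i‖`. The unperturbed dual dynamics contracts each of these terms
independently, and the perturbation mixes them with coefficients whose total is independent of the
volume, so the whole sum still contracts exponentially. Since the filter rejects nonnegative energy
transfers, every jump operator annihilates `ψ₀`, which is therefore stationary; trace-norm duality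
turns the contraction of oscillations into convergence to `ψ₀`, with only a factor `N` in front.
-/

noncomputable section

namespace GroundStatePrep

section CStar

variable {𝒜 : Type*} [CStarAlgebra 𝒜]

theorem norm_one_le_one : ‖(1 : 𝒜)‖ ≤ 1 := by
  cases subsingleton_or_nontrivial 𝒜
  · simp [Subsingleton.elim (1 : 𝒜) 0]
  · exact CStarRing.norm_one.le

-- This is the Cauchy–Schwarz inequality in the Hilbert C⋆-module `𝒜 ^ ι`.
theorem norm_sum_kraus_le {ι : Type*} [Fintype ι] (V : ι → 𝒜) (A : 𝒜) :
    ‖∑ i, star (V i) * A * V i‖ ≤ ‖A‖ * ‖∑ i, star (V i) * V i‖ := by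
  let _ := CStarAlgebra.spectralOrder 𝒜
  have _ := CStarAlgebra.spectralOrderedRing 𝒜
  let x : WithCStarModule 𝒜 (ι → 𝒜) := WithCStarModule.equiv 𝒜 (ι → 𝒜) |>.symm fun i => star (V i)
  let y : WithCStarModule 𝒜 (ι → 𝒜) :=
    WithCStarModule.equiv 𝒜 (ι → 𝒜) |>.symm fun i => star (V i) * A
  have hxy : inner 𝒜 x y = ∑ i, star (V i) * A * V i := by
    simp [x, y, WithCStarModule.pi_inner, WithCStarModule.inner_def]
  have hx : ‖x‖ ^ 2 = ‖∑ i, star (V i) * V i‖ := by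
    simp [x, WithCStarModule.pi_norm_sq, WithCStarModule.inner_def]
  have hy : ‖y‖ ^ 2 ≤ ‖A‖ ^ 2 * ‖∑ i, star (V i) * V i‖ := by
    have hAA : A * star A ≤ algebraMap ℝ 𝒜 (‖A‖ ^ 2) := by
      simpa only [CStarRing.norm_self_mul_star, ← sq] using
        IsSelfAdjoint.le_algebraMap_norm_self (IsSelfAdjoint.mul_star_self A)
    have hle : ∑ i, star (V i) * (A * star A) * V i ≤ ‖A‖ ^ 2 • ∑ i, star (V i) * V i := by
      rw [Finset.smul_sum]
      refine Finset.sum_le_sum fun i _ => (star_left_conjugate_le_conjugate hAA (V i)).trans_eq ?_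
      rw [Algebra.algebraMap_eq_smul_one, mul_smul_comm, smul_mul_assoc, mul_one]
    calc ‖y‖ ^ 2 = ‖∑ i, star (V i) * (A * star A) * V i‖ := by
          simp [y, WithCStarModule.pi_norm_sq, WithCStarModule.inner_def, mul_assoc]
      _ ≤ ‖‖A‖ ^ 2 • ∑ i, star (V i) * V i‖ :=
          CStarAlgebra.norm_le_norm_of_nonneg_of_le (Finset.sum_nonneg fun i _ =>
            star_left_conjugate_nonneg (mul_star_self_nonneg A) (V i)) hle
      _ = ‖A‖ ^ 2 * ‖∑ i, star (V i) * V i‖ := by rw [norm_smul, norm_pow, norm_norm]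
  rw [← hxy, ← hx]
  rw [← hx, ← mul_pow] at hy
  calc ‖inner 𝒜 x y‖ ≤ ‖x‖ * ‖y‖ := CStarModule.norm_inner_le (WithCStarModule 𝒜 (ι → 𝒜))
    _ ≤ ‖x‖ * (‖A‖ * ‖x‖) := by gcongr; exact le_of_sq_le_sq hy (by positivity)
    _ = ‖A‖ * ‖x‖ ^ 2 := by ring

/-- The map `O ↦ S† O T - ½ {S† T, O}`. On the diagonal `S = T` it is the dual, in the Heisenberg
picture, of the dissipator of the jump operator `S`; the polarized form serves to expand a jump
operator into local pieces. -/
def dualDissipator (S T O : 𝒜) : 𝒜 :=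
  star S * O * T - (1 / 2 : ℂ) • (star S * T * O + O * (star S * T))

theorem norm_dualDissipator_le (S T O : 𝒜) : ‖dualDissipator S T O‖ ≤ 2 * ‖S‖ * ‖T‖ * ‖O‖ := by
  have hST : ‖star S * T‖ ≤ ‖S‖ * ‖T‖ := by simpa using norm_mul_le (star S) T
  have hconj : ‖star S * O * T‖ ≤ ‖S‖ * ‖O‖ * ‖T‖ := by simpa using norm_mul₃_le (a := star S)
  have hanti : ‖star S * T * O + O * (star S * T)‖ ≤ ‖S‖ * ‖T‖ * ‖O‖ + ‖O‖ * (‖S‖ * ‖T‖) :=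
    norm_add_le_of_le (norm_mul_le_of_le hST le_rfl) (norm_mul_le_of_le le_rfl hST)
  calc ‖dualDissipator S T O‖
      ≤ ‖star S * O * T‖ + ‖(1 / 2 : ℂ) • (star S * T * O + O * (star S * T))‖ := norm_sub_le _ _
    _ = ‖star S * O * T‖ + 1 / 2 * ‖star S * T * O + O * (star S * T)‖ := by
        rw [norm_smul]; norm_num
    _ ≤ 2 * ‖S‖ * ‖T‖ * ‖O‖ := by linarith

theorem dualDissipator_add_left (S S' T O : 𝒜) :
    dualDissipator (S + S') T O = dualDissipator S T O + dualDissipator S' T O := by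
  simp only [dualDissipator, star_add, add_mul, mul_add]; module

theorem dualDissipator_add_mid (S T T' O : 𝒜) :
    dualDissipator S (T + T') O = dualDissipator S T O + dualDissipator S T' O := by
  simp only [dualDissipator, add_mul, mul_add]; module

theorem dualDissipator_sub (S T O O' : 𝒜) :
    dualDissipator S T (O - O') = dualDissipator S T O - dualDissipator S T O' := by
  simp only [dualDissipator, sub_mul, mul_sub]; module

theorem dualDissipator_sum_left {ι : Type*} (s : Finset ι) (S : ι → 𝒜) (T O : 𝒜) :
    dualDissipator (∑ i ∈ s, S i) T O = ∑ i ∈ s, dualDissipator (S i) T O :=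
  map_sum (AddMonoidHom.mk' (dualDissipator · T O) fun S S' => dualDissipator_add_left S S' T O) S s

theorem dualDissipator_sum_mid {ι : Type*} (s : Finset ι) (S : 𝒜) (T : ι → 𝒜) (O : 𝒜) :
    dualDissipator S (∑ i ∈ s, T i) O = ∑ i ∈ s, dualDissipator S (T i) O :=
  map_sum (AddMonoidHom.mk' (dualDissipator S · O) fun T T' => dualDissipator_add_mid S T T' O) T s

theorem dualDissipator_eq_zero {S T O : 𝒜} (hS : Commute O (star S)) (hT : Commute O T) :
    dualDissipator S T O = 0 := by
  have hconj : star S * O * T = star S * T * O := by rw [mul_assoc, hT.eq, mul_assoc]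
  have hright : O * (star S * T) = star S * T * O := by rw [← mul_assoc, hS.eq, hconj]
  rw [dualDissipator, hconj, hright]; module

theorem dualDissipator_one (S T : 𝒜) : dualDissipator S T 1 = 0 :=
  dualDissipator_eq_zero (Commute.one_left _) (Commute.one_left _)

theorem euler_kraus_sum_eq {ι : Type*} (s : Finset ι) (K : ι → 𝒜) (A : 𝒜) {h : ℝ} (hh : 0 ≤ h)
    {G : 𝒜} (hG : G = ∑ j ∈ s, star (K j) * K j) :
    star (1 - ((h / 2 : ℝ) : ℂ) • G) * A * (1 - ((h / 2 : ℝ) : ℂ) • G) +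
        ∑ j ∈ s, star (((√h : ℝ) : ℂ) • K j) * A * (((√h : ℝ) : ℂ) • K j) =
      A + (h : ℂ) • ∑ j ∈ s, dualDissipator (K j) (K j) A +
        ((h ^ 2 / 4 : ℝ) : ℂ) • (G * A * G) := by
  have hGs : star G = G := by simp [hG]
  have hsq : ((√h : ℝ) : ℂ) * ((√h : ℝ) : ℂ) = h := by
    rw [← Complex.ofReal_mul, Real.mul_self_sqrt hh]
  have hsum : ∑ j ∈ s, dualDissipator (K j) (K j) A =
      ∑ j ∈ s, star (K j) * A * K j - (1 / 2 : ℂ) • (G * A + A * G) := by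
    simp only [dualDissipator, Finset.sum_sub_distrib, ← Finset.smul_sum, Finset.sum_add_distrib,
      hG, Finset.sum_mul, Finset.mul_sum]
  simp only [star_sub, star_one, star_smul, hGs, Complex.star_def, Complex.conj_ofReal,
    smul_mul_assoc, mul_smul_comm, smul_smul, hsq, hsum, ← Finset.smul_sum, mul_sub, sub_mul,
    one_mul, mul_one]
  push_cast
  module

-- Up to the term `h² G A G / 4`, `1 + h 𝓛†` is a completely positive map, with the Kraus operators
-- `1 - h G / 2` and `√h K_j`.
theorem norm_add_smul_sum_dualDissipator_le {ι : Type*} (s : Finset ι) (K : ι → 𝒜) (A : 𝒜)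
    {h : ℝ} (hh : 0 ≤ h) :
    ‖A + (h : ℂ) • ∑ j ∈ s, dualDissipator (K j) (K j) A‖ ≤
      (1 + h ^ 2 / 2 * (∑ j ∈ s, ‖K j‖ ^ 2) ^ 2) * ‖A‖ := by
  set g := ∑ j ∈ s, ‖K j‖ ^ 2
  set G := ∑ j ∈ s, star (K j) * K j with hG
  have hGg : ‖G‖ ≤ g := norm_sum_le_of_le s fun j _ => by rw [CStarRing.norm_star_mul_self, sq]
  let V : Option s → 𝒜 := fun o =>
    o.elim (1 - ((h / 2 : ℝ) : ℂ) • G) fun j => ((√h : ℝ) : ℂ) • K j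
  have hkraus : ∀ B : 𝒜, ∑ o, star (V o) * B * V o = B +
      (h : ℂ) • ∑ j ∈ s, dualDissipator (K j) (K j) B +
        ((h ^ 2 / 4 : ℝ) : ℂ) • (G * B * G) := fun B => by
    rw [← euler_kraus_sum_eq s K B hh hG, Fintype.sum_option, ← Finset.sum_coe_sort s]
    rfl
  have hGAG : ∀ B : 𝒜, ‖((h ^ 2 / 4 : ℝ) : ℂ) • (G * B * G)‖ ≤ h ^ 2 / 4 * (g ^ 2 * ‖B‖) := by
    intro B
    rw [norm_smul, Complex.norm_real, Real.norm_of_nonneg (by positivity)]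
    gcongr
    calc ‖G * B * G‖ ≤ ‖G‖ * ‖B‖ * ‖G‖ := norm_mul₃_le
      _ ≤ g * ‖B‖ * g := by gcongr
      _ = g ^ 2 * ‖B‖ := by ring
  have hone : ‖∑ o, star (V o) * V o‖ ≤ 1 + h ^ 2 / 4 * g ^ 2 := by
    have h1 := norm_one_le_one (𝒜 := 𝒜)
    have hV := hkraus 1
    simp only [mul_one, dualDissipator_one, Finset.sum_const_zero, smul_zero, add_zero] at hV
    rw [hV]
    refine norm_add_le_of_le h1 ((mul_one G ▸ hGAG 1).trans ?_)
    gcongr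
    exact mul_le_of_le_one_right (by positivity) h1
  calc ‖A + (h : ℂ) • ∑ j ∈ s, dualDissipator (K j) (K j) A‖
      = ‖∑ o, star (V o) * A * V o - ((h ^ 2 / 4 : ℝ) : ℂ) • (G * A * G)‖ := by
        rw [hkraus A, add_sub_cancel_right]
    _ ≤ ‖A‖ * (1 + h ^ 2 / 4 * g ^ 2) + h ^ 2 / 4 * (g ^ 2 * ‖A‖) :=
        norm_sub_le_of_le ((norm_sum_kraus_le V A).trans (by gcongr)) (hGAG A)
    _ = (1 + h ^ 2 / 2 * g ^ 2) * ‖A‖ := by ring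

end CStar

section OneSpin

variable {𝒜 : Type*} [CStarAlgebra 𝒜]

/-- `A` commutes with the algebra generated by `a` and `a†`. For the lowering operator `a` of a
spin this says that `A` acts trivially on that spin. -/
def CommutesWith (A a : 𝒜) : Prop := Commute A a ∧ Commute A (star a)

namespace CommutesWith

variable {A B a : 𝒜}

theorem star (h : CommutesWith A a) : CommutesWith (star A) a :=
  ⟨by simpa using h.2.star_star, by simpa using h.1.star_star⟩

theorem add (h : CommutesWith A a) (h' : CommutesWith B a) : CommutesWith (A + B) a :=
  ⟨h.1.add_left h'.1, h.2.add_left h'.2⟩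

theorem mul (h : CommutesWith A a) (h' : CommutesWith B a) : CommutesWith (A * B) a :=
  ⟨h.1.mul_left h'.1, h.2.mul_left h'.2⟩

end CommutesWith

/-- The map `O ↦ ⟨0|O|0⟩ ⊗ 1`, which evaluates in the state `|0⟩` the spin with lowering operator
`a = |0⟩⟨1|`. -/
def condExp (a : 𝒜) : 𝒜 →L[ℂ] 𝒜 :=
  ContinuousLinearMap.mulLeftRight ℂ 𝒜 (a * star a) (a * star a) +
    ContinuousLinearMap.mulLeftRight ℂ 𝒜 (star a) a

/-- The part `O - ⟨0|O|0⟩ ⊗ 1` of an operator. Its norm measures how much the operator depends on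
the spin with lowering operator `a`. -/
def osc (a : 𝒜) : 𝒜 →L[ℂ] 𝒜 := ContinuousLinearMap.id ℂ 𝒜 - condExp a

/-- The operator `Z = |0⟩⟨0| - |1⟩⟨1|` of the spin with lowering operator `a = |0⟩⟨1|`. -/
def parity (a : 𝒜) : 𝒜 := a * star a - star a * a

theorem condExp_apply (a O : 𝒜) :
    condExp a O = a * star a * O * (a * star a) + star a * O * a := by
  simp [condExp]

theorem osc_apply (a O : 𝒜) : osc a O = O - condExp a O := rfl

theorem condExp_mul_left {A a : 𝒜} (h : CommutesWith A a) (O : 𝒜) :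
    condExp a (A * O) = A * condExp a O := by
  have h1 : a * star a * A = A * (a * star a) := ((h.1.mul_right h.2).eq).symm
  simp only [condExp_apply, mul_add, ← mul_assoc, h.2.eq]
  rw [h1]; simp only [mul_assoc]

theorem condExp_mul_right {A a : 𝒜} (h : CommutesWith A a) (O : 𝒜) :
    condExp a (O * A) = condExp a O * A := by
  have h1 : A * (a * star a) = a * star a * A := (h.1.mul_right h.2).eq
  simp only [condExp_apply, add_mul, mul_assoc, h.1.eq]
  rw [h1]; simp only [mul_assoc]

theorem CommutesWith.condExp {A a b : 𝒜} (h : CommutesWith A a) (hb : CommutesWith b a) :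
    CommutesWith (condExp b A) a := by
  rw [condExp_apply]
  exact (((hb.mul hb.star).mul h).mul (hb.mul hb.star)).add ((hb.star.mul h).mul hb)

theorem condExp_dualDissipator {S T a : 𝒜} (hS : CommutesWith S a) (hT : CommutesWith T a)
    (O : 𝒜) : condExp a (dualDissipator S T O) = dualDissipator S T (condExp a O) := by
  simp only [dualDissipator, map_sub, map_smul, map_add, condExp_mul_left (hS.star.mul hT),
    condExp_mul_right (hS.star.mul hT), condExp_mul_right hT, condExp_mul_left hS.star]

theorem osc_dualDissipator {S T a : 𝒜} (hS : CommutesWith S a) (hT : CommutesWith T a) (O : 𝒜) :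
    osc a (dualDissipator S T O) = dualDissipator S T (osc a O) := by
  rw [osc_apply, osc_apply, dualDissipator_sub, condExp_dualDissipator hS hT]

/-- The relations of the lowering operator `|0⟩⟨1|` of one spin. -/
structure IsLowering (a : 𝒜) : Prop where
  mul_self : a * a = 0
  car : a * star a + star a * a = 1

namespace IsLowering

variable {a : 𝒜} (ha : IsLowering a)
include ha

-- Together with `mul_assoc` these rules bring every word in `a`, `a†` and further letters to normal
-- form; each relation comes in a second version for use inside a longer word.
theorem word_rules :
    a * a = 0 ∧ star a * star a = 0 ∧ a * (star a * a) = a ∧ star a * (a * star a) = star a ∧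
      ∀ x, a * (a * x) = 0 ∧ star a * (star a * x) = 0 ∧ a * (star a * (a * x)) = a * x ∧
        star a * (a * (star a * x)) = star a * x := by
  have hs : star a * star a = 0 := by simpa using congrArg star ha.mul_self
  have hasa : a * (star a * a) = a := by
    have := congrArg (a * ·) ha.car
    simpa only [mul_add, mul_one, ← mul_assoc, ha.mul_self, zero_mul, zero_add] using this
  have hsas : star a * (a * star a) = star a := by
    simpa [mul_assoc] using congrArg star hasa
  refine ⟨ha.mul_self, hs, hasa, hsas, fun x => ⟨?_, ?_, ?_, ?_⟩⟩
  · rw [← mul_assoc, ha.mul_self, zero_mul]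
  · rw [← mul_assoc, hs, zero_mul]
  · rw [← mul_assoc, ← mul_assoc, mul_assoc a, hasa]
  · rw [← mul_assoc, ← mul_assoc, mul_assoc (star a), hsas]

theorem norm_condExp_le (O : 𝒜) : ‖condExp a O‖ ≤ ‖O‖ := by
  have hkraus := norm_sum_kraus_le ![a * star a, a] O
  simp only [Fin.sum_univ_two, Matrix.cons_val_zero, Matrix.cons_val_one, star_mul, star_star,
    mul_assoc, ha.word_rules, ha.car] at hkraus
  rw [condExp_apply]
  simp only [mul_assoc]
  exact hkraus.trans (mul_le_of_le_one_right (norm_nonneg O) norm_one_le_one)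

theorem norm_osc_le (O : 𝒜) : ‖osc a O‖ ≤ 2 * ‖O‖ := by
  rw [osc_apply]
  linarith [norm_sub_le O (condExp a O), ha.norm_condExp_le O]

theorem commutesWith_condExp (O : 𝒜) : CommutesWith (condExp a O) a := by
  constructor <;>
  simp only [Commute, SemiconjBy, condExp_apply, mul_add, add_mul, mul_assoc, ha.word_rules,
    mul_zero, add_zero, zero_add]

theorem condExp_of_commutesWith {A : 𝒜} (h : CommutesWith A a) : condExp a A = A := by
  have hone : condExp a 1 = 1 := by
    simp only [condExp_apply, mul_one, mul_assoc, ha.word_rules, ha.car]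
  simpa only [mul_one, hone] using condExp_mul_left h 1

theorem osc_of_commutesWith {A : 𝒜} (h : CommutesWith A a) : osc a A = 0 := by
  rw [osc_apply, ha.condExp_of_commutesWith h, sub_self]

theorem matrixUnit_expansion (T : 𝒜) :
    T = a * star a * condExp a T + a * condExp a (T * star a) + star a * condExp a (a * T)
      + star a * a * condExp a (a * T * star a) := by
  have h : T = (a * star a + star a * a) * T * (a * star a + star a * a) := by
    rw [ha.car, one_mul, mul_one]
  conv_lhs => rw [h]
  simp only [condExp_apply, mul_add, add_mul, mul_assoc, ha.word_rules, mul_zero, add_zero,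
    zero_add]
  abel

theorem osc_dualDissipator_self (O : 𝒜) :
    osc a (dualDissipator a a O) = dualDissipator a a (osc a O) := by
  have hcond : condExp a (dualDissipator a a O) = 0 := by
    simp only [condExp_apply, dualDissipator, mul_sub, sub_mul, smul_add, smul_mul_assoc,
      mul_smul_comm, mul_add, mul_assoc, ha.word_rules, mul_zero, add_zero, zero_add,
      smul_zero, sub_zero, zero_mul]
  have hdiss : dualDissipator a a (condExp a O) = 0 :=
    dualDissipator_eq_zero (ha.commutesWith_condExp O).2 (ha.commutesWith_condExp O).1
  rw [osc_apply, hcond, osc_apply, dualDissipator_sub, hdiss]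

-- The matrix units `|0⟩⟨1|`, `|1⟩⟨0|` and `|1⟩⟨1| - |0⟩⟨0|` decay at the rates `1/2`, `1/2`, `1`.
theorem dualDissipator_osc (O : 𝒜) : dualDissipator a a (osc a O) =
    -((3 / 4 : ℂ) • osc a O + (1 / 4 : ℂ) • (parity a * osc a O * parity a)) := by
  have hO : O = (a * star a + star a * a) * O * (a * star a + star a * a) := by
    rw [ha.car, one_mul, mul_one]
  have hosc : osc a O = a * (star a * (O * (star a * a))) + star a * (a * (O * (a * star a)))
      + star a * (a * (O * (star a * a))) - star a * (O * a) := by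
    rw [osc_apply, condExp_apply]
    nth_rewrite 1 [hO]
    simp only [mul_add, add_mul, mul_assoc]
    abel
  simp only [hosc, parity, dualDissipator, mul_sub, sub_mul, smul_add, smul_sub, mul_add, add_mul,
    mul_assoc, ha.word_rules, mul_zero, add_zero, zero_add, sub_zero, zero_sub, neg_mul]
  module

theorem star_parity_mul_parity : star (parity a) * parity a = 1 := by
  rw [← ha.car]
  simp only [parity, star_sub, star_mul, star_star, mul_sub, sub_mul, mul_assoc, ha.word_rules,
    mul_zero, sub_zero, zero_sub]
  abel

theorem norm_parity_le : ‖parity a‖ ≤ 1 := by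
  have hsq : ‖parity a‖ * ‖parity a‖ ≤ 1 := by
    rw [← CStarRing.norm_star_mul_self, ha.star_parity_mul_parity]
    exact norm_one_le_one
  nlinarith [norm_nonneg (parity a)]

theorem norm_parity_conj_le (O : 𝒜) : ‖parity a * O * parity a‖ ≤ ‖O‖ :=
  calc ‖parity a * O * parity a‖ ≤ ‖parity a‖ * ‖O‖ * ‖parity a‖ := norm_mul₃_le
    _ ≤ 1 * ‖O‖ * 1 := by gcongr <;> exact ha.norm_parity_le
    _ = ‖O‖ := by ring

theorem norm_add_star_le : ‖a + star a‖ ≤ 1 := by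
  have hsq : ‖a + star a‖ * ‖a + star a‖ ≤ 1 := by
    rw [← CStarRing.norm_star_mul_self, star_add, star_star, add_comm (star a)]
    simp only [mul_add, add_mul, ha.word_rules, zero_add, add_zero]
    rw [add_comm (star a * a), ha.car]
    exact norm_one_le_one
  nlinarith [norm_nonneg (a + star a)]

theorem norm_le_one : ‖a‖ ≤ 1 := by
  have hproj : ‖star a * a‖ * ‖star a * a‖ = ‖star a * a‖ := by
    rw [← CStarRing.norm_star_mul_self]
    simp only [star_mul, star_star, mul_assoc, ha.word_rules]
  have hsq : ‖star a * a‖ ≤ 1 := by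
    by_contra! hlt
    nlinarith
  rw [CStarRing.norm_star_mul_self] at hsq
  nlinarith [norm_nonneg a]

end IsLowering

end OneSpin

section Spins

variable {𝒜 : Type*} [CStarAlgebra 𝒜] {Λ : Type*}

/-- The operators `k i` are the lowering operators of a system of spins, on which they and their
adjoints act irreducibly. Working with these relations replaces tensor products throughout. -/
structure IsSpinSystem (k : Λ → 𝒜) : Prop where
  lowering : ∀ i, IsLowering (k i)
  commutes : ∀ i j, i ≠ j → CommutesWith (k i) (k j)
  irreducible : ∀ A, (∀ i, CommutesWith A (k i)) → ∃ c : ℂ, A = c • 1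

/-- `A` acts only on the spins in `S`. -/
def LocalizedOn (k : Λ → 𝒜) (S : Finset Λ) (A : 𝒜) : Prop := ∀ i, i ∉ S → CommutesWith A (k i)

theorem LocalizedOn.mono {k : Λ → 𝒜} {S S' : Finset Λ} {A : 𝒜} (h : LocalizedOn k S A)
    (hS : S ⊆ S') : LocalizedOn k S' A :=
  fun i hi => h i fun hi' => hi (hS hi')

namespace IsSpinSystem

variable {k : Λ → 𝒜} (hk : IsSpinSystem k)
include hk

theorem commutesWith_condExp {A : 𝒜} {i : Λ} (j : Λ) (h : CommutesWith A (k i)) :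
    CommutesWith (condExp (k j) A) (k i) := by
  rcases eq_or_ne j i with rfl | hji
  · exact (hk.lowering j).commutesWith_condExp A
  · exact h.condExp (hk.commutes j i hji)

theorem commute_of_localizedOn (S : Finset Λ) : ∀ {T O : 𝒜}, LocalizedOn k S T →
    (∀ i ∈ S, CommutesWith O (k i)) → Commute T O := by
  classical
  induction S using Finset.induction_on with
  | empty =>
    intro T O hT _
    obtain ⟨c, rfl⟩ := hk.irreducible T fun i => hT i (Finset.notMem_empty i)
    exact (Commute.one_left O).smul_left c
  | insert a S ha ih =>
    intro T O hT hO
    obtain ⟨hOa, hOa'⟩ := hO a (Finset.mem_insert_self a S)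
    have hka : LocalizedOn k (insert a S) (k a) := fun i hi =>
      hk.commutes a i fun h => hi (h ▸ Finset.mem_insert_self a S)
    have hcond : ∀ U, LocalizedOn k (insert a S) U → Commute (condExp (k a) U) O := by
      refine fun U hU => ih (fun i hi => ?_) fun i hi => hO i (Finset.mem_insert_of_mem hi)
      rcases eq_or_ne i a with rfl | hia
      · exact (hk.lowering i).commutesWith_condExp U
      · exact hk.commutesWith_condExp a (hU i (by simp [hia, hi]))
    rw [(hk.lowering a).matrixUnit_expansion T]
    refine ((Commute.add_left ?_ ?_).add_left ?_).add_left ?_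
    · exact (hOa.symm.mul_left hOa'.symm).mul_left (hcond T hT)
    · exact hOa.symm.mul_left (hcond _ fun i hi => (hT i hi).mul (hka i hi).star)
    · exact hOa'.symm.mul_left (hcond _ fun i hi => (hka i hi).mul (hT i hi))
    · exact (hOa'.symm.mul_left hOa.symm).mul_left
        (hcond _ fun i hi => ((hka i hi).mul (hT i hi)).mul (hka i hi).star)

theorem exists_commutesWith_norm_sub_le (S : Finset Λ) (O : 𝒜) :
    ∃ O' : 𝒜, (∀ i ∈ S, CommutesWith O' (k i)) ∧ ‖O - O'‖ ≤ ∑ i ∈ S, ‖osc (k i) O‖ := by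
  classical
  induction S using Finset.induction_on with
  | empty => exact ⟨O, by simp, by simp⟩
  | insert a S ha ih =>
    obtain ⟨O', hcomm, hnorm⟩ := ih
    refine ⟨condExp (k a) O', fun i hi => ?_, ?_⟩
    · rcases Finset.mem_insert.1 hi with rfl | hi
      · exact (hk.lowering i).commutesWith_condExp O'
      · exact hk.commutesWith_condExp a (hcomm i hi)
    · have hsplit : O - condExp (k a) O' = osc (k a) O + condExp (k a) (O - O') := by
        rw [osc_apply, map_sub]; abel
      rw [Finset.sum_insert ha, hsplit]
      exact norm_add_le_of_le le_rfl (((hk.lowering a).norm_condExp_le _).trans hnorm)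

-- Removing the spins one at a time, in the order of increasing `d`, splits off the pieces `T m`.
theorem exists_localized_decomposition (d : Λ → ℕ) (V : 𝒜) (S : Finset Λ) :
    ∃ (T : Λ → 𝒜) (c : 𝒜), V = c + ∑ m ∈ S, T m ∧ (∀ m ∈ S, ‖T m‖ ≤ ‖osc (k m) V‖) ∧
      (∀ m ∈ S, ∀ i ∈ S, d m < d i → CommutesWith (T m) (k i)) ∧ ‖c‖ ≤ ‖V‖ ∧
      ∀ i ∈ S, CommutesWith c (k i) := by
  classical
  induction S using Finset.induction_on_max_value d with
  | empty => exact ⟨fun _ => 0, V, by simp, by simp, by simp, le_rfl, by simp⟩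
  | insert a S ha hmax ih =>
    obtain ⟨T, c, hV, hT, hTcomm, hc, hccomm⟩ := ih
    have hne : ∀ m ∈ S, m ≠ a := fun m hm h => ha (h ▸ hm)
    refine ⟨fun m => if m = a then osc (k a) V else condExp (k a) (T m), condExp (k a) c,
      ?_, fun m hm => ?_, fun m hm i hi hd => ?_, ((hk.lowering a).norm_condExp_le _).trans hc,
      fun i hi => ?_⟩
    · rw [Finset.sum_insert ha, if_pos rfl,
        Finset.sum_congr rfl fun m hm => if_neg (hne m hm), ← map_sum, add_left_comm, ← map_add,
        ← hV, osc_apply, sub_add_cancel]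
    · rcases Finset.mem_insert.1 hm with rfl | hm
      · simp
      · simp only [if_neg (hne m hm)]
        exact ((hk.lowering a).norm_condExp_le _).trans (hT m hm)
    · rcases Finset.mem_insert.1 hm with rfl | hm
      · rcases Finset.mem_insert.1 hi with rfl | hi
        · exact absurd hd (lt_irrefl _)
        · exact absurd (hmax i hi) (not_le.2 hd)
      · simp only [if_neg (hne m hm)]
        rcases Finset.mem_insert.1 hi with rfl | hi
        · exact (hk.lowering i).commutesWith_condExp _
        · exact hk.commutesWith_condExp a (hTcomm m hm i hi hd)
    · rcases Finset.mem_insert.1 hi with rfl | hi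
      · exact (hk.lowering i).commutesWith_condExp _
      · exact hk.commutesWith_condExp a (hccomm i hi)

end IsSpinSystem

end Spins

section Locality

variable {𝒜 : Type*} [CStarAlgebra 𝒜] {Λ : Type*} {k : Λ → 𝒜}

namespace IsSpinSystem

variable (hk : IsSpinSystem k)
include hk

theorem dualDissipator_eq_zero_of_localizedOn {S : Finset Λ} {T T' O : 𝒜} (hT : LocalizedOn k S T)
    (hT' : LocalizedOn k S T') (hO : ∀ i ∈ S, CommutesWith O (k i)) :
    dualDissipator T T' O = 0 :=
  dualDissipator_eq_zero
    (hk.commute_of_localizedOn S (fun i hi => (hT i hi).star) hO).symm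
    (hk.commute_of_localizedOn S hT' hO).symm

theorem norm_dualDissipator_le_sum_norm_osc {S : Finset Λ} {T T' : 𝒜} (hT : LocalizedOn k S T)
    (hT' : LocalizedOn k S T') (O : 𝒜) :
    ‖dualDissipator T T' O‖ ≤ 2 * ‖T‖ * ‖T'‖ * ∑ m ∈ S, ‖osc (k m) O‖ := by
  obtain ⟨O', hcomm, hnorm⟩ := hk.exists_commutesWith_norm_sub_le S O
  rw [← sub_zero (dualDissipator T T' O), ← hk.dualDissipator_eq_zero_of_localizedOn hT hT' hcomm,
    ← dualDissipator_sub]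
  exact (norm_dualDissipator_le _ _ _).trans (by gcongr)

theorem norm_dualDissipator_condExp_le {S : Finset Λ} {T T' : 𝒜} (hT : LocalizedOn k S T)
    (hT' : LocalizedOn k S T') (O : 𝒜) (i : Λ) :
    ‖dualDissipator T T' (condExp (k i) O)‖ ≤ 2 * ‖T‖ * ‖T'‖ * ∑ m ∈ S, ‖osc (k m) O‖ := by
  obtain ⟨O', hcomm, hnorm⟩ := hk.exists_commutesWith_norm_sub_le S O
  have hzero : dualDissipator T T' (condExp (k i) O') = 0 :=
    hk.dualDissipator_eq_zero_of_localizedOn hT hT' fun m hm =>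
      hk.commutesWith_condExp i (hcomm m hm)
  rw [← sub_zero (dualDissipator T T' (condExp (k i) O)), ← hzero, ← dualDissipator_sub,
    ← map_sub]
  refine (norm_dualDissipator_le _ _ _).trans ?_
  gcongr
  exact ((hk.lowering i).norm_condExp_le _).trans hnorm

end IsSpinSystem

variable [DecidableEq Λ]

/-- The defect at the site `i` in the commutation of `osc` with the dissipator of a jump operator
at `j`. At `i = j`, where commutation is not to be expected, it is `osc` of the dissipator. -/
def oscDefect (k : Λ → 𝒜) (j : Λ) (S T O : 𝒜) (i : Λ) : 𝒜 :=
  osc (k i) (dualDissipator S T O) - if i = j then 0 else dualDissipator S T (osc (k i) O)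

theorem oscDefect_add_left (k : Λ → 𝒜) (j : Λ) (S S' T O : 𝒜) (i : Λ) :
    oscDefect k j (S + S') T O i = oscDefect k j S T O i + oscDefect k j S' T O i := by
  simp only [oscDefect, dualDissipator_add_left, map_add]
  split_ifs <;> abel

theorem oscDefect_add_mid (k : Λ → 𝒜) (j : Λ) (S T T' O : 𝒜) (i : Λ) :
    oscDefect k j S (T + T') O i = oscDefect k j S T O i + oscDefect k j S T' O i := by
  simp only [oscDefect, dualDissipator_add_mid, map_add]
  split_ifs <;> abel

theorem oscDefect_sum (k : Λ → 𝒜) (j : Λ) {ι κ : Type*} (s : Finset ι) (t : Finset κ) (S : ι → 𝒜)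
    (T : κ → 𝒜) (O : 𝒜) (i : Λ) :
    oscDefect k j (∑ m ∈ s, S m) (∑ n ∈ t, T n) O i =
      ∑ m ∈ s, ∑ n ∈ t, oscDefect k j (S m) (T n) O i := by
  simp only [oscDefect, dualDissipator_sum_left, dualDissipator_sum_mid, map_sum]
  split_ifs <;> simp only [sub_zero, Finset.sum_sub_distrib] <;>
    simp only [Finset.sum_comm (s := t)]

namespace IsSpinSystem

variable (hk : IsSpinSystem k)
include hk

theorem norm_oscDefect_le {S : Finset Λ} {T T' : 𝒜} {j : Λ} (hj : j ∈ S)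
    (hT : LocalizedOn k S T) (hT' : LocalizedOn k S T') (O : 𝒜) (i : Λ) :
    ‖oscDefect k j T T' O i‖ ≤
      if i ∈ S then 4 * ‖T‖ * ‖T'‖ * ∑ m ∈ S, ‖osc (k m) O‖ else 0 := by
  have hdiss := hk.norm_dualDissipator_le_sum_norm_osc hT hT' O
  rw [oscDefect]
  by_cases hij : i = j
  · rw [if_pos hij, if_pos (hij ▸ hj), sub_zero]
    linarith [(hk.lowering i).norm_osc_le (dualDissipator T T' O)]
  rw [if_neg hij]
  split_ifs with hi
  · have hcommutator : osc (k i) (dualDissipator T T' O) - dualDissipator T T' (osc (k i) O) =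
        dualDissipator T T' (condExp (k i) O) - condExp (k i) (dualDissipator T T' O) := by
      rw [osc_apply, osc_apply, dualDissipator_sub]; abel
    rw [hcommutator]
    linarith [norm_sub_le (dualDissipator T T' (condExp (k i) O))
      (condExp (k i) (dualDissipator T T' O)), hk.norm_dualDissipator_condExp_le hT hT' O i,
      (hk.lowering i).norm_condExp_le (dualDissipator T T' O)]
  · rw [osc_dualDissipator (hT i hi) (hT' i hi), sub_self, norm_zero]

theorem osc_dualDissipator_eq (i j : Λ) (K O : 𝒜) :
    osc (k i) (dualDissipator K K O) =
      (if i = j then dualDissipator (k i) (k i) (osc (k i) O)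
        else dualDissipator K K (osc (k i) O)) +
      (oscDefect k j K K O i - oscDefect k j (k j) (k j) O i) := by
  rcases eq_or_ne i j with rfl | hij
  · simp only [oscDefect, if_true, sub_zero, (hk.lowering i).osc_dualDissipator_self]
    abel
  · have hcomm := hk.commutes j i hij.symm
    simp only [oscDefect, if_neg hij, osc_dualDissipator hcomm hcomm]
    abel

end IsSpinSystem

end Locality

section Contraction

variable {𝒜 : Type*} [CStarAlgebra 𝒜] {Λ : Type*} [Fintype Λ] {k : Λ → 𝒜}

/-- A finite set with a distance for which the balls grow at most polynomially. -/
structure HasPolyGrowth (d : Λ → Λ → ℕ) (q : ℕ) (Γ : ℝ) : Prop where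
  self : ∀ i, d i i = 0
  symm : ∀ i j, d i j = d j i
  triangle : ∀ i j m, d i m ≤ d i j + d j m
  sum_le : ∀ j, ∑ i, ((1 + (d i j : ℝ)) ^ q)⁻¹ ≤ Γ

/-- The ball of radius `r` around `j`. -/
def ballOf (d : Λ → Λ → ℕ) (j : Λ) (r : ℕ) : Finset Λ := Finset.univ.filter fun i => d i j ≤ r

theorem mem_ballOf {d : Λ → Λ → ℕ} {i j : Λ} {r : ℕ} : i ∈ ballOf d j r ↔ d i j ≤ r := by
  simp [ballOf]

theorem ballOf_mono (d : Λ → Λ → ℕ) (j : Λ) {r r' : ℕ} (h : r ≤ r') :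
    ballOf d j r ⊆ ballOf d j r' :=
  fun _ hi => mem_ballOf.2 ((mem_ballOf.1 hi).trans h)

theorem sum_ballOf_le (d : Λ → Λ → ℕ) (q : ℕ) (j : Λ) (r : ℕ) {w : Λ → ℝ} (hw : ∀ m, 0 ≤ w m) :
    ∑ m ∈ ballOf d j r, w m ≤ (1 + (r : ℝ)) ^ q * ∑ m, w m * ((1 + (d m j : ℝ)) ^ q)⁻¹ := by
  rw [Finset.mul_sum]
  refine (Finset.sum_le_sum fun m hm => ?_).trans
    (Finset.sum_le_univ_sum_of_nonneg fun m => mul_nonneg (by positivity)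
      (mul_nonneg (hw m) (by positivity)))
  have hd : (d m j : ℝ) ≤ r := by exact_mod_cast mem_ballOf.1 hm
  rw [← div_eq_mul_inv, mul_div_assoc', le_div_iff₀ (by positivity), mul_comm]
  gcongr
  exact hw m

namespace HasPolyGrowth

variable {d : Λ → Λ → ℕ} {q : ℕ} {Γ : ℝ} (hd : HasPolyGrowth d q Γ)
include hd

theorem nonneg (j : Λ) : 0 ≤ Γ :=
  (Finset.sum_nonneg fun _ _ => by positivity).trans (hd.sum_le j)

theorem card_ballOf_le (j : Λ) (r : ℕ) : ((ballOf d j r).card : ℝ) ≤ Γ * (1 + (r : ℝ)) ^ q :=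
  calc ((ballOf d j r).card : ℝ) = ∑ _i ∈ ballOf d j r, (1 : ℝ) := by simp
    _ ≤ (1 + (r : ℝ)) ^ q * ∑ i, 1 * ((1 + (d i j : ℝ)) ^ q)⁻¹ :=
        sum_ballOf_le d q j r fun _ => zero_le_one
    _ ≤ (1 + (r : ℝ)) ^ q * Γ := by
        simp only [one_mul]
        gcongr
        exact hd.sum_le j
    _ = Γ * (1 + (r : ℝ)) ^ q := mul_comm _ _

end HasPolyGrowth

/-- The operator `V` is a sum of operators `T m` on the balls around `j` through the sites `m`,
with `p`-th moment `∑ (1 + d m j) ^ p ‖T m‖` at most `x`. -/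
def IsQuasilocal (k : Λ → 𝒜) (d : Λ → Λ → ℕ) (p : ℕ) (j : Λ) (x : ℝ) (V : 𝒜) : Prop :=
  ∃ T : Λ → 𝒜, V = ∑ m, T m ∧ (∀ m, LocalizedOn k (ballOf d j (d m j)) (T m)) ∧
    ∑ m, (1 + (d m j : ℝ)) ^ p * ‖T m‖ ≤ x

theorem IsQuasilocal.nonneg {d : Λ → Λ → ℕ} {p : ℕ} {j : Λ} {x : ℝ} {V : 𝒜}
    (h : IsQuasilocal k d p j x V) : 0 ≤ x := by
  obtain ⟨T, -, -, hx⟩ := h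
  exact (Finset.sum_nonneg fun _ _ => by positivity).trans hx

/-- The sum of the oscillations of `O`, weighted by the distance of the sites from `j`. -/
def weightedOsc (k : Λ → 𝒜) (d : Λ → Λ → ℕ) (q : ℕ) (j : Λ) (O : 𝒜) : ℝ :=
  ∑ m, ‖osc (k m) O‖ * ((1 + (d m j : ℝ)) ^ q)⁻¹

theorem weightedOsc_nonneg (k : Λ → 𝒜) (d : Λ → Λ → ℕ) (q : ℕ) (j : Λ) (O : 𝒜) :
    0 ≤ weightedOsc k d q j O :=
  Finset.sum_nonneg fun _ _ => by positivity

namespace IsSpinSystem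

variable (hk : IsSpinSystem k)
include hk

theorem isQuasilocal_lowering {d : Λ → Λ → ℕ} {q : ℕ} {Γ : ℝ} (hd : HasPolyGrowth d q Γ) (p : ℕ)
    (j : Λ) : IsQuasilocal k d p j 1 (k j) := by
  classical
  refine ⟨Pi.single j (k j), by simp, fun m i hi => ?_, ?_⟩
  · rcases eq_or_ne m j with rfl | hmj
    · rw [Pi.single_eq_same]
      refine hk.commutes m i fun hmi => hi ?_
      rw [← hmi, mem_ballOf]
    · rw [Pi.single_eq_of_ne hmj]
      exact ⟨Commute.zero_left _, Commute.zero_left _⟩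
  · rw [Finset.sum_eq_single j (fun m _ hm => by simp [hm]) (by simp)]
    simpa [hd.self] using (hk.lowering j).norm_le_one

variable [DecidableEq Λ]

theorem isQuasilocal_of_osc {d : Λ → Λ → ℕ} {q : ℕ} {Γ : ℝ} (hd : HasPolyGrowth d q Γ) (p : ℕ)
    (j : Λ) (V : 𝒜) :
    IsQuasilocal k d p j
      (3 * ‖V‖ + ∑ m ∈ Finset.univ.erase j, (1 + (d m j : ℝ)) ^ p * ‖osc (k m) V‖) V := by
  obtain ⟨T, c, hV, hT, hTcomm, hc, hccomm⟩ :=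
    hk.exists_localized_decomposition (fun i => d i j) V Finset.univ
  simp only [Finset.mem_univ, forall_const] at hT hTcomm hccomm
  refine ⟨T + Pi.single j c, ?_, fun m i hi => ?_, ?_⟩
  · simp only [Pi.add_apply, Finset.sum_add_distrib, Finset.sum_pi_single', Finset.mem_univ,
      if_true, hV, add_comm]
  · rw [mem_ballOf, not_le] at hi
    refine (hTcomm m i hi).add ?_
    rcases eq_or_ne m j with rfl | hmj
    · simpa using hccomm i
    · rw [Pi.single_eq_of_ne hmj]
      exact ⟨Commute.zero_left _, Commute.zero_left _⟩
  · rw [← Finset.add_sum_erase _ _ (Finset.mem_univ j)]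
    refine add_le_add ?_ (Finset.sum_le_sum fun m hm => ?_)
    · simp only [hd.self, Pi.add_apply, Pi.single_eq_same, Nat.cast_zero, add_zero, one_pow,
        one_mul]
      linarith [norm_add_le (T j) c, hT j, (hk.lowering j).norm_osc_le V]
    · rw [Pi.add_apply, Pi.single_eq_of_ne (Finset.ne_of_mem_erase hm), add_zero]
      gcongr
      exact hT m

theorem isQuasilocal_sub_lowering {d : Λ → Λ → ℕ} {q : ℕ} {Γ : ℝ} (hd : HasPolyGrowth d q Γ)
    (p : ℕ) (j : Λ) {K : 𝒜} {x : ℝ}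
    (hx : 3 * ‖K - k j‖ + ∑ m ∈ Finset.univ.erase j,
      (1 + (d m j : ℝ)) ^ p * ‖osc (k m) K‖ ≤ x) :
    IsQuasilocal k d p j x (K - k j) := by
  obtain ⟨T, hsum, hloc, hmoment⟩ := hk.isQuasilocal_of_osc hd p j (K - k j)
  refine ⟨T, hsum, hloc, hmoment.trans (le_of_eq_of_le ?_ hx)⟩
  congr 1
  refine Finset.sum_congr rfl fun m hm => ?_
  rw [map_sub, (hk.lowering m).osc_of_commutesWith
    (hk.commutes j m (Finset.ne_of_mem_erase hm).symm), sub_zero]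

theorem sum_norm_oscDefect_le_of_localizedOn {d : Λ → Λ → ℕ} {q : ℕ} {Γ : ℝ}
    (hd : HasPolyGrowth d q Γ) (j : Λ) {T T' : 𝒜} {r r' : ℕ}
    (hT : LocalizedOn k (ballOf d j r) T) (hT' : LocalizedOn k (ballOf d j r') T') (O : 𝒜) :
    ∑ i, ‖oscDefect k j T T' O i‖ ≤ 4 * Γ * weightedOsc k d q j O *
      ((1 + (r : ℝ)) ^ (2 * q) * ‖T‖) * ((1 + (r' : ℝ)) ^ (2 * q) * ‖T'‖) := by
  set R : ℕ := max r r'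
  set U := weightedOsc k d q j O
  have hΓ := hd.nonneg j
  have hU : 0 ≤ U := weightedOsc_nonneg k d q j O
  have hj : j ∈ ballOf d j R := by rw [mem_ballOf, hd.self]; exact Nat.zero_le R
  have hRle : 1 + (R : ℝ) ≤ (1 + (r : ℝ)) * (1 + (r' : ℝ)) := by
    have : (R : ℝ) ≤ r + r' := by exact_mod_cast max_le_add_of_nonneg r.zero_le r'.zero_le
    nlinarith [mul_nonneg (Nat.cast_nonneg (α := ℝ) r) (Nat.cast_nonneg (α := ℝ) r')]
  calc ∑ i, ‖oscDefect k j T T' O i‖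
      ≤ ∑ i, if i ∈ ballOf d j R then
          4 * ‖T‖ * ‖T'‖ * ∑ m ∈ ballOf d j R, ‖osc (k m) O‖ else 0 :=
        Finset.sum_le_sum fun i _ => hk.norm_oscDefect_le hj
          (hT.mono (ballOf_mono d j (le_max_left r r')))
          (hT'.mono (ballOf_mono d j (le_max_right r r'))) O i
    _ = (ballOf d j R).card * (4 * ‖T‖ * ‖T'‖ * ∑ m ∈ ballOf d j R, ‖osc (k m) O‖) := by
        rw [Finset.sum_ite_mem, Finset.univ_inter, Finset.sum_const, nsmul_eq_mul]
    _ ≤ Γ * (1 + (R : ℝ)) ^ q * (4 * ‖T‖ * ‖T'‖ * ((1 + (R : ℝ)) ^ q * U)) := by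
        gcongr
        · exact hd.card_ballOf_le j R
        · exact sum_ballOf_le d q j R fun m => norm_nonneg _
    _ = 4 * Γ * U * (‖T‖ * ‖T'‖) * (1 + (R : ℝ)) ^ (2 * q) := by ring
    _ ≤ 4 * Γ * U * (‖T‖ * ‖T'‖) * ((1 + (r : ℝ)) * (1 + (r' : ℝ))) ^ (2 * q) := by gcongr
    _ = _ := by rw [mul_pow]; ring

theorem sum_norm_oscDefect_le_of_isQuasilocal {d : Λ → Λ → ℕ} {q : ℕ} {Γ : ℝ}
    (hd : HasPolyGrowth d q Γ) {j : Λ} {V W : 𝒜} {x y : ℝ} (hV : IsQuasilocal k d (2 * q) j x V)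
    (hW : IsQuasilocal k d (2 * q) j y W) (O : 𝒜) :
    ∑ i, ‖oscDefect k j V W O i‖ ≤ 4 * Γ * weightedOsc k d q j O * (x * y) := by
  have hx₀ := hV.nonneg
  obtain ⟨S, rfl, hS, hx⟩ := hV
  obtain ⟨T, rfl, hT, hy⟩ := hW
  have hΓ := hd.nonneg j
  have hU := weightedOsc_nonneg k d q j O
  calc ∑ i, ‖oscDefect k j (∑ m, S m) (∑ n, T n) O i‖
      ≤ ∑ i, ∑ m, ∑ n, ‖oscDefect k j (S m) (T n) O i‖ := by
        refine Finset.sum_le_sum fun i _ => ?_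
        rw [oscDefect_sum]
        exact norm_sum_le_of_le _ fun m _ => norm_sum_le _ _
    _ = ∑ m, ∑ n, ∑ i, ‖oscDefect k j (S m) (T n) O i‖ := by
        rw [Finset.sum_comm]
        exact Finset.sum_congr rfl fun m _ => Finset.sum_comm
    _ ≤ ∑ m, ∑ n, 4 * Γ * weightedOsc k d q j O * ((1 + (d m j : ℝ)) ^ (2 * q) * ‖S m‖) *
          ((1 + (d n j : ℝ)) ^ (2 * q) * ‖T n‖) :=
        Finset.sum_le_sum fun m _ => Finset.sum_le_sum fun n _ =>
          hk.sum_norm_oscDefect_le_of_localizedOn hd j (hS m) (hT n) O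
    _ = 4 * Γ * weightedOsc k d q j O * ((∑ m, (1 + (d m j : ℝ)) ^ (2 * q) * ‖S m‖) *
          ∑ n, (1 + (d n j : ℝ)) ^ (2 * q) * ‖T n‖) := by
        rw [Finset.sum_mul_sum]
        simp only [Finset.mul_sum, mul_assoc]
    _ ≤ 4 * Γ * weightedOsc k d q j O * (x * y) := by
        gcongr

theorem sum_norm_oscDefect_sub_le {d : Λ → Λ → ℕ} {q : ℕ} {Γ : ℝ} (hd : HasPolyGrowth d q Γ)
    {j : Λ} {K : 𝒜} {x : ℝ} (hK : IsQuasilocal k d (2 * q) j x (K - k j)) (O : 𝒜) :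
    ∑ i, ‖oscDefect k j K K O i - oscDefect k j (k j) (k j) O i‖ ≤
      4 * Γ * (2 * x + x ^ 2) * weightedOsc k d q j O := by
  have hlow := hk.isQuasilocal_lowering hd (2 * q) j
  have hexpand : ∀ i, oscDefect k j K K O i - oscDefect k j (k j) (k j) O i =
      oscDefect k j (K - k j) (k j) O i + oscDefect k j (k j) (K - k j) O i +
        oscDefect k j (K - k j) (K - k j) O i := fun i => by
    rw [show oscDefect k j K K O i =
      oscDefect k j (k j + (K - k j)) (k j + (K - k j)) O i by rw [add_sub_cancel]]
    rw [oscDefect_add_left, oscDefect_add_mid, oscDefect_add_mid]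
    abel
  calc ∑ i, ‖oscDefect k j K K O i - oscDefect k j (k j) (k j) O i‖
      ≤ ∑ i, (‖oscDefect k j (K - k j) (k j) O i‖ + ‖oscDefect k j (k j) (K - k j) O i‖ +
          ‖oscDefect k j (K - k j) (K - k j) O i‖) :=
        Finset.sum_le_sum fun i _ => by rw [hexpand i]; exact norm_add₃_le
    _ ≤ 4 * Γ * weightedOsc k d q j O * (x * 1) + 4 * Γ * weightedOsc k d q j O * (1 * x) +
          4 * Γ * weightedOsc k d q j O * (x * x) := by
        rw [Finset.sum_add_distrib, Finset.sum_add_distrib]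
        exact add_le_add_three (hk.sum_norm_oscDefect_le_of_isQuasilocal hd hK hlow O)
          (hk.sum_norm_oscDefect_le_of_isQuasilocal hd hlow hK O)
          (hk.sum_norm_oscDefect_le_of_isQuasilocal hd hK hK O)
    _ = 4 * Γ * (2 * x + x ^ 2) * weightedOsc k d q j O := by ring

theorem sum_sum_norm_oscDefect_sub_le {d : Λ → Λ → ℕ} {q : ℕ} {Γ : ℝ}
    (hd : HasPolyGrowth d q Γ) {K : Λ → 𝒜} {x : ℝ}
    (hK : ∀ j, IsQuasilocal k d (2 * q) j x (K j - k j)) (O : 𝒜) :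
    ∑ i, ∑ j, ‖oscDefect k j (K j) (K j) O i - oscDefect k j (k j) (k j) O i‖ ≤
      4 * Γ ^ 2 * (2 * x + x ^ 2) * ∑ i, ‖osc (k i) O‖ := by
  rcases isEmpty_or_nonempty Λ with hΛ | ⟨⟨j₀⟩⟩
  · simp
  have hΓ := hd.nonneg j₀
  have hx := (hK j₀).nonneg
  calc ∑ i, ∑ j, ‖oscDefect k j (K j) (K j) O i - oscDefect k j (k j) (k j) O i‖
      ≤ ∑ j, 4 * Γ * (2 * x + x ^ 2) * weightedOsc k d q j O := by
        rw [Finset.sum_comm]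
        exact Finset.sum_le_sum fun j _ => hk.sum_norm_oscDefect_sub_le hd (hK j) O
    _ = 4 * Γ * (2 * x + x ^ 2) *
          ∑ m, ‖osc (k m) O‖ * ∑ j, ((1 + (d j m : ℝ)) ^ q)⁻¹ := by
        simp only [weightedOsc]
        rw [← Finset.mul_sum, Finset.sum_comm]
        simp only [Finset.mul_sum, hd.symm]
    _ ≤ 4 * Γ * (2 * x + x ^ 2) * ∑ m, ‖osc (k m) O‖ * Γ := by
        gcongr with m
        exact hd.sum_le m
    _ = 4 * Γ ^ 2 * (2 * x + x ^ 2) * ∑ i, ‖osc (k i) O‖ := by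
        rw [← Finset.sum_mul]; ring

-- The dissipator at `i` and the remaining dissipators are each given one half of the identity map.
theorem osc_add_smul_sum_dualDissipator (K : Λ → 𝒜) (h : ℝ) (O : 𝒜) (i : Λ) :
    osc (k i) (O + (h : ℂ) • ∑ j, dualDissipator (K j) (K j) O) =
      (1 / 2 : ℂ) • (osc (k i) O + ((2 * h : ℝ) : ℂ) •
        ∑ j ∈ Finset.univ.erase i, dualDissipator (K j) (K j) (osc (k i) O)) +
      (1 / 2 : ℂ) • (((1 - 3 * h / 2 : ℝ) : ℂ) • osc (k i) O -
        ((h / 2 : ℝ) : ℂ) • (parity (k i) * osc (k i) O * parity (k i))) +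
      (h : ℂ) • ∑ j, (oscDefect k j (K j) (K j) O i - oscDefect k j (k j) (k j) O i) := by
  have hothers : ∑ j ∈ Finset.univ.erase i, (if i = j then
      dualDissipator (k i) (k i) (osc (k i) O) else dualDissipator (K j) (K j) (osc (k i) O)) =
      ∑ j ∈ Finset.univ.erase i, dualDissipator (K j) (K j) (osc (k i) O) :=
    Finset.sum_congr rfl fun j hj => if_neg (Finset.ne_of_mem_erase hj).symm
  rw [map_add, map_smul, map_sum, Finset.sum_congr rfl fun j _ => hk.osc_dualDissipator_eq i j _ O,
    Finset.sum_add_distrib, ← Finset.add_sum_erase _ _ (Finset.mem_univ i), if_pos rfl, hothers,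
    (hk.lowering i).dualDissipator_osc]
  push_cast
  module

theorem norm_osc_add_smul_sum_dualDissipator_le (K : Λ → 𝒜) {h : ℝ} (h0 : 0 ≤ h)
    (h1 : h ≤ 1 / 2) (O : 𝒜) (i : Λ) :
    ‖osc (k i) (O + (h : ℂ) • ∑ j, dualDissipator (K j) (K j) O)‖ ≤
      (1 - h / 2 + (∑ j, ‖K j‖ ^ 2) ^ 2 * h ^ 2) * ‖osc (k i) O‖ +
        h * ∑ j, ‖oscDefect k j (K j) (K j) O i - oscDefect k j (k j) (k j) O i‖ := by
  set A := osc (k i) O with hA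
  have hhalf : ∀ B : 𝒜, ‖(1 / 2 : ℂ) • B‖ = 1 / 2 * ‖B‖ := fun B => by
    rw [norm_smul]; norm_num
  have hothers : ‖A + ((2 * h : ℝ) : ℂ) • ∑ j ∈ Finset.univ.erase i,
      dualDissipator (K j) (K j) A‖ ≤ (1 + (2 * h) ^ 2 / 2 * (∑ j, ‖K j‖ ^ 2) ^ 2) * ‖A‖ := by
    refine (norm_add_smul_sum_dualDissipator_le _ K A (by positivity)).trans ?_
    gcongr
    exact Finset.erase_subset _ _
  have hself : ‖((1 - 3 * h / 2 : ℝ) : ℂ) • A -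
      ((h / 2 : ℝ) : ℂ) • (parity (k i) * A * parity (k i))‖ ≤ (1 - h) * ‖A‖ := by
    refine (norm_sub_le _ _).trans ?_
    rw [norm_smul, norm_smul, Complex.norm_real, Complex.norm_real,
      Real.norm_of_nonneg (by linarith), Real.norm_of_nonneg (by positivity)]
    nlinarith [(hk.lowering i).norm_parity_conj_le A]
  have hdefect : ‖(h : ℂ) • ∑ j, (oscDefect k j (K j) (K j) O i - oscDefect k j (k j) (k j) O i)‖ ≤
      h * ∑ j, ‖oscDefect k j (K j) (K j) O i - oscDefect k j (k j) (k j) O i‖ := by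
    rw [norm_smul, Complex.norm_real, Real.norm_of_nonneg h0]
    gcongr
    exact norm_sum_le _ _
  rw [hk.osc_add_smul_sum_dualDissipator]
  refine norm_add₃_le.trans ?_
  rw [hhalf, hhalf, ← hA]
  linarith

omit [DecidableEq Λ] in
theorem sum_norm_osc_add_smul_sum_dualDissipator_le {d : Λ → Λ → ℕ} {q : ℕ} {Γ : ℝ}
    (hd : HasPolyGrowth d q Γ) {K : Λ → 𝒜} {x : ℝ}
    (hK : ∀ j, IsQuasilocal k d (2 * q) j x (K j - k j))
    (hsmall : 4 * Γ ^ 2 * (2 * x + x ^ 2) ≤ 1 / 4) {h : ℝ} (h0 : 0 ≤ h) (h1 : h ≤ 1 / 2) (O : 𝒜) :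
    ∑ i, ‖osc (k i) (O + (h : ℂ) • ∑ j, dualDissipator (K j) (K j) O)‖ ≤
      (1 - h / 4 + (∑ j, ‖K j‖ ^ 2) ^ 2 * h ^ 2) * ∑ i, ‖osc (k i) O‖ := by
  classical
  have hdefect :
      ∑ i, ∑ j, ‖oscDefect k j (K j) (K j) O i - oscDefect k j (k j) (k j) O i‖ ≤
        1 / 4 * ∑ i, ‖osc (k i) O‖ :=
    (hk.sum_sum_norm_oscDefect_sub_le hd hK O).trans (by gcongr)
  refine (Finset.sum_le_sum fun i _ =>
    hk.norm_osc_add_smul_sum_dualDissipator_le K h0 h1 O i).trans ?_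
  rw [Finset.sum_add_distrib, ← Finset.mul_sum, ← Finset.mul_sum]
  linarith [mul_le_mul_of_nonneg_left hdefect h0]

end IsSpinSystem

end Contraction

attribute [local instance] LieRing.ofAssociativeRing

section Evolution

variable {𝒜 : Type*} [CStarAlgebra 𝒜]

/-- The Heisenberg evolution `e^{iHs} A e^{-iHs}`. -/
def heisEvo (H : 𝒜) (s : ℝ) (A : 𝒜) : 𝒜 :=
  NormedSpace.exp ((Complex.I * (s : ℂ)) • H) * A *
    NormedSpace.exp ((-(Complex.I * (s : ℂ))) • H)

theorem exp_smul_mul_exp_neg_smul (z : ℂ) (H : 𝒜) :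
    NormedSpace.exp (z • H) * NormedSpace.exp ((-z) • H) = 1 := by
  let +nondep : NormedAlgebra ℚ 𝒜 := .restrictScalars ℚ ℂ 𝒜
  rw [neg_smul, ← NormedSpace.exp_add_of_commute (Commute.refl _).neg_right, add_neg_cancel,
    NormedSpace.exp_zero]

theorem heisEvo_zero (H A : 𝒜) : heisEvo H 0 A = A := by
  simp [heisEvo, NormedSpace.exp_zero]

theorem heisEvo_neg_heisEvo (H : 𝒜) (s : ℝ) (A : 𝒜) : heisEvo H (-s) (heisEvo H s A) = A := by
  have hinv := exp_smul_mul_exp_neg_smul (-(Complex.I * (s : ℂ))) H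
  rw [neg_neg] at hinv
  simp only [heisEvo, Complex.ofReal_neg, mul_neg, neg_neg]
  calc _ = (NormedSpace.exp ((-(Complex.I * (s : ℂ))) • H) *
        NormedSpace.exp ((Complex.I * (s : ℂ)) • H)) * A *
        (NormedSpace.exp ((-(Complex.I * (s : ℂ))) • H) *
        NormedSpace.exp ((Complex.I * (s : ℂ)) • H)) := by simp only [mul_assoc]
    _ = A := by rw [hinv, one_mul, mul_one]

theorem heisEvo_heisEvo_neg (H : 𝒜) (s : ℝ) (A : 𝒜) : heisEvo H s (heisEvo H (-s) A) = A := by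
  simpa only [neg_neg] using heisEvo_neg_heisEvo H (-s) A

theorem heisEvo_neg_left (H : 𝒜) (s : ℝ) (A : 𝒜) : heisEvo (-H) s A = heisEvo H (-s) A := by
  simp [heisEvo]

theorem heisEvo_sub (H : 𝒜) (s : ℝ) (A B : 𝒜) :
    heisEvo H s (A - B) = heisEvo H s A - heisEvo H s B := by
  simp only [heisEvo, mul_sub, sub_mul]

theorem heisEvo_smul (H : 𝒜) (s : ℝ) (c : ℂ) (A : 𝒜) :
    heisEvo H s (c • A) = c • heisEvo H s A := by
  simp only [heisEvo, mul_smul_comm, smul_mul_assoc]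

theorem heisEvo_lie (H : 𝒜) (s : ℝ) (A : 𝒜) : heisEvo H s ⁅H, A⁆ = ⁅H, heisEvo H s A⁆ := by
  have hcomm : ∀ z : ℂ, Commute H (NormedSpace.exp (z • H)) := fun z =>
    ((Commute.refl H).smul_right z).exp_right
  simp only [heisEvo, Ring.lie_def, mul_sub, sub_mul]
  congr 1
  · simp only [← mul_assoc, (hcomm _).eq]
  · simp only [mul_assoc, (hcomm _).eq]

theorem norm_exp_mul_I_smul_le {H : 𝒜} (hH : IsSelfAdjoint H) (s : ℝ) :
    ‖NormedSpace.exp ((Complex.I * (s : ℂ)) • H)‖ ≤ 1 := by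
  let +nondep : NormedAlgebra ℚ 𝒜 := .restrictScalars ℚ ℂ 𝒜
  have hskew : (Complex.I * (s : ℂ)) • H ∈ skewAdjoint 𝒜 := by
    rw [skewAdjoint.mem_iff, star_smul, hH.star_eq]
    simp
  have hunitary := NormedSpace.exp_mem_unitary_of_mem_skewAdjoint hskew
  rcases subsingleton_or_nontrivial 𝒜 with _ | _
  · rw [Subsingleton.elim (NormedSpace.exp ((Complex.I * (s : ℂ)) • H)) 0, norm_zero]
    exact zero_le_one
  · exact (CStarRing.norm_of_mem_unitary hunitary).le

theorem norm_heisEvo_le {H : 𝒜} (hH : IsSelfAdjoint H) (s : ℝ) (A : 𝒜) :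
    ‖heisEvo H s A‖ ≤ ‖A‖ := by
  have hleft := norm_exp_mul_I_smul_le hH s
  have hright := norm_exp_mul_I_smul_le hH (-s)
  rw [Complex.ofReal_neg, mul_neg] at hright
  calc ‖heisEvo H s A‖
      ≤ ‖NormedSpace.exp ((Complex.I * (s : ℂ)) • H)‖ * ‖A‖ *
        ‖NormedSpace.exp ((-(Complex.I * (s : ℂ))) • H)‖ := norm_mul₃_le
    _ ≤ 1 * ‖A‖ * 1 := by gcongr
    _ = ‖A‖ := by rw [one_mul, mul_one]

theorem norm_heisEvo {H : 𝒜} (hH : IsSelfAdjoint H) (s : ℝ) (A : 𝒜) :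
    ‖heisEvo H s A‖ = ‖A‖ :=
  le_antisymm (norm_heisEvo_le hH s A) (by
    conv_lhs => rw [← heisEvo_neg_heisEvo H s A]
    exact norm_heisEvo_le hH _ _)

theorem hasDerivAt_exp_mul_smul (H : 𝒜) (c : ℂ) (s : ℝ) :
    HasDerivAt (fun s : ℝ => NormedSpace.exp ((c * (s : ℂ)) • H))
      (NormedSpace.exp ((c * (s : ℂ)) • H) * (c • H)) s := by
  have hsmul : ∀ s : ℝ, (c * (s : ℂ)) • H = s • (c • H) := fun s => by
    rw [mul_comm, mul_smul, Complex.coe_smul]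
  simpa only [hsmul] using hasDerivAt_exp_smul_const (𝕂 := ℝ) (c • H) s

theorem hasDerivAt_heisEvo (H : 𝒜) {f : ℝ → 𝒜} {f' : 𝒜} {s : ℝ} (hf : HasDerivAt f f' s) :
    HasDerivAt (fun s => heisEvo H s (f s)) (heisEvo H s (f' + Complex.I • ⁅H, f s⁆)) s := by
  have hderiv := ((hasDerivAt_exp_mul_smul H Complex.I s).mul hf).mul
    (hasDerivAt_exp_mul_smul H (-Complex.I) s)
  have hcomm : Commute H (NormedSpace.exp ((-Complex.I * (s : ℂ)) • H)) :=
    ((Commute.refl H).smul_right _).exp_right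
  simp only [neg_mul] at hderiv hcomm
  refine hderiv.congr_deriv ?_
  simp only [heisEvo, Ring.lie_def, Pi.mul_apply, mul_add, add_mul, mul_sub, sub_mul, smul_sub,
    mul_smul_comm, smul_mul_assoc, mul_assoc, ← hcomm.eq]
  module

theorem hasDerivAt_heisEvo_const (H A : 𝒜) (s : ℝ) :
    HasDerivAt (fun s => heisEvo H s A) (Complex.I • ⁅H, heisEvo H s A⁆) s := by
  have hderiv := hasDerivAt_heisEvo H (hasDerivAt_const s A)
  rwa [zero_add, heisEvo_smul, heisEvo_lie] at hderiv

theorem hasDerivAt_heisEvo_neg (H : 𝒜) {f : ℝ → 𝒜} {f' : 𝒜} {s : ℝ} (hf : HasDerivAt f f' s) :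
    HasDerivAt (fun s => heisEvo H (-s) (f s))
      (heisEvo H (-s) (f' - Complex.I • ⁅H, f s⁆)) s := by
  simpa only [heisEvo_neg_left, neg_lie, smul_neg, ← sub_eq_add_neg] using
    hasDerivAt_heisEvo (-H) hf

theorem continuous_heisEvo (H A : 𝒜) : Continuous fun s => heisEvo H s A :=
  continuous_iff_continuousAt.2 fun s => (hasDerivAt_heisEvo_const H A s).continuousAt

end Evolution

section LiebRobinson

variable {𝒜 : Type*} [CStarAlgebra 𝒜]

theorem norm_lie_le_two_mul (A B : 𝒜) : ‖⁅A, B⁆‖ ≤ 2 * ‖A‖ * ‖B‖ := by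
  rw [Ring.lie_def]
  linarith [norm_sub_le (A * B) (B * A), norm_mul_le A B, norm_mul_le B A, mul_comm ‖A‖ ‖B‖]

/-- The commutator of the maps `osc a` and `O ↦ [G, O]`, which drives the growth of the
oscillations under the Heisenberg evolution generated by `G`. -/
def oscLieDefect (a G O : 𝒜) : 𝒜 := osc a ⁅G, O⁆ - ⁅G, osc a O⁆

theorem oscLieDefect_eq (a G O : 𝒜) :
    oscLieDefect a G O = ⁅G, condExp a O⁆ - condExp a ⁅G, O⁆ := by
  rw [oscLieDefect, osc_apply, osc_apply, lie_sub]
  abel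

theorem CommutesWith.oscLieDefect_eq_zero {G a : 𝒜} (h : CommutesWith G a) (O : 𝒜) :
    oscLieDefect a G O = 0 := by
  rw [oscLieDefect_eq, Ring.lie_def, Ring.lie_def, map_sub, condExp_mul_left h,
    condExp_mul_right h, sub_self]

theorem oscLieDefect_add (a G G' O : 𝒜) :
    oscLieDefect a (G + G') O = oscLieDefect a G O + oscLieDefect a G' O := by
  simp only [oscLieDefect, add_lie, map_add]
  abel

theorem oscLieDefect_neg (a G O : 𝒜) : oscLieDefect a (-G) O = -oscLieDefect a G O := by
  simp only [oscLieDefect, neg_lie, map_neg]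
  abel

theorem oscLieDefect_sum {ι : Type*} (s : Finset ι) (a : 𝒜) (G : ι → 𝒜) (O : 𝒜) :
    oscLieDefect a (∑ i ∈ s, G i) O = ∑ i ∈ s, oscLieDefect a (G i) O :=
  map_sum (AddMonoidHom.mk' (oscLieDefect a · O) fun G G' => oscLieDefect_add a G G' O) G s

theorem hasDerivAt_heisEvo_neg_osc_heisEvo (a H X : 𝒜) (s : ℝ) :
    HasDerivAt (fun s => heisEvo H (-s) (osc a (heisEvo H s X)))
      (heisEvo H (-s) (Complex.I • oscLieDefect a H (heisEvo H s X))) s := by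
  have hosc : HasDerivAt (fun s => osc a (heisEvo H s X))
      (osc a (Complex.I • ⁅H, heisEvo H s X⁆)) s :=
    ((osc a).restrictScalars ℝ).hasFDerivAt.comp_hasDerivAt s (hasDerivAt_heisEvo_const H X s)
  refine (hasDerivAt_heisEvo_neg H hosc).congr_deriv ?_
  rw [map_smul, ← smul_sub, oscLieDefect]

theorem norm_sub_le_of_norm_deriv_le_mul_norm {E : Type*} [NormedAddCommGroup E]
    [NormedSpace ℝ E] {B B' : ℝ → E} {w δ t : ℝ} (hB : ∀ s, HasDerivAt B (B' s) s)
    (hB' : ∀ s, ‖B' s‖ ≤ w * ‖B s‖) (hB0 : ‖B 0‖ ≤ δ) (hw : 0 ≤ w) (ht : 0 ≤ t) :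
    ‖B t - B 0‖ ≤ δ * (w * t * Real.exp (w * t)) := by
  have hgrowth : ∀ s ∈ Set.Ico 0 t, ‖B s‖ ≤ δ * Real.exp (w * t) := fun s hs => by
    have hs' := norm_le_gronwallBound_of_norm_deriv_right_le (ε := 0)
      (fun s _ => (hB s).continuousAt.continuousWithinAt) (fun s _ => (hB s).hasDerivWithinAt)
      hB0 (fun s _ => by simpa using hB' s) s (Set.Ico_subset_Icc_self hs)
    rw [gronwallBound_ε0, sub_zero] at hs'
    have hδ : 0 ≤ δ := (norm_nonneg _).trans hB0
    exact hs'.trans (by have := hs.2.le; gcongr)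
  calc ‖B t - B 0‖ ≤ w * (δ * Real.exp (w * t)) * (t - 0) :=
        norm_image_sub_le_of_norm_deriv_le_segment' (fun s _ => (hB s).hasDerivWithinAt)
          (fun s hs => (hB' s).trans (mul_le_mul_of_nonneg_left (hgrowth s hs) hw)) t
          ⟨ht, le_rfl⟩
    _ = δ * (w * t * Real.exp (w * t)) := by ring

variable {Λ : Type*} {k : Λ → 𝒜}

theorem IsSpinSystem.norm_oscLieDefect_le (hk : IsSpinSystem k) {S : Finset Λ} {T : 𝒜}
    (hT : LocalizedOn k S T) (O : 𝒜) (i : Λ) :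
    ‖oscLieDefect (k i) T O‖ ≤ 4 * ‖T‖ * ∑ m ∈ S, ‖osc (k m) O‖ := by
  obtain ⟨O', hcomm, hnear⟩ := hk.exists_commutesWith_norm_sub_le S O
  have hlie : ∀ P, (∀ m ∈ S, CommutesWith P (k m)) → ⁅T, P⁆ = 0 := fun P hP =>
    (hk.commute_of_localizedOn S hT hP).lie_eq
  have hdefect : oscLieDefect (k i) T O = ⁅T, condExp (k i) (O - O')⁆ -
      condExp (k i) ⁅T, O - O'⁆ := by
    rw [oscLieDefect_eq, map_sub, lie_sub, lie_sub, hlie O' hcomm,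
      hlie _ fun m hm => hk.commutesWith_condExp i (hcomm m hm), sub_zero, sub_zero]
  calc ‖oscLieDefect (k i) T O‖
      ≤ 2 * ‖T‖ * ‖O - O'‖ + 2 * ‖T‖ * ‖O - O'‖ := by
        rw [hdefect]
        refine norm_sub_le_of_le ((norm_lie_le_two_mul _ _).trans ?_)
          (((hk.lowering i).norm_condExp_le _).trans (norm_lie_le_two_mul _ _))
        gcongr
        exact (hk.lowering i).norm_condExp_le _
    _ = 4 * ‖T‖ * ‖O - O'‖ := by ring
    _ ≤ 4 * ‖T‖ * ∑ m ∈ S, ‖osc (k m) O‖ := by gcongr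

variable [Fintype Λ] {d : Λ → Λ → ℕ} {q : ℕ} {Γ : ℝ} {g : Λ → 𝒜} {e : ℝ} {l r : ℕ}

/-- The terms `g n` have norm at most `e` and live on the balls of radius `r`, and at most `l` of
them act on any given spin. -/
structure IsLocalInteraction (k : Λ → 𝒜) (d : Λ → Λ → ℕ) (g : Λ → 𝒜) (e : ℝ) (l r : ℕ) :
    Prop where
  localized : ∀ n, LocalizedOn k (ballOf d n r) (g n)
  norm_le : ∀ n, ‖g n‖ ≤ e
  overlap : ∀ m, ∃ N : Finset Λ, N.card ≤ l ∧ ∀ n, n ∉ N → CommutesWith (g n) (k m)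

/-- The velocity in the Lieb–Robinson bound for an interaction as in `IsLocalInteraction`, on a
set where the balls of radius `r` have at most `Γ (1 + r) ^ q` elements. -/
def lrVelocity (Γ : ℝ) (q : ℕ) (e : ℝ) (l r : ℕ) : ℝ :=
  4 * Real.exp 1 * e * l * (Γ * (1 + (r : ℝ)) ^ q)

theorem lrVelocity_nonneg (hΓ : 0 ≤ Γ) (q : ℕ) (he : 0 ≤ e) (l r : ℕ) :
    0 ≤ lrVelocity Γ q e l r := by
  unfold lrVelocity
  positivity

theorem HasPolyGrowth.le_two_mul_of_mem_ballOf (hd : HasPolyGrowth d q Γ) {m m' n : Λ}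
    (hm : m ∈ ballOf d n r) (hm' : m' ∈ ballOf d n r) : d m m' ≤ 2 * r := by
  have htri := hd.triangle m n m'
  rw [hd.symm n m'] at htri
  have hdm := mem_ballOf.1 hm
  have hdm' := mem_ballOf.1 hm'
  omega

namespace IsLocalInteraction

variable (hg : IsLocalInteraction k d g e l r)
include hg

theorem nonneg (n : Λ) : 0 ≤ e := (norm_nonneg _).trans (hg.norm_le n)

theorem neg : IsLocalInteraction k d (fun n => -g n) e l r where
  localized n i hi := ⟨(hg.localized n i hi).1.neg_left, (hg.localized n i hi).2.neg_left⟩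
  norm_le n := (norm_neg _).trans_le (hg.norm_le n)
  overlap m := by
    obtain ⟨N, hN, hcomm⟩ := hg.overlap m
    exact ⟨N, hN, fun n hn => ⟨(hcomm n hn).1.neg_left, (hcomm n hn).2.neg_left⟩⟩

theorem norm_sum_le_of_commutesWith_eq_zero (m : Λ) {E : Type*} [NormedAddCommGroup E]
    {F : Λ → E} {x : ℝ} (hx : 0 ≤ x) (hF : ∀ n, ‖F n‖ ≤ x)
    (hF0 : ∀ n, CommutesWith (g n) (k m) → F n = 0) : ‖∑ n, F n‖ ≤ l * x := by
  obtain ⟨N, hN, hcomm⟩ := hg.overlap m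
  rw [← Finset.sum_subset (Finset.subset_univ N) fun n _ hn => hF0 n (hcomm n hn)]
  calc ‖∑ n ∈ N, F n‖ ≤ N.card • x :=
        (norm_sum_le _ _).trans (Finset.sum_le_card_nsmul _ _ _ fun n _ => hF n)
    _ ≤ l * x := by rw [nsmul_eq_mul]; gcongr

theorem norm_sum_oscLieDefect_le (hk : IsSpinSystem k) (hd : HasPolyGrowth d q Γ) (hr : 1 ≤ r)
    {j : Λ} {O : 𝒜} {M : ℝ}
    (hO : ∀ m, ‖osc (k m) O‖ ≤ Real.exp (-(d m j / (2 * r))) * M) (m : Λ) :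
    ‖∑ n, oscLieDefect (k m) (g n) O‖ ≤
      lrVelocity Γ q e l r * (Real.exp (-(d m j / (2 * r))) * M) := by
  have hr' : (0 : ℝ) < 2 * r := by positivity
  have hΓ := hd.nonneg j
  have he := hg.nonneg j
  have hM : 0 ≤ Real.exp (-(d m j / (2 * r))) * M := (norm_nonneg _).trans (hO m)
  have hterm : ∀ n, m ∈ ballOf d n r → ∀ m' ∈ ballOf d n r,
      ‖osc (k m') O‖ ≤ Real.exp 1 * (Real.exp (-(d m j / (2 * r))) * M) := by
    intro n hm m' hm'
    have hM0 : 0 ≤ M := nonneg_of_mul_nonneg_right hM (Real.exp_pos _)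
    refine (hO m').trans ?_
    rw [← mul_assoc, ← Real.exp_add]
    gcongr
    have htri : (d m j : ℝ) ≤ 2 * r + d m' j := by
      exact_mod_cast (hd.triangle m m' j).trans
        (Nat.add_le_add_right (hd.le_two_mul_of_mem_ballOf hm hm') _)
    rw [← sub_nonneg, show 1 + -((d m j : ℝ) / (2 * r)) - -(d m' j / (2 * r)) =
      (2 * r + d m' j - d m j) / (2 * r) by field_simp; ring]
    exact div_nonneg (by linarith) hr'.le
  refine (hg.norm_sum_le_of_commutesWith_eq_zero m (x := 4 * e * ((Γ * (1 + (r : ℝ)) ^ q) *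
    (Real.exp 1 * (Real.exp (-(d m j / (2 * r))) * M)))) (by positivity) (fun n => ?_)
    fun n hn => hn.oscLieDefect_eq_zero O).trans_eq (by rw [lrVelocity]; ring)
  by_cases hm : m ∈ ballOf d n r
  · have hsum : ∑ m' ∈ ballOf d n r, ‖osc (k m') O‖ ≤
        (Γ * (1 + (r : ℝ)) ^ q) * (Real.exp 1 * (Real.exp (-(d m j / (2 * r))) * M)) := by
      refine (Finset.sum_le_card_nsmul _ _ _ (hterm n hm)).trans ?_
      rw [nsmul_eq_mul]
      gcongr
      exact hd.card_ballOf_le n r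
    refine (hk.norm_oscLieDefect_le (hg.localized n) O m).trans ?_
    gcongr
    exact hg.norm_le n
  · rw [(hg.localized n m hm).oscLieDefect_eq_zero, norm_zero]
    positivity

-- Grönwall's inequality for `e^{-iHs} (osc (k m) (e^{iHs} X e^{-iHs})) e^{iHs}`, in the supremum
-- over `m` with the weights `exp (d m j / 2r)`.
theorem norm_osc_heisEvo_le_of_nonneg (hk : IsSpinSystem k) (hd : HasPolyGrowth d q Γ)
    (hr : 1 ≤ r) {H : 𝒜} (hH : IsSelfAdjoint H)
    (hHg : ∀ m O, oscLieDefect (k m) H O = ∑ n, oscLieDefect (k m) (g n) O) {j : Λ} {X : 𝒜}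
    (hX : LocalizedOn k {j} X) (hXn : ‖X‖ ≤ 1) {t : ℝ} (ht : 0 ≤ t) {m : Λ} (hm : m ≠ j) :
    ‖osc (k m) (heisEvo H t X)‖ ≤ 2 * (lrVelocity Γ q e l r * t *
      Real.exp (lrVelocity Γ q e l r * t - d m j / (2 * r))) := by
  set w := lrVelocity Γ q e l r
  have hw : 0 ≤ w := lrVelocity_nonneg (hd.nonneg j) q (hg.nonneg j) l r
  let weight : Λ → ℝ := fun m => Real.exp (d m j / (2 * r))
  have hinv : ∀ m, Real.exp (-(d m j / (2 * r))) = (weight m)⁻¹ := fun m => Real.exp_neg _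
  let B : ℝ → Λ → 𝒜 := fun s m => weight m • heisEvo H (-s) (osc (k m) (heisEvo H s X))
  let B' : ℝ → Λ → 𝒜 := fun s m =>
    weight m • heisEvo H (-s) (Complex.I • oscLieDefect (k m) H (heisEvo H s X))
  have hderiv : ∀ s, HasDerivAt B (B' s) s := fun s => hasDerivAt_pi.2 fun m =>
    (hasDerivAt_heisEvo_neg_osc_heisEvo (k m) H X s).const_smul (weight m)
  have hnorm : ∀ m s Y, ‖weight m • heisEvo H s Y‖ = weight m * ‖Y‖ := fun m s Y => by
    rw [norm_smul, norm_heisEvo hH, Real.norm_of_nonneg (Real.exp_nonneg _)]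
  have hB' : ∀ s, ‖B' s‖ ≤ w * ‖B s‖ := fun s => by
    refine (pi_norm_le_iff_of_nonneg (by positivity)).2 fun m => ?_
    have hdefect := hg.norm_sum_oscLieDefect_le hk hd hr (j := j) (O := heisEvo H s X)
      (M := ‖B s‖) (fun m => by
        rw [hinv, ← div_eq_inv_mul, le_div_iff₀' (Real.exp_pos _), ← hnorm m (-s)]
        exact norm_le_pi_norm (B s) m) m
    rw [hnorm, norm_smul, Complex.norm_I, one_mul, hHg, ← le_div_iff₀' (Real.exp_pos _)]
    exact hdefect.trans_eq (by rw [hinv]; ring)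
  have hB0_ne : ∀ m, m ≠ j → B 0 m = 0 := fun m hm => by
    simp only [B, neg_zero, heisEvo_zero]
    rw [(hk.lowering m).osc_of_commutesWith (hX m (by simpa using hm)), smul_zero]
  have hB0 : ‖B 0‖ ≤ 2 := (pi_norm_le_iff_of_nonneg zero_le_two).2 fun m => by
    rcases eq_or_ne m j with rfl | hmj
    · simp only [B, weight, neg_zero, heisEvo_zero, hd.self, Nat.cast_zero, zero_div,
        Real.exp_zero, one_smul]
      linarith [(hk.lowering m).norm_osc_le X]
    · rw [hB0_ne m hmj, norm_zero]
      exact zero_le_two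
  have hBt := (norm_le_pi_norm (B t - B 0) m).trans
    (norm_sub_le_of_norm_deriv_le_mul_norm hderiv hB' hB0 hw ht)
  rw [Pi.sub_apply, hB0_ne m hm, sub_zero, hnorm, ← le_div_iff₀' (Real.exp_pos _)] at hBt
  exact hBt.trans_eq (by rw [Real.exp_sub]; ring)

theorem norm_osc_heisEvo_le (hk : IsSpinSystem k) (hd : HasPolyGrowth d q Γ)
    (hr : 1 ≤ r) {H : 𝒜} (hH : IsSelfAdjoint H)
    (hHg : ∀ m O, oscLieDefect (k m) H O = ∑ n, oscLieDefect (k m) (g n) O) {j : Λ} {X : 𝒜}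
    (hX : LocalizedOn k {j} X) (hXn : ‖X‖ ≤ 1) (t : ℝ) {m : Λ} (hm : m ≠ j) :
    ‖osc (k m) (heisEvo H t X)‖ ≤ 2 * (lrVelocity Γ q e l r * |t| *
      Real.exp (lrVelocity Γ q e l r * |t| - d m j / (2 * r))) := by
  rcases le_total 0 t with ht | ht
  · rw [abs_of_nonneg ht]
    exact hg.norm_osc_heisEvo_le_of_nonneg hk hd hr hH hHg hX hXn ht hm
  · rw [abs_of_nonpos ht, ← neg_neg t, ← heisEvo_neg_left, neg_neg]
    refine hg.neg.norm_osc_heisEvo_le_of_nonneg hk hd hr hH.neg (fun m O => ?_) hX hXn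
      (neg_nonneg.2 ht) hm
    simp only [oscLieDefect_neg, hHg, Finset.sum_neg_distrib]

end IsLocalInteraction

end LiebRobinson

section WeakCoupling

variable {𝒜 : Type*} [CStarAlgebra 𝒜]

/-- The evolution `e^{-2is} a + e^{2is} a†` of `a + a†` generated by `-parity a`. -/
def freeEvo (a : 𝒜) (s : ℝ) : 𝒜 :=
  Complex.exp (-2 * Complex.I * s) • a + Complex.exp (2 * Complex.I * s) • star a

theorem freeEvo_zero (a : 𝒜) : freeEvo a 0 = a + star a := by
  simp [freeEvo]

theorem commutesWith_freeEvo {a b : 𝒜} (h : CommutesWith a b) (s : ℝ) :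
    CommutesWith (freeEvo a s) b :=
  ⟨(h.1.smul_left _).add_left (h.star.1.smul_left _),
    (h.2.smul_left _).add_left (h.star.2.smul_left _)⟩

theorem CommutesWith.parity {A a : 𝒜} (h : CommutesWith A a) : Commute A (parity a) :=
  (h.1.mul_right h.2).sub_right (h.2.mul_right h.1)

theorem commutesWith_parity {a b : 𝒜} (h : CommutesWith a b) : CommutesWith (parity a) b :=
  ⟨(h.1.mul_left h.star.1).sub_left (h.star.1.mul_left h.1),
    (h.2.mul_left h.star.2).sub_left (h.star.2.mul_left h.2)⟩

theorem isSelfAdjoint_parity (a : 𝒜) : IsSelfAdjoint (parity a) :=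
  (IsSelfAdjoint.mul_star_self a).sub (IsSelfAdjoint.star_mul_self a)

namespace IsLowering

variable {a : 𝒜} (ha : IsLowering a)
include ha

theorem oscLieDefect_parity (O : 𝒜) : oscLieDefect a (parity a) O = 0 := by
  rw [oscLieDefect_eq, (ha.commutesWith_condExp O).parity.symm.lie_eq, zero_sub, neg_eq_zero]
  simp only [condExp_apply, parity, Ring.lie_def, mul_sub, sub_mul, mul_assoc, ha.word_rules,
    mul_zero, sub_zero]
  abel

theorem lie_parity_self : ⁅parity a, a⁆ = (2 : ℂ) • a := by
  simp only [parity, Ring.lie_def, mul_sub, sub_mul, mul_assoc, ha.word_rules, mul_zero, sub_zero,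
    zero_sub, sub_neg_eq_add, two_smul]

theorem lie_parity_star : ⁅parity a, star a⁆ = (-2 : ℂ) • star a := by
  simp only [parity, Ring.lie_def, mul_sub, sub_mul, mul_assoc, ha.word_rules, mul_zero, sub_zero,
    zero_sub, neg_smul, two_smul]
  abel

theorem hasDerivAt_freeEvo (s : ℝ) :
    HasDerivAt (freeEvo a) (Complex.I • ⁅-parity a, freeEvo a s⁆) s := by
  have hexp : ∀ c : ℂ, HasDerivAt (fun s : ℝ => Complex.exp (c * s)) (c * Complex.exp (c * s)) s :=
    fun c => by
      simpa [mul_comm] using ((Complex.ofRealCLM.hasDerivAt (x := s)).const_mul c).cexp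
  refine (((hexp (-2 * Complex.I)).smul_const a).add
    ((hexp (2 * Complex.I)).smul_const (star a))).congr_deriv ?_
  have hlie : ∀ (c : ℂ) (A : 𝒜), ⁅parity a, c • A⁆ = c • ⁅parity a, A⁆ := fun c A => by
    simp only [Ring.lie_def, mul_smul_comm, smul_mul_assoc, smul_sub]
  rw [freeEvo, neg_lie, lie_add, hlie, hlie, ha.lie_parity_self, ha.lie_parity_star]
  module

theorem norm_freeEvo_le (s : ℝ) : ‖freeEvo a s‖ ≤ 2 := by
  have hexp : ∀ c : ℝ, ‖Complex.exp (c * Complex.I * s)‖ = 1 := fun c => by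
    simp [Complex.norm_exp]
  have hneg := hexp (-2)
  have hpos := hexp 2
  push_cast at hneg hpos
  refine (norm_add_le _ _).trans ?_
  rw [norm_smul, norm_smul, hneg, hpos, norm_star]
  linarith [ha.norm_le_one]

end IsLowering

theorem le_of_le_one_of_le_mul_exp {v x y : ℝ} (p : ℕ) (hx : 0 ≤ x) (hy : 0 ≤ y) (hv1 : v ≤ 1)
    (hv : v ≤ x * Real.exp (x - y)) :
    v ≤ Real.exp 1 * p.factorial * x * ((1 + x) / (1 + y)) ^ p := by
  have hfac : (1 : ℝ) ≤ p.factorial := by exact_mod_cast Nat.one_le_of_lt p.factorial_pos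
  have hexp : (1 : ℝ) ≤ Real.exp 1 := Real.one_le_exp zero_le_one
  rcases le_total y x with hyx | hxy
  · have hratio : 1 ≤ ((1 + x) / (1 + y)) ^ p :=
      one_le_pow₀ ((one_le_div (by positivity)).2 (by linarith))
    have hlinear : v ≤ Real.exp 1 * x := by
      rcases le_total 1 x with h | h
      · nlinarith
      · refine hv.trans ?_
        rw [mul_comm]
        gcongr
        linarith
    calc v ≤ Real.exp 1 * 1 * x * 1 := by linarith
      _ ≤ _ := by gcongr
  · have hdecay : Real.exp (x - y) ≤ Real.exp 1 * p.factorial * (1 / (1 + (y - x))) ^ p := by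
      have hpow := Real.pow_div_factorial_le_exp (1 + (y - x)) (by linarith) p
      rw [div_le_iff₀ (by positivity), mul_comm] at hpow
      rw [one_div, inv_pow, ← div_eq_mul_inv, le_div_iff₀ (by positivity)]
      calc _ ≤ Real.exp (x - y) * (p.factorial * Real.exp (1 + (y - x))) := by gcongr
        _ = p.factorial * (Real.exp (x - y) * Real.exp (1 + (y - x))) := by ring
        _ = _ := by rw [← Real.exp_add]; ring_nf
    have hratio : 1 / (1 + (y - x)) ≤ (1 + x) / (1 + y) := by
      rw [div_le_div_iff₀ (by positivity) (by positivity)]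
      nlinarith
    calc v ≤ x * Real.exp (x - y) := hv
      _ ≤ x * (Real.exp 1 * p.factorial * ((1 + x) / (1 + y)) ^ p) := by
          gcongr
          exact hdecay.trans (by gcongr)
      _ = _ := by ring

variable {Λ : Type*} {k : Λ → 𝒜}

theorem IsSpinSystem.localizedOn_add_star (hk : IsSpinSystem k) (j : Λ) :
    LocalizedOn k {j} (k j + star (k j)) := fun i hi =>
  have hji := hk.commutes j i fun h => hi (Finset.mem_singleton.2 h.symm)
  hji.add hji.star

variable [Fintype Λ]

namespace IsSpinSystem

variable (hk : IsSpinSystem k)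
include hk

theorem oscLieDefect_sum_parity (m : Λ) (O : 𝒜) :
    oscLieDefect (k m) (∑ i, parity (k i)) O = 0 := by
  rw [oscLieDefect_sum]
  refine Finset.sum_eq_zero fun i _ => ?_
  rcases eq_or_ne i m with rfl | him
  · exact (hk.lowering i).oscLieDefect_parity O
  · exact (commutesWith_parity (hk.commutes i m him)).oscLieDefect_eq_zero O

theorem lie_neg_sum_parity_freeEvo (j : Λ) (s : ℝ) :
    ⁅-∑ i, parity (k i), freeEvo (k j) s⁆ = ⁅-parity (k j), freeEvo (k j) s⁆ := by
  rw [neg_lie, neg_lie, sum_lie, Finset.sum_eq_single_of_mem j (Finset.mem_univ j)]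
  exact fun i _ hij =>
    (commutesWith_freeEvo (hk.commutes j i hij.symm) s).parity.symm.lie_eq

end IsSpinSystem

/-- The Hamiltonian `H = -∑ Z_i + ∑ g_n` with self-adjoint terms `g_n` as in
`IsLocalInteraction`. -/
structure IsWeaklyCoupled (k : Λ → 𝒜) (d : Λ → Λ → ℕ) (H : 𝒜) (g : Λ → 𝒜) (e : ℝ) (l r : ℕ) :
    Prop where
  eq : H = -∑ i, parity (k i) + ∑ n, g n
  selfAdjoint : ∀ n, IsSelfAdjoint (g n)
  interaction : IsLocalInteraction k d g e l r

namespace IsWeaklyCoupled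

variable {d : Λ → Λ → ℕ} {q : ℕ} {Γ : ℝ} {H : 𝒜} {g : Λ → 𝒜} {e : ℝ} {l r : ℕ}
  (hw : IsWeaklyCoupled k d H g e l r) (hk : IsSpinSystem k)
include hw

theorem isSelfAdjoint : IsSelfAdjoint H := by
  rw [hw.eq]
  exact (isSelfAdjoint_sum _ fun i _ => isSelfAdjoint_parity (k i)).neg.add
    (isSelfAdjoint_sum _ fun n _ => hw.selfAdjoint n)

include hk

theorem oscLieDefect_eq_sum (m : Λ) (O : 𝒜) :
    oscLieDefect (k m) H O = ∑ n, oscLieDefect (k m) (g n) O := by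
  rw [hw.eq, oscLieDefect_add, oscLieDefect_neg, hk.oscLieDefect_sum_parity, neg_zero, zero_add,
    oscLieDefect_sum]

theorem norm_osc_heisEvo_add_star_le (hd : HasPolyGrowth d q Γ) (hr : 1 ≤ r) (p : ℕ)
    (hv : lrVelocity Γ q e l r ≤ 1) {j m : Λ} (hm : m ≠ j) (s : ℝ) :
    ‖osc (k m) (heisEvo H s (k j + star (k j)))‖ ≤
      2 * Real.exp 1 * p.factorial * lrVelocity Γ q e l r * (2 * r) ^ p *
        ((1 + (d m j : ℝ)) ^ p)⁻¹ * (1 + |s|) ^ (p + 1) := by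
  set w := lrVelocity Γ q e l r
  set x := ‖osc (k m) (heisEvo H s (k j + star (k j)))‖
  have hw0 : 0 ≤ w := lrVelocity_nonneg (hd.nonneg j) q (hw.interaction.nonneg j) l r
  have hr' : (1 : ℝ) ≤ r := by exact_mod_cast hr
  have htrivial : x / 2 ≤ 1 := by
    linarith [(hk.lowering m).norm_osc_le (heisEvo H s (k j + star (k j))),
      norm_heisEvo_le hw.isSelfAdjoint s (k j + star (k j)), (hk.lowering j).norm_add_star_le]
  have hlr : x / 2 ≤ w * |s| * Real.exp (w * |s| - d m j / (2 * r)) := by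
    linarith [hw.interaction.norm_osc_heisEvo_le hk hd hr hw.isSelfAdjoint
      (hw.oscLieDefect_eq_sum hk) (hk.localizedOn_add_star j) (hk.lowering j).norm_add_star_le s hm]
  have hratio : (1 + w * |s|) / (1 + (d m j : ℝ) / (2 * r)) ≤
      (1 + |s|) * (2 * r) * (1 + (d m j : ℝ))⁻¹ := by
    rw [← div_eq_mul_inv, div_le_div_iff₀ (by positivity) (by positivity)]
    have htime : 1 + w * |s| ≤ 1 + |s| := by nlinarith [abs_nonneg s]
    have hdist : 1 + (d m j : ℝ) ≤ 2 * r * (1 + (d m j : ℝ) / (2 * r)) := by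
      rw [mul_add, mul_div_cancel₀ _ (by positivity)]
      linarith
    calc _ ≤ (1 + |s|) * (2 * r * (1 + (d m j : ℝ) / (2 * r))) := by gcongr
      _ = _ := by ring
  calc x = 2 * (x / 2) := by ring
    _ ≤ 2 * (Real.exp 1 * p.factorial * (w * |s|) *
        ((1 + |s|) * (2 * r) * (1 + (d m j : ℝ))⁻¹) ^ p) := by
        gcongr
        exact (le_of_le_one_of_le_mul_exp p (by positivity) (by positivity) htrivial hlr).trans
          (by gcongr)
    _ = 2 * Real.exp 1 * p.factorial * w * (2 * r) ^ p * ((1 + (d m j : ℝ)) ^ p)⁻¹ *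
        ((1 + |s|) ^ p * |s|) := by rw [mul_pow, mul_pow, inv_pow]; ring
    _ ≤ _ := by
        rw [pow_succ]
        gcongr
        linarith

theorem norm_lie_interaction_freeEvo_le (j : Λ) (s : ℝ) :
    ‖⁅∑ n, g n, freeEvo (k j) s⁆‖ ≤ 4 * e * l := by
  have hlocal : LocalizedOn k {j} (freeEvo (k j) s) := fun i hi =>
    commutesWith_freeEvo (hk.commutes j i fun h => hi (Finset.mem_singleton.2 h.symm)) s
  have he := hw.interaction.nonneg j
  rw [sum_lie]
  refine (hw.interaction.norm_sum_le_of_commutesWith_eq_zero j (x := 2 * e * 2) (by positivity)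
    (fun n => (norm_lie_le_two_mul _ _).trans ?_) fun n hn => ?_).trans_eq (by ring)
  · gcongr
    exacts [hw.interaction.norm_le n, (hk.lowering j).norm_freeEvo_le s]
  · exact (hk.commute_of_localizedOn {j} hlocal (by simpa using hn)).symm.lie_eq

theorem norm_heisEvo_add_star_sub_freeEvo_le (j : Λ) (s : ℝ) :
    ‖heisEvo H s (k j + star (k j)) - freeEvo (k j) s‖ ≤ 4 * e * l * |s| := by
  have hderiv : ∀ s, HasDerivAt (fun s => heisEvo H (-s) (freeEvo (k j) s))
      (heisEvo H (-s) (-(Complex.I • ⁅∑ n, g n, freeEvo (k j) s⁆))) s := fun s => by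
    refine (hasDerivAt_heisEvo_neg H ((hk.lowering j).hasDerivAt_freeEvo s)).congr_deriv ?_
    congr 1
    rw [hw.eq, add_lie, hk.lie_neg_sum_parity_freeEvo]
    module
  have hmean := convex_univ.norm_image_sub_le_of_norm_hasDerivWithin_le (C := 4 * e * l)
    (fun s _ => (hderiv s).hasDerivWithinAt) (fun s _ => by
      rw [norm_heisEvo hw.isSelfAdjoint, norm_neg, norm_smul, Complex.norm_I, one_mul]
      exact hw.norm_lie_interaction_freeEvo_le hk j s) (Set.mem_univ 0) (Set.mem_univ s)
  rw [neg_zero, heisEvo_zero, freeEvo_zero, sub_zero, Real.norm_eq_abs] at hmean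
  calc ‖heisEvo H s (k j + star (k j)) - freeEvo (k j) s‖
      = ‖heisEvo H s (heisEvo H (-s) (freeEvo (k j) s) - (k j + star (k j)))‖ := by
        rw [heisEvo_sub, heisEvo_heisEvo_neg, norm_sub_rev]
    _ ≤ 4 * e * l * |s| := by rwa [norm_heisEvo hw.isSelfAdjoint]

end IsWeaklyCoupled

end WeakCoupling

section JumpBounds

open MeasureTheory

variable {𝒜 : Type*} [CStarAlgebra 𝒜]

/-- A filter whose Fourier transform is `1` at the energy `-2` and `0` at the energy `2`, and whose
`p`-th moment is at most `M`. It turns `e^{-2is} a + e^{2is} a†` into `a`. -/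
structure IsLoweringFilter (f : ℝ → ℂ) (p : ℕ) (M : ℝ) : Prop where
  continuous : Continuous f
  integrable_moment : Integrable fun s => ‖f s‖ * (1 + |s|) ^ p
  moment_le : ∫ s, ‖f s‖ * (1 + |s|) ^ p ≤ M
  integral_mul_exp_neg : ∫ s, f s * Complex.exp (-2 * Complex.I * s) = 1
  integral_mul_exp : ∫ s, f s * Complex.exp (2 * Complex.I * s) = 0

namespace IsLoweringFilter

variable {f : ℝ → ℂ} {p : ℕ} {M : ℝ} (hf : IsLoweringFilter f p M)
include hf

theorem nonneg : 0 ≤ M := (integral_nonneg fun s => by positivity).trans hf.moment_le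

theorem integrable_smul {E : Type*} [NormedAddCommGroup E] [NormedSpace ℂ E] {A : ℝ → E}
    (hA : Continuous A) {c : ℝ} (hc : ∀ s, ‖A s‖ ≤ c) : Integrable fun s => f s • A s := by
  refine (hf.integrable_moment.const_mul c).mono' (hf.continuous.smul hA).aestronglyMeasurable
    (Filter.Eventually.of_forall fun s => ?_)
  have hpow : 1 ≤ (1 + |s|) ^ p := one_le_pow₀ (by linarith [abs_nonneg s])
  calc ‖f s • A s‖ ≤ ‖f s‖ * c := by rw [norm_smul]; gcongr; exact hc s
    _ = c * (‖f s‖ * 1) := by ring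
    _ ≤ c * (‖f s‖ * (1 + |s|) ^ p) := by
        have hc0 : 0 ≤ c := (norm_nonneg _).trans (hc 0)
        gcongr

theorem integrable : Integrable f := by
  simpa using hf.integrable_smul (A := fun _ => (1 : ℂ)) continuous_const (c := 1) (by simp)

theorem norm_integral_smul_le {E : Type*} [NormedAddCommGroup E] [NormedSpace ℂ E] {A : ℝ → E}
    {c : ℝ} (hc0 : 0 ≤ c) (hc : ∀ s, ‖A s‖ ≤ c * (1 + |s|) ^ p) :
    ‖∫ s, f s • A s‖ ≤ c * M := by
  have hpoint : ∀ s, ‖f s • A s‖ ≤ c * (‖f s‖ * (1 + |s|) ^ p) := fun s => by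
    rw [norm_smul, mul_left_comm]
    gcongr
    exact hc s
  refine (norm_integral_le_of_norm_le (hf.integrable_moment.const_mul c)
    (Filter.Eventually.of_forall hpoint)).trans ?_
  rw [integral_const_mul]
  exact mul_le_mul_of_nonneg_left hf.moment_le hc0

theorem integrable_mul_exp (c : ℝ) :
    Integrable fun s : ℝ => f s * Complex.exp (c * Complex.I * s) :=
  hf.integrable_smul (c := 1) (by fun_prop) fun s => by simp [Complex.norm_exp]

theorem integrable_smul_freeEvo_and_integral (a : 𝒜) :
    (Integrable fun s => f s • freeEvo a s) ∧ ∫ s, f s • freeEvo a s = a := by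
  have hneg := hf.integrable_mul_exp (-2)
  have hpos := hf.integrable_mul_exp 2
  push_cast at hneg hpos
  simp only [freeEvo, smul_add, ← mul_smul, ← smul_eq_mul (f _)]
  simp only [smul_eq_mul]
  refine ⟨(hneg.smul_const a).add (hpos.smul_const (star a)), ?_⟩
  rw [integral_add (hneg.smul_const a) (hpos.smul_const (star a)), integral_smul_const,
    integral_smul_const, hf.integral_mul_exp_neg, hf.integral_mul_exp, one_smul, zero_smul,
    add_zero]

end IsLoweringFilter

variable {Λ : Type*} [Fintype Λ] {k : Λ → 𝒜}

namespace IsWeaklyCoupled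

variable {d : Λ → Λ → ℕ} {q : ℕ} {Γ : ℝ} {H : 𝒜} {g : Λ → 𝒜} {e : ℝ} {l r : ℕ}
  (hw : IsWeaklyCoupled k d H g e l r) (hk : IsSpinSystem k)
include hw hk

theorem integrable_smul_heisEvo {f : ℝ → ℂ} {p : ℕ} {M : ℝ} (hf : IsLoweringFilter f p M) (j : Λ) :
    Integrable fun s => f s • heisEvo H s (k j + star (k j)) :=
  hf.integrable_smul (continuous_heisEvo H _) fun s =>
    (norm_heisEvo_le hw.isSelfAdjoint s _).trans (hk.lowering j).norm_add_star_le

theorem norm_integral_smul_heisEvo_sub_le {f : ℝ → ℂ} {p : ℕ} {M : ℝ}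
    (hf : IsLoweringFilter f (p + 1) M) (j : Λ) :
    ‖(∫ s, f s • heisEvo H s (k j + star (k j))) - k j‖ ≤ 4 * e * l * M := by
  have he := hw.interaction.nonneg j
  obtain ⟨hint, hfree⟩ := hf.integrable_smul_freeEvo_and_integral (k j)
  have hdiff : (∫ s, f s • heisEvo H s (k j + star (k j))) - k j =
      ∫ s, f s • (heisEvo H s (k j + star (k j)) - freeEvo (k j) s) := by
    simp only [smul_sub]
    rw [integral_sub (hw.integrable_smul_heisEvo hk hf j) hint, hfree]
  rw [hdiff]
  refine hf.norm_integral_smul_le (by positivity) fun s => ?_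
  refine (hw.norm_heisEvo_add_star_sub_freeEvo_le hk j s).trans ?_
  gcongr
  exact (le_add_of_nonneg_left zero_le_one).trans
    (le_self_pow₀ (le_add_of_nonneg_right (abs_nonneg s)) p.succ_ne_zero)

theorem norm_osc_integral_smul_heisEvo_le (hd : HasPolyGrowth d q Γ) (hr : 1 ≤ r)
    (hv : lrVelocity Γ q e l r ≤ 1) {f : ℝ → ℂ} {p : ℕ} {M : ℝ}
    (hf : IsLoweringFilter f (p + 1) M) {j m : Λ} (hm : m ≠ j) :
    ‖osc (k m) (∫ s, f s • heisEvo H s (k j + star (k j)))‖ ≤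
      2 * Real.exp 1 * p.factorial * lrVelocity Γ q e l r * (2 * r) ^ p *
        ((1 + (d m j : ℝ)) ^ p)⁻¹ * M := by
  have hv0 := lrVelocity_nonneg (hd.nonneg j) q (hw.interaction.nonneg j) l r
  rw [← (osc (k m)).integral_comp_comm (hw.integrable_smul_heisEvo hk hf j)]
  simp only [map_smul]
  exact hf.norm_integral_smul_le (by positivity)
    (hw.norm_osc_heisEvo_add_star_le hk hd hr p hv hm)

theorem isQuasilocal_integral_smul_heisEvo_sub (hd : HasPolyGrowth d q Γ) (hr : 1 ≤ r)
    (hv : lrVelocity Γ q e l r ≤ 1) (p : ℕ) {f : ℝ → ℂ} {M : ℝ}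
    (hf : IsLoweringFilter f (p + q + 1) M) (j : Λ) :
    IsQuasilocal k d p j (M * (12 * e * l + Γ * (2 * Real.exp 1 * (p + q).factorial *
        lrVelocity Γ q e l r * (2 * r) ^ (p + q))))
      ((∫ s, f s • heisEvo H s (k j + star (k j))) - k j) := by
  classical
  set c := 2 * Real.exp 1 * (p + q).factorial * lrVelocity Γ q e l r * (2 * r) ^ (p + q)
  have hc : 0 ≤ c := by
    have := lrVelocity_nonneg (hd.nonneg j) q (hw.interaction.nonneg j) l r
    positivity
  have hM := hf.nonneg
  refine hk.isQuasilocal_sub_lowering hd p j ?_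
  have hosc : ∑ m ∈ Finset.univ.erase j, (1 + (d m j : ℝ)) ^ p *
      ‖osc (k m) (∫ s, f s • heisEvo H s (k j + star (k j)))‖ ≤ M * (Γ * c) :=
    calc _ ≤ ∑ m ∈ Finset.univ.erase j, c * M * ((1 + (d m j : ℝ)) ^ q)⁻¹ := by
          refine Finset.sum_le_sum fun m hm => ?_
          calc _ ≤ (1 + (d m j : ℝ)) ^ p * (c * ((1 + (d m j : ℝ)) ^ (p + q))⁻¹ * M) := by
                gcongr
                exact hw.norm_osc_integral_smul_heisEvo_le hk hd hr hv hf
                  (Finset.ne_of_mem_erase hm)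
            _ = c * M * ((1 + (d m j : ℝ)) ^ q)⁻¹ := by
                rw [pow_add]
                field_simp
      _ ≤ ∑ m, c * M * ((1 + (d m j : ℝ)) ^ q)⁻¹ :=
          Finset.sum_le_univ_sum_of_nonneg fun m => by positivity
      _ = c * M * ∑ m, ((1 + (d m j : ℝ)) ^ q)⁻¹ := by rw [Finset.mul_sum]
      _ ≤ c * M * Γ := by gcongr; exact hd.sum_le j
      _ = M * (Γ * c) := by ring
  linarith [hw.norm_integral_smul_heisEvo_sub_le hk hf j]

end IsWeaklyCoupled

end JumpBounds

section Filter

open MeasureTheory FourierTransform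

/-- The inverse Fourier transform `s ↦ (2π)⁻¹ ∫ F(ω) e^{-iωs} dω`, in the normalization of
`filterTime`: `filterTime u v` is `timeDomain (filterHat u v)`. -/
def timeDomain (F : ℝ → ℂ) (s : ℝ) : ℂ :=
  (1 / (2 * Real.pi) : ℂ) * ∫ ω : ℝ, F ω * Complex.exp (-(Complex.I * ω * s))

theorem timeDomain_eq_fourier (F : ℝ → ℂ) (s : ℝ) :
    timeDomain F s = (1 / (2 * Real.pi) : ℂ) * 𝓕 F (s / (2 * Real.pi)) := by
  have hpi : (Real.pi : ℂ) ≠ 0 := by exact_mod_cast Real.pi_ne_zero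
  rw [timeDomain, Real.fourier_real_eq_integral_exp_smul]
  congr 2 with ω
  rw [smul_eq_mul, mul_comm]
  congr 2
  push_cast
  field_simp

theorem norm_timeDomain_le_norm_fourier (F : ℝ → ℂ) (s : ℝ) :
    ‖timeDomain F s‖ ≤ ‖𝓕 F (s / (2 * Real.pi))‖ := by
  have hfactor : ‖(1 / (2 * Real.pi) : ℂ)‖ ≤ 1 := by
    rw [norm_div, norm_one, norm_mul, Complex.norm_real, Real.norm_of_nonneg Real.pi_pos.le,
      Complex.norm_ofNat, div_le_one (by positivity)]
    linarith [Real.pi_gt_three]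
  rw [timeDomain_eq_fourier, norm_mul]
  exact mul_le_of_le_one_left (norm_nonneg _) hfactor

theorem continuous_timeDomain {F : ℝ → ℂ} (hF : Integrable F) : Continuous (timeDomain F) := by
  have hfourier : Continuous (𝓕 F) := VectorFourier.fourierIntegral_continuous
    Real.continuous_fourierChar (by exact continuous_inner) hF
  rw [funext (timeDomain_eq_fourier F)]
  exact continuous_const.mul (hfourier.comp (continuous_id.div_const _))

theorem integral_timeDomain_mul_exp {F : ℝ → ℂ} (hF : Integrable F)
    (hi : Integrable (timeDomain F)) {ν : ℝ} (hν : ContinuousAt F ν) :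
    ∫ s, timeDomain F s * Complex.exp (Complex.I * ν * s) = F ν := by
  have hfourier : 𝓕 F = fun ξ => (2 * Real.pi : ℂ) * timeDomain F (ξ * (2 * Real.pi)) := by
    funext ξ
    have hpi' : (Real.pi : ℂ) ≠ 0 := by exact_mod_cast Real.pi_ne_zero
    rw [timeDomain_eq_fourier, mul_div_cancel_right₀ _ (by positivity)]
    field_simp
  have hFi : Integrable (𝓕 F) := hfourier ▸ (hi.comp_mul_right' (by positivity)).const_mul _
  have hscale := Measure.integral_comp_mul_right
    (fun s => timeDomain F s * Complex.exp (Complex.I * ν * s)) (2 * Real.pi)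
  rw [abs_of_pos (by positivity), eq_inv_smul_iff₀ (by positivity), Complex.real_smul] at hscale
  rw [← hscale, ← integral_const_mul, ← hF.fourierInv_fourier_eq hFi hν, Real.fourierInv_eq']
  congr 1 with ξ
  rw [smul_eq_mul, hfourier, mul_comm (Complex.exp _), ← mul_assoc]
  push_cast
  congr 2
  simp only [RCLike.inner_apply, conj_trivial]
  push_cast
  ring

section CompactSupport

variable {F : ℝ → ℂ} {R : ℝ}

theorem iteratedDeriv_eq_zero_of_notMem_tsupport {x : ℝ} (hx : x ∉ tsupport F) (n : ℕ) :
    iteratedDeriv n F x = 0 := by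
  rw [iteratedDeriv_eq_iteratedFDeriv,
    image_eq_zero_of_notMem_tsupport fun h => hx (tsupport_iteratedFDeriv_subset n h)]
  rfl

variable (hF : ContDiff ℝ (⊤ : ℕ∞) F) (hFs : tsupport F ⊆ Set.Icc (-R) R)
include hF hFs

theorem integrable_iteratedDeriv (n : ℕ) : Integrable (iteratedDeriv n F) :=
  (hF.continuous_iteratedDeriv n (by exact_mod_cast le_top)).integrable_of_hasCompactSupport <|
    HasCompactSupport.intro isCompact_Icc fun _ hx =>
      iteratedDeriv_eq_zero_of_notMem_tsupport (fun h => hx (hFs h)) n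

theorem integral_norm_iteratedDeriv_le {n : ℕ} {B : ℝ} (hR : 0 ≤ R)
    (hB : ∀ ω, ‖iteratedDeriv n F ω‖ ≤ B) :
    ∫ ω, ‖iteratedDeriv n F ω‖ ≤ 2 * R * B := by
  have hvanish : ∀ x, x ∉ Set.Icc (-R) R → ‖iteratedDeriv n F x‖ = 0 := fun x hx => by
    rw [iteratedDeriv_eq_zero_of_notMem_tsupport (fun h => hx (hFs h)), norm_zero]
  rw [← setIntegral_eq_integral_of_forall_compl_eq_zero hvanish]
  calc _ ≤ ∫ _ in Set.Icc (-R) R, B :=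
        setIntegral_mono (integrable_iteratedDeriv hF hFs n).norm.integrableOn
          (integrableOn_const (by simp)) hB
    _ = 2 * R * B := by
        rw [setIntegral_const, Real.volume_real_Icc_of_le (by linarith), smul_eq_mul]; ring

theorem pow_mul_norm_timeDomain_le {n : ℕ} {B : ℝ} (hR : 0 ≤ R)
    (hB : ∀ ω, ‖iteratedDeriv n F ω‖ ≤ B) (s : ℝ) :
    |s| ^ n * ‖timeDomain F s‖ ≤ 2 * R * B := by
  have hpi : (Real.pi : ℂ) ≠ 0 := by exact_mod_cast Real.pi_ne_zero
  have hphase : 2 * Real.pi * Complex.I * ((s / (2 * Real.pi) : ℝ) : ℂ) = Complex.I * s := by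
    push_cast
    field_simp
  have hfourier : 𝓕 (iteratedDeriv n F) (s / (2 * Real.pi)) =
      (Complex.I * s) ^ n • 𝓕 F (s / (2 * Real.pi)) :=
    (congrFun (Real.fourier_iteratedDeriv (N := ⊤) hF
      (fun n _ => integrable_iteratedDeriv hF hFs n) (by exact_mod_cast le_top)) _).trans
      (by simp only [hphase])
  calc |s| ^ n * ‖timeDomain F s‖
      ≤ |s| ^ n * ‖𝓕 F (s / (2 * Real.pi))‖ := by
        gcongr
        exact norm_timeDomain_le_norm_fourier F s
    _ = ‖𝓕 (iteratedDeriv n F) (s / (2 * Real.pi))‖ := by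
        rw [hfourier, norm_smul, norm_pow, norm_mul, Complex.norm_I, one_mul, Complex.norm_real,
          Real.norm_eq_abs]
    _ ≤ ∫ ω, ‖iteratedDeriv n F ω‖ := VectorFourier.norm_fourierIntegral_le_integral_norm _ _ _ _ _
    _ ≤ 2 * R * B := integral_norm_iteratedDeriv_le hF hFs hR hB

theorem norm_timeDomain_mul_pow_le {p : ℕ} {B₀ B₁ : ℝ} (hR : 0 ≤ R)
    (hB₀ : ∀ ω, ‖F ω‖ ≤ B₀) (hB₁ : ∀ ω, ‖iteratedDeriv (p + 2) F ω‖ ≤ B₁) (s : ℝ) :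
    ‖timeDomain F s‖ * (1 + |s|) ^ p ≤ 2 ^ (p + 1) * (2 * R * (B₀ + B₁)) * (1 + s ^ 2)⁻¹ := by
  have hlow := pow_mul_norm_timeDomain_le (n := 0) hF hFs hR
    (by simpa only [iteratedDeriv_zero] using hB₀) s
  have hhigh := pow_mul_norm_timeDomain_le hF hFs hR hB₁ s
  rw [pow_zero, one_mul] at hlow
  have hpow : (1 + |s|) ^ (p + 2) ≤ 2 ^ (p + 1) * (1 + |s| ^ (p + 2)) := by
    simpa using add_pow_le zero_le_one (abs_nonneg s) (p + 2)
  rw [← div_eq_mul_inv, le_div_iff₀ (by positivity)]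
  calc ‖timeDomain F s‖ * (1 + |s|) ^ p * (1 + s ^ 2)
      ≤ ‖timeDomain F s‖ * (1 + |s|) ^ p * (1 + |s|) ^ 2 := by
        gcongr
        nlinarith [abs_nonneg s, sq_abs s]
    _ = ‖timeDomain F s‖ * (1 + |s|) ^ (p + 2) := by rw [pow_add]; ring
    _ ≤ ‖timeDomain F s‖ * (2 ^ (p + 1) * (1 + |s| ^ (p + 2))) := by gcongr
    _ = 2 ^ (p + 1) * (‖timeDomain F s‖ + |s| ^ (p + 2) * ‖timeDomain F s‖) := by ring
    _ ≤ 2 ^ (p + 1) * (2 * R * B₀ + 2 * R * B₁) := by gcongr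
    _ = 2 ^ (p + 1) * (2 * R * (B₀ + B₁)) := by ring

theorem integrable_timeDomain_moment_and_integral_le {p : ℕ} {B₀ B₁ : ℝ} (hR : 0 ≤ R)
    (hB₀ : ∀ ω, ‖F ω‖ ≤ B₀) (hB₁ : ∀ ω, ‖iteratedDeriv (p + 2) F ω‖ ≤ B₁) :
    (Integrable fun s => ‖timeDomain F s‖ * (1 + |s|) ^ p) ∧
    ∫ s, ‖timeDomain F s‖ * (1 + |s|) ^ p ≤ 2 ^ (p + 1) * (2 * R * (B₀ + B₁)) * Real.pi := by
  have hdecay := norm_timeDomain_mul_pow_le hF hFs hR hB₀ hB₁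
  have hcauchy := integrable_inv_one_add_sq.const_mul (2 ^ (p + 1) * (2 * R * (B₀ + B₁)))
  have hcont : Continuous fun s => ‖timeDomain F s‖ * (1 + |s|) ^ p :=
    (continuous_timeDomain (by simpa using integrable_iteratedDeriv hF hFs 0)).norm.mul
      ((continuous_const.add continuous_abs).pow p)
  have hint : Integrable fun s => ‖timeDomain F s‖ * (1 + |s|) ^ p :=
    hcauchy.mono' hcont.aestronglyMeasurable (Filter.Eventually.of_forall fun s => by
      rw [Real.norm_of_nonneg (by positivity)]; exact hdecay s)
  refine ⟨hint, (integral_mono hint hcauchy hdecay).trans_eq ?_⟩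
  rw [integral_const_mul, integral_univ_inv_one_add_sq]

end CompactSupport

/-- The bound on `‖f̂⁽ⁿ⁾‖` that the Leibniz rule gives for `f̂(ω) = û(ω/8) v̂(2ω)` from the Gevrey
bounds on `û` and `v̂`. -/
def filterDerivBound (α A₁u A₂u A₁v A₂v : ℝ) (n : ℕ) : ℝ :=
  ∑ i ∈ Finset.range (n + 1), (n.choose i : ℝ) * (A₁u * A₂u ^ i * (i : ℝ) ^ (i * α)) *
    (2 ^ (n - i) * (A₁v * A₂v ^ (n - i) * ((n - i : ℕ) : ℝ) ^ ((n - i : ℕ) * α)))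

/-- A bound on the moment `∫ ‖f(s)‖ (1 + |s|)ᵖ ds` of the time-domain filter that depends on the
filter through its Gevrey constants only. -/
def filterMomentBound (α A₁u A₂u A₁v A₂v : ℝ) (p : ℕ) : ℝ :=
  2 ^ (p + 1) * (2 * 8 * (filterDerivBound α A₁u A₂u A₁v A₂v 0 +
    filterDerivBound α A₁u A₂u A₁v A₂v (p + 2))) * Real.pi

namespace FilterAssumption

variable {α A₁u A₂u A₁v A₂v : ℝ} {u : ℝ → ℝ} {v : ℝ → ℂ}
  (hf : FilterAssumption α A₁u A₂u A₁v A₂v u v)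
include hf

theorem contDiff_comp_div : ContDiff ℝ (⊤ : ℕ∞) fun ω => (u (ω / 8) : ℂ) :=
  Complex.ofRealCLM.contDiff.comp (hf.gevrey_u.1.comp (contDiff_id.div_const 8))

theorem contDiff_comp_mul : ContDiff ℝ (⊤ : ℕ∞) fun ω => v (2 * ω) :=
  hf.gevrey_v.1.comp (contDiff_const.mul contDiff_id)

theorem contDiff_filterHat : ContDiff ℝ (⊤ : ℕ∞) (filterHat u v) :=
  hf.contDiff_comp_div.mul hf.contDiff_comp_mul

theorem tsupport_filterHat_subset : tsupport (filterHat u v) ⊆ Set.Icc (-8) 8 := by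
  refine closure_minimal (fun ω hω => ?_) isClosed_Icc
  have hu : ω / 8 ∈ Set.Icc (-1 : ℝ) 1 :=
    hf.supp_u (subset_tsupport u fun h => hω (by simp [filterHat, h]))
  constructor <;> linarith [hu.1, hu.2]

theorem filterHat_of_nonneg {ω : ℝ} (hω : 0 ≤ ω) : filterHat u v ω = 0 := by
  have hpos : Set.EqOn v 0 (Set.Ioi 0) := fun x hx =>
    image_eq_zero_of_notMem_tsupport fun h => (Set.mem_Ioi.1 hx).not_ge (hf.supp_v h)
  have hnonneg : Set.EqOn v 0 (Set.Ici 0) :=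
    closure_Ioi (0 : ℝ) ▸ hpos.closure hf.gevrey_v.1.continuous continuous_zero
  rw [filterHat, hnonneg (Set.mem_Ici.2 (by positivity)), Pi.zero_apply, mul_zero]

theorem filterHat_neg_two : filterHat u v (-2) = 1 := by
  rw [filterHat, show (-2 : ℝ) / 8 = -(1 / 4) by norm_num, show (2 : ℝ) * -2 = -4 by norm_num,
    hf.value_u, hf.value_v, Complex.ofReal_one, mul_one]

theorem norm_iteratedFDeriv_comp_div_le (n : ℕ) (ω : ℝ) :
    ‖iteratedFDeriv ℝ n (fun ω => (u (ω / 8) : ℂ)) ω‖ ≤ A₁u * A₂u ^ n * (n : ℝ) ^ (n * α) := by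
  have hcomp : (fun ω => (u (ω / 8) : ℂ)) = Complex.ofRealLI ∘ fun ω => u ((1 / 8) * ω) := by
    funext x
    simp [div_eq_inv_mul]
  have hsmooth : ContDiff ℝ (⊤ : ℕ∞) fun ω => u ((1 / 8) * ω) :=
    hf.gevrey_u.1.comp (contDiff_const.mul contDiff_id)
  rw [hcomp, Complex.ofRealLI.norm_iteratedFDeriv_comp_left hsmooth.contDiffAt
    (by exact_mod_cast le_top), norm_iteratedFDeriv_eq_norm_iteratedDeriv,
    iteratedDeriv_comp_const_smul (hf.gevrey_u.1.of_le (by exact_mod_cast le_top)), norm_smul,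
    norm_pow]
  exact (mul_le_of_le_one_left (norm_nonneg _)
    (pow_le_one₀ (norm_nonneg _) (by norm_num))).trans (hf.gevrey_u.2 n _)

theorem norm_iteratedFDeriv_comp_mul_le (n : ℕ) (ω : ℝ) :
    ‖iteratedFDeriv ℝ n (fun ω => v (2 * ω)) ω‖ ≤
      2 ^ n * (A₁v * A₂v ^ n * (n : ℝ) ^ (n * α)) := by
  rw [norm_iteratedFDeriv_eq_norm_iteratedDeriv,
    iteratedDeriv_comp_const_smul (hf.gevrey_v.1.of_le (by exact_mod_cast le_top)), norm_smul,
    Real.norm_of_nonneg (by positivity)]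
  gcongr
  exact hf.gevrey_v.2 n _

theorem norm_iteratedDeriv_filterHat_le (n : ℕ) (ω : ℝ) :
    ‖iteratedDeriv n (filterHat u v) ω‖ ≤ filterDerivBound α A₁u A₂u A₁v A₂v n := by
  rw [← norm_iteratedFDeriv_eq_norm_iteratedDeriv]
  refine (norm_iteratedFDeriv_mul_le hf.contDiff_comp_div hf.contDiff_comp_mul ω
    (by exact_mod_cast le_top)).trans (Finset.sum_le_sum fun i _ => ?_)
  have hu := hf.norm_iteratedFDeriv_comp_div_le i ω
  have hv := hf.norm_iteratedFDeriv_comp_mul_le (n - i) ω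
  have hu0 := (norm_nonneg _).trans hu
  gcongr

theorem integrable_filterTime_moment_and_integral_le (p : ℕ) :
    (Integrable fun s => ‖filterTime u v s‖ * (1 + |s|) ^ p) ∧
    ∫ s, ‖filterTime u v s‖ * (1 + |s|) ^ p ≤ filterMomentBound α A₁u A₂u A₁v A₂v p :=
  integrable_timeDomain_moment_and_integral_le hf.contDiff_filterHat hf.tsupport_filterHat_subset
    (by norm_num) (by simpa only [iteratedDeriv_zero] using hf.norm_iteratedDeriv_filterHat_le 0)
    (hf.norm_iteratedDeriv_filterHat_le (p + 2))

theorem integrable_filterHat : Integrable (filterHat u v) := by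
  simpa using integrable_iteratedDeriv hf.contDiff_filterHat hf.tsupport_filterHat_subset 0

theorem continuous_filterTime : Continuous (filterTime u v) :=
  continuous_timeDomain hf.integrable_filterHat

theorem integrable_filterTime : Integrable (filterTime u v) := by
  refine (integrable_norm_iff hf.continuous_filterTime.aestronglyMeasurable).1 ?_
  simpa only [pow_zero, mul_one] using (hf.integrable_filterTime_moment_and_integral_le 0).1

theorem integral_filterTime_mul_exp (ν : ℝ) :
    ∫ s, filterTime u v s * Complex.exp (Complex.I * ν * s) = filterHat u v ν :=
  integral_timeDomain_mul_exp hf.integrable_filterHat hf.integrable_filterTime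
    hf.contDiff_filterHat.continuous.continuousAt

theorem isLoweringFilter_filterTime (p : ℕ) :
    IsLoweringFilter (filterTime u v) p (filterMomentBound α A₁u A₂u A₁v A₂v p) where
  continuous := hf.continuous_filterTime
  integrable_moment := (hf.integrable_filterTime_moment_and_integral_le p).1
  moment_le := (hf.integrable_filterTime_moment_and_integral_le p).2
  integral_mul_exp_neg := by
    have h := hf.integral_filterTime_mul_exp (-2)
    rw [hf.filterHat_neg_two] at h
    push_cast at h
    simpa only [mul_comm Complex.I] using h
  integral_mul_exp := by
    have h := hf.integral_filterTime_mul_exp 2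
    rw [hf.filterHat_of_nonneg zero_le_two] at h
    push_cast at h
    simpa only [mul_comm Complex.I] using h

end FilterAssumption

end Filter

section OnSite

theorem eq_of_update_invariant {ι κ β : Type*} [Finite ι] [DecidableEq ι] {g : (ι → κ) → β}
    (hg : ∀ x i b, g (Function.update x i b) = g x) (x y : ι → κ) : g x = g y := by
  cases nonempty_fintype ι
  have hpiecewise : ∀ s : Finset ι, g (s.piecewise x y) = g y := fun s => by
    induction s using Finset.induction_on with
    | empty => rw [Finset.piecewise_empty]
    | insert i s _ ih => rw [Finset.piecewise_insert, hg, ih]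
  simpa only [Finset.piecewise_univ] using hpiecewise Finset.univ

variable {Λ : Type} [Fintype Λ] [DecidableEq Λ]

theorem sum_ite_agree_off (i : Λ) (x : Λ → Fin 2) (F : (Λ → Fin 2) → ℂ) :
    ∑ z, (if ∀ n, n ≠ i → x n = z n then F z else 0) = ∑ b, F (Function.update x i b) := by
  have hupdate : ∀ z : Λ → Fin 2, (∀ n, n ≠ i → x n = z n) → Function.update x i (z i) = z :=
    fun z hz => Function.update_eq_iff.2 ⟨rfl, hz⟩
  rw [← Finset.sum_filter]
  refine Finset.sum_nbij' (fun z => z i) (Function.update x i) (by simp) (fun b _ => ?_)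
    (fun z hz => hupdate z (Finset.mem_filter.1 hz).2) (by simp)
    (fun z hz => by rw [hupdate z (Finset.mem_filter.1 hz).2])
  exact Finset.mem_filter.2
    ⟨Finset.mem_univ _, fun n hn => (Function.update_of_ne hn _ _).symm⟩

theorem onSite_mul_apply (i : Λ) (M : Matrix (Fin 2) (Fin 2) ℂ) (A : Op Λ) (x y : Λ → Fin 2) :
    (onSite i M * A) x y = ∑ b, M (x i) b * A (Function.update x i b) y := by
  simp only [Matrix.mul_apply, onSite, Matrix.of_apply, ite_mul, zero_mul]
  rw [sum_ite_agree_off i x fun z => M (x i) (z i) * A z y]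
  simp only [Function.update_self]

theorem mul_onSite_apply (i : Λ) (M : Matrix (Fin 2) (Fin 2) ℂ) (A : Op Λ) (x y : Λ → Fin 2) :
    (A * onSite i M) x y = ∑ b, A x (Function.update y i b) * M b (y i) := by
  simp only [Matrix.mul_apply, onSite, Matrix.of_apply, mul_ite, mul_zero, eq_comm (b := y _)]
  rw [sum_ite_agree_off i y fun z => A x z * M (z i) (y i)]
  simp only [Function.update_self]

theorem onSite_mul_onSite (i : Λ) (M N : Matrix (Fin 2) (Fin 2) ℂ) :
    onSite i M * onSite i N = onSite i (M * N) := by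
  ext x y
  have hoff : ∀ b, (∀ n, n ≠ i → Function.update x i b n = y n) ↔ ∀ n, n ≠ i → x n = y n :=
    fun b => forall₂_congr fun n hn => by rw [Function.update_of_ne hn]
  rw [onSite_mul_apply]
  simp only [onSite, Matrix.of_apply, Function.update_self, Matrix.mul_apply, hoff, mul_ite,
    mul_zero]
  split_ifs
  exacts [rfl, Finset.sum_const_zero]

theorem onSite_zero (i : Λ) : onSite i (0 : Matrix (Fin 2) (Fin 2) ℂ) = 0 := by
  ext x y
  simp [onSite]

theorem onSite_one (i : Λ) : onSite i (1 : Matrix (Fin 2) (Fin 2) ℂ) = 1 := by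
  ext x y
  have heq : x = y ↔ x i = y i ∧ ∀ n, n ≠ i → x n = y n := by
    rw [← Function.eq_update_iff, Function.update_eq_self]
  simp only [onSite, Matrix.of_apply, Matrix.one_apply, heq, ite_and]
  split_ifs <;> rfl

theorem star_onSite (i : Λ) (M : Matrix (Fin 2) (Fin 2) ℂ) :
    star (onSite i M) = onSite i Mᴴ := by
  ext x y
  simp only [Matrix.star_apply, onSite, Matrix.of_apply, Matrix.conjTranspose_apply,
    eq_comm (b := x _)]
  split_ifs
  exacts [rfl, star_zero _]

section Support

variable {S : Set Λ} {A : Op Λ} {i : Λ}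

omit [DecidableEq Λ] in
theorem IsSupportedOn.apply_eq_zero (hA : IsSupportedOn S A) (hi : i ∉ S) {x y : Λ → Fin 2}
    (hxy : x i ≠ y i) : A x y = 0 := by
  obtain ⟨B, hB⟩ := hA
  rw [hB, if_neg fun h => hxy (h i hi)]

theorem IsSupportedOn.apply_update_update (hA : IsSupportedOn S A) (hi : i ∉ S)
    (x y : Λ → Fin 2) (b : Fin 2) (hxy : x i = y i) :
    A (Function.update x i b) (Function.update y i b) = A x y := by
  obtain ⟨B, hB⟩ := hA
  have hrestrict : ∀ z : Λ → Fin 2, (fun n : S => Function.update z i b n) = fun n : S => z n :=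
    fun z => funext fun n => Function.update_of_ne (fun h : (n : Λ) = i => hi (h ▸ n.2)) _ _
  have hoff : (∀ n ∉ S, Function.update x i b n = Function.update y i b n) ↔
      ∀ n ∉ S, x n = y n := forall₂_congr fun n _ => by
    rcases eq_or_ne n i with rfl | hn
    · simp only [Function.update_self, hxy]
    · rw [Function.update_of_ne hn, Function.update_of_ne hn]
  simp only [hB, hrestrict]
  congr 1
  exact propext hoff

theorem IsSupportedOn.commute_onSite (hA : IsSupportedOn S A) (hi : i ∉ S)
    (M : Matrix (Fin 2) (Fin 2) ℂ) : Commute A (onSite i M) := by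
  ext x y
  have hshift : A x (Function.update y i (x i)) = A (Function.update x i (y i)) y := by
    simpa using (hA.apply_update_update hi x (Function.update y i (x i)) (y i) (by simp)).symm
  rw [mul_onSite_apply, onSite_mul_apply, Finset.sum_eq_single (x i), Finset.sum_eq_single (y i),
    hshift, mul_comm]
  · exact fun b _ hb => by rw [hA.apply_eq_zero hi (by simpa using hb), mul_zero]
  · simp
  · exact fun b _ hb => by rw [hA.apply_eq_zero hi (by simpa using hb.symm), zero_mul]
  · simp

end Support

theorem commute_onSite_onSite {i j : Λ} (hij : i ≠ j) (M N : Matrix (Fin 2) (Fin 2) ℂ) :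
    Commute (onSite i M) (onSite j N) :=
  IsSupportedOn.commute_onSite (S := {i})
    ⟨fun x y => M (x ⟨i, rfl⟩) (y ⟨i, rfl⟩), fun x y => by simp [onSite]⟩ hij.symm N

/-- The lowering operator `|0⟩⟨1|` at the site `i`, which removes one excitation of `-Z_i`. -/
def lower (i : Λ) : Op Λ := onSite i !![0, 1; 0, 0]

theorem star_lower (i : Λ) : star (lower i) = onSite i !![0, 0; 1, 0] := by
  rw [lower, star_onSite]
  congr 1
  ext a b
  fin_cases a <;> fin_cases b <;> simp

theorem onSite_eq_lower (i : Λ) (M : Matrix (Fin 2) (Fin 2) ℂ) :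
    onSite i M = M 0 0 • (lower i * star (lower i)) + M 0 1 • lower i +
      (M 1 0 • star (lower i) + M 1 1 • (star (lower i) * lower i)) := by
  rw [star_lower, lower, onSite_mul_onSite, onSite_mul_onSite]
  ext x y
  simp only [onSite, Matrix.add_apply, Matrix.smul_apply, Matrix.of_apply]
  generalize x i = a, y i = b
  split_ifs <;> fin_cases a <;> fin_cases b <;> simp

theorem pauliX_eq (i : Λ) : pauliX i = lower i + star (lower i) := by
  simp [pauliX, onSite_eq_lower i !![0, 1; 1, 0]]

theorem pauliZ_eq_parity (i : Λ) : pauliZ i = parity (lower i) := by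
  simp [pauliZ, onSite_eq_lower i !![1, 0; 0, -1], parity, sub_eq_add_neg]

theorem commutesWith_lower_iff {A : Op Λ} {i : Λ} :
    CommutesWith A (lower i) ↔ ∀ M, Commute A (onSite i M) := by
  refine ⟨fun h M => ?_, fun h => ⟨h _, by rw [star_lower]; exact h _⟩⟩
  rw [onSite_eq_lower]
  exact (((h.1.mul_right h.2).smul_right _).add_right (h.1.smul_right _)).add_right
    ((h.2.smul_right _).add_right ((h.2.mul_right h.1).smul_right _))

theorem apply_update_of_commute_onSite {A : Op Λ} {i : Λ} (hA : ∀ M, Commute A (onSite i M))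
    (x y : Λ → Fin 2) (a b : Fin 2) :
    (if b = y i then A x (Function.update y i a) else 0) =
      if a = x i then A (Function.update x i b) y else 0 := by
  have h := congrFun₂ (hA (Matrix.single a b 1)).eq x y
  rw [mul_onSite_apply, onSite_mul_apply] at h
  simpa [Matrix.single_apply, ite_and] using h

theorem exists_eq_smul_one_of_commutesWith_lower {A : Op Λ}
    (hA : ∀ i, CommutesWith A (lower i)) : ∃ c : ℂ, A = c • 1 := by
  have hunit := fun i => apply_update_of_commute_onSite (commutesWith_lower_iff.1 (hA i))
  have hoffdiag : ∀ x y, x ≠ y → A x y = 0 := fun x y hxy => by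
    obtain ⟨i, hi⟩ := Function.ne_iff.1 hxy
    simpa [hi.symm] using hunit i x y (y i) (y i)
  have hdiag : ∀ x i b, A (Function.update x i b) (Function.update x i b) = A x x :=
    fun x i b => by simpa using (hunit i x (Function.update x i b) (x i) b).symm
  refine ⟨A 0 0, ?_⟩
  ext x y
  rw [Matrix.smul_apply, Matrix.one_apply]
  split_ifs with hxy
  · rw [smul_eq_mul, mul_one, ← hxy]
    exact eq_of_update_invariant (g := fun x => A x x) hdiag x 0
  · rw [hoffdiag x y hxy, smul_zero]

theorem isLowering_lower (i : Λ) : IsLowering (lower i) where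
  mul_self := by
    rw [lower, onSite_mul_onSite, ← onSite_zero i]
    congr 1
    ext a b
    fin_cases a <;> fin_cases b <;> simp
  car := by simpa using (onSite_eq_lower i 1).symm.trans (onSite_one i)

theorem isSpinSystem_lower : IsSpinSystem (lower : Λ → Op Λ) where
  lowering := isLowering_lower
  commutes _ _ hij := commutesWith_lower_iff.2 fun _ => commute_onSite_onSite hij _ _
  irreducible _ hA := exists_eq_smul_one_of_commutesWith_lower hA

end OnSite

section Lattice

theorem coordDist_self (periodic : Bool) {L : ℕ} (a : Fin (L + 1)) :
    coordDist periodic a a = 0 := by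
  simp [coordDist]

theorem coordDist_comm (periodic : Bool) {L : ℕ} (a b : Fin (L + 1)) :
    coordDist periodic a b = coordDist periodic b a := by
  have hsymm : ((a : ℤ) - (b : ℤ)).natAbs = ((b : ℤ) - (a : ℤ)).natAbs := by
    rw [← Int.natAbs_neg, neg_sub]
  simp only [coordDist, hsymm]

theorem coordDist_triangle (periodic : Bool) {L : ℕ} (a b c : Fin (L + 1)) :
    coordDist periodic a c ≤ coordDist periodic a b + coordDist periodic b c := by
  unfold coordDist
  split_ifs <;> omega

theorem card_filter_coordDist_eq_le (periodic : Bool) {L : ℕ} (b : Fin (L + 1)) (n : ℕ) :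
    (Finset.univ.filter fun a : Fin (L + 1) => coordDist periodic a b = n).card ≤ 4 := by
  have hsub : ∀ a ∈ Finset.univ.filter fun a : Fin (L + 1) => coordDist periodic a b = n,
      ((a : ℕ) : ℤ) ∈
        ({(b : ℤ) + n, (b : ℤ) - n, (b : ℤ) + (L + 1 - n), (b : ℤ) - (L + 1 - n)} : Finset ℤ) := by
    intro a ha
    have hdist : coordDist periodic a b = n := (Finset.mem_filter.1 ha).2
    simp only [Finset.mem_insert, Finset.mem_singleton]
    unfold coordDist at hdist
    split_ifs at hdist <;> omega
  exact (Finset.card_le_card_of_injOn _ hsub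
    (Nat.cast_injective.comp Fin.val_injective).injOn).trans Finset.card_le_four

theorem sum_range_inv_one_add_sq_le (n : ℕ) :
    ∑ i ∈ Finset.range n, ((1 + (i : ℝ)) ^ 2)⁻¹ ≤ 2 := by
  have hshift : ∑ i ∈ Finset.range n, ((1 + (i : ℝ)) ^ 2)⁻¹ =
      ∑ i ∈ Finset.Ioo 0 (n + 1), ((i : ℝ) ^ 2)⁻¹ := by
    rw [show Finset.Ioo 0 (n + 1) = Finset.Ico (0 + 1) (n + 1) from rfl, ← Finset.sum_Ico_add',
      ← Finset.range_eq_Ico]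
    simp only [Nat.cast_add, Nat.cast_one, add_comm]
  rw [hshift]
  simpa using sum_Ioo_inv_sq_le (α := ℝ) 0 (n + 1)

theorem sum_inv_one_add_coordDist_sq_le (periodic : Bool) {L : ℕ} (b : Fin (L + 1)) :
    ∑ a, ((1 + (coordDist periodic a b : ℝ)) ^ 2)⁻¹ ≤ 8 := by
  have hlt : ∀ a : Fin (L + 1), coordDist periodic a b ∈ Finset.range (L + 1) := fun a => by
    rw [Finset.mem_range]
    unfold coordDist
    split_ifs <;> omega
  rw [← Finset.sum_fiberwise_of_maps_to (fun a _ => hlt a)]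
  calc _ ≤ ∑ n ∈ Finset.range (L + 1), 4 * ((1 + (n : ℝ)) ^ 2)⁻¹ := by
        refine Finset.sum_le_sum fun n _ => ?_
        rw [Finset.sum_congr rfl (g := fun _ => ((1 + (n : ℝ)) ^ 2)⁻¹) fun a ha => by
          rw [(Finset.mem_filter.1 ha).2], Finset.sum_const, nsmul_eq_mul]
        gcongr
        exact_mod_cast card_filter_coordDist_eq_le periodic b n
    _ = 4 * ∑ n ∈ Finset.range (L + 1), ((1 + (n : ℝ)) ^ 2)⁻¹ := by rw [Finset.mul_sum]
    _ ≤ 8 := by linarith [sum_range_inv_one_add_sq_le (L + 1)]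

theorem inv_one_add_manhattanDist_pow_le (periodic : Bool) {D L : ℕ} (i j : Site D L) :
    ((1 + (manhattanDist periodic i j : ℝ)) ^ (2 * D))⁻¹ ≤
      ∏ n, ((1 + (coordDist periodic (i n) (j n) : ℝ)) ^ 2)⁻¹ := by
  rw [Finset.prod_inv_distrib]
  refine inv_anti₀ (Finset.prod_pos fun n _ => by positivity) ?_
  calc ∏ n, (1 + (coordDist periodic (i n) (j n) : ℝ)) ^ 2
      ≤ ∏ _ : Fin D, (1 + (manhattanDist periodic i j : ℝ)) ^ 2 := by
        gcongr with n
        exact_mod_cast Finset.single_le_sum (f := fun n => coordDist periodic (i n) (j n))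
          (fun _ _ => Nat.zero_le _) (Finset.mem_univ n)
    _ = _ := by rw [Finset.prod_const, Finset.card_univ, Fintype.card_fin, ← pow_mul]

theorem hasPolyGrowth_manhattanDist (periodic : Bool) (D L : ℕ) :
    HasPolyGrowth (manhattanDist periodic : Site D L → Site D L → ℕ) (2 * D) (8 ^ D) where
  self i := by simp [manhattanDist, coordDist_self]
  symm i j := Finset.sum_congr rfl fun n _ => coordDist_comm periodic _ _
  triangle i j m := by
    simp only [manhattanDist, ← Finset.sum_add_distrib]
    exact Finset.sum_le_sum fun n _ => coordDist_triangle periodic _ _ _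
  sum_le j :=
    calc ∑ i : Site D L, ((1 + (manhattanDist periodic i j : ℝ)) ^ (2 * D))⁻¹
        ≤ ∑ i : Site D L, ∏ n, ((1 + (coordDist periodic (i n) (j n) : ℝ)) ^ 2)⁻¹ :=
          Finset.sum_le_sum fun i _ => inv_one_add_manhattanDist_pow_le periodic i j
      _ = ∏ n, ∑ a, ((1 + (coordDist periodic a (j n) : ℝ)) ^ 2)⁻¹ :=
          (Fintype.prod_sum fun n a => ((1 + (coordDist periodic a (j n) : ℝ)) ^ 2)⁻¹).symm
      _ ≤ ∏ _ : Fin D, (8 : ℝ) := by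
          gcongr with n
          exact sum_inv_one_add_coordDist_sq_le periodic _
      _ = 8 ^ D := by rw [Finset.prod_const, Finset.card_univ, Fintype.card_fin]

end Lattice

section Euler

open Filter

variable {𝔹 : Type*} [NormedRing 𝔹]

theorem norm_pow_sub_pow_le [NormOneClass 𝔹] {a b : 𝔹} {m : ℝ} (hm : 1 ≤ m) (ha : ‖a‖ ≤ m)
    (hb : ‖b‖ ≤ m) (n : ℕ) : ‖a ^ n - b ^ n‖ ≤ n * ‖a - b‖ * m ^ n := by
  induction n with
  | zero => simp
  | succ n ih =>
    have htelescope : a ^ (n + 1) - b ^ (n + 1) = a * (a ^ n - b ^ n) + (a - b) * b ^ n := by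
      rw [pow_succ', pow_succ', mul_sub, sub_mul]; abel
    have hbn : ‖b ^ n‖ ≤ m ^ n := (norm_pow_le b n).trans (by gcongr)
    calc ‖a ^ (n + 1) - b ^ (n + 1)‖
        ≤ ‖a‖ * ‖a ^ n - b ^ n‖ + ‖a - b‖ * ‖b ^ n‖ := htelescope ▸
          (norm_add_le _ _).trans (add_le_add (norm_mul_le _ _) (norm_mul_le _ _))
      _ ≤ m * (n * ‖a - b‖ * m ^ n) + ‖a - b‖ * (m * m ^ n) := by
          gcongr
          exact hbn.trans (le_mul_of_one_le_left (by positivity) hm)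
      _ = (n + 1 : ℕ) * ‖a - b‖ * m ^ (n + 1) := by push_cast; ring

variable [NormedAlgebra ℂ 𝔹] [CompleteSpace 𝔹] [NormOneClass 𝔹]

theorem norm_exp_le_exp_norm (x : 𝔹) : ‖NormedSpace.exp x‖ ≤ Real.exp ‖x‖ := by
  have hreal := NormedSpace.exp_series_hasSum_exp' (𝕂 := ℝ) ‖x‖
  rw [← congrFun Real.exp_eq_exp_ℝ ‖x‖] at hreal
  rw [← (NormedSpace.exp_series_hasSum_exp' (𝕂 := ℂ) x).tsum_eq]
  refine tsum_of_norm_bounded hreal fun n => ?_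
  rw [norm_smul, smul_eq_mul, norm_inv, Complex.norm_natCast]
  gcongr
  exact norm_pow_le x n

theorem norm_one_add_pow_sub_exp_pow_le (y : 𝔹) (n : ℕ) :
    ‖(1 + y) ^ n - NormedSpace.exp y ^ n‖ ≤
      n * ‖1 + y - NormedSpace.exp y‖ * Real.exp (n * ‖y‖) := by
  have hone : ‖1 + y‖ ≤ Real.exp ‖y‖ := (norm_add_le _ _).trans (by
    rw [norm_one]; linarith [Real.add_one_le_exp ‖y‖])
  rw [Real.exp_nat_mul]
  exact norm_pow_sub_pow_le (Real.one_le_exp (norm_nonneg y)) hone (norm_exp_le_exp_norm y) n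

omit [NormOneClass 𝔹] in
theorem tendsto_natCast_mul_norm_one_add_sub_exp (x : 𝔹) :
    Tendsto (fun n : ℕ => n * ‖1 + ((n : ℂ)⁻¹) • x - NormedSpace.exp (((n : ℂ)⁻¹) • x)‖) atTop
      (nhds 0) := by
  have hinv : Tendsto (fun n : ℕ => ((n : ℂ)⁻¹) • x) atTop (nhds 0) := by
    simpa using (tendsto_inv_atTop_nhds_zero_nat (𝕜 := ℂ)).smul_const x
  have hlittle := (hasFDerivAt_exp_zero (𝕂 := ℂ) (𝔸 := 𝔹)).isLittleO.comp_tendsto hinv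
  have hbig : (fun n : ℕ => ((n : ℂ)⁻¹) • x) =O[atTop] fun n : ℕ => (n : ℝ)⁻¹ :=
    Asymptotics.IsBigO.of_bound ‖x‖ (Eventually.of_forall fun n => by
      rw [norm_smul, norm_inv, norm_inv, Complex.norm_natCast, Real.norm_natCast, mul_comm])
  refine ((hlittle.trans_isBigO (by simpa using! hbig)).norm_left.tendsto_div_nhds_zero).congr
    fun n => ?_
  rw [div_inv_eq_mul, mul_comm, norm_sub_rev _ (NormedSpace.exp _)]
  simp [sub_sub]

theorem tendsto_one_add_smul_pow (x : 𝔹) :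
    Tendsto (fun n : ℕ => (1 + ((n : ℂ)⁻¹) • x) ^ n) atTop (nhds (NormedSpace.exp x)) := by
  let +nondep : NormedAlgebra ℚ 𝔹 := .restrictScalars ℚ ℂ 𝔹
  rw [tendsto_iff_norm_sub_tendsto_zero]
  refine squeeze_zero' (Eventually.of_forall fun n => norm_nonneg _) ?_
    (by simpa using (tendsto_natCast_mul_norm_one_add_sub_exp x).mul_const (Real.exp ‖x‖))
  filter_upwards [eventually_ne_atTop 0] with n hn
  have hscale : n • ((n : ℂ)⁻¹ • x) = x := by
    rw [← Nat.cast_smul_eq_nsmul ℂ, smul_smul, mul_inv_cancel₀ (by exact_mod_cast hn), one_smul]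
  have hnorm : n * ‖(n : ℂ)⁻¹ • x‖ = ‖x‖ := by
    rw [← Complex.norm_natCast, ← norm_smul, Nat.cast_smul_eq_nsmul, hscale]
  have h := norm_one_add_pow_sub_exp_pow_le ((n : ℂ)⁻¹ • x) n
  rwa [← NormedSpace.exp_nsmul, hscale, hnorm] at h

end Euler

section TraceEstimates

variable {n : Type*} [Fintype n] [DecidableEq n]

theorem norm_star_dotProduct_mulVec_le (A : Matrix n n ℂ) (v : n → ℂ) :
    ‖star v ⬝ᵥ (A *ᵥ v)‖ ≤ ‖A‖ * (star v ⬝ᵥ v).re := by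
  have hinner : ∀ w : n → ℂ, star v ⬝ᵥ w = inner ℂ (WithLp.toLp 2 v) (WithLp.toLp 2 w) :=
    fun w => by rw [EuclideanSpace.inner_toLp_toLp, dotProduct_comm]
  have hself : (inner ℂ (WithLp.toLp 2 v) (WithLp.toLp 2 v) : ℂ).re =
      ‖WithLp.toLp 2 v‖ * ‖WithLp.toLp 2 v‖ :=
    inner_self_eq_norm_mul_norm (𝕜 := ℂ) _
  rw [hinner, hinner, hself]
  calc _ ≤ ‖WithLp.toLp 2 v‖ * ‖WithLp.toLp 2 (A *ᵥ v)‖ := norm_inner_le_norm _ _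
    _ ≤ ‖WithLp.toLp 2 v‖ * (‖A‖ * ‖WithLp.toLp 2 v‖) := by
        gcongr
        exact Matrix.l2_opNorm_mulVec A (WithLp.toLp 2 v)
    _ = _ := by ring

theorem norm_trace_mul_le_of_posSemidef {ρ : Matrix n n ℂ} (hρ : ρ.PosSemidef)
    (A : Matrix n n ℂ) : ‖(A * ρ).trace‖ ≤ ‖A‖ * ρ.trace.re := by
  obtain ⟨B, rfl⟩ := CStarAlgebra.nonneg_iff_eq_star_mul_self.1 hρ.nonneg
  have htrace : ∀ C : Matrix n n ℂ, (C * (star B * B)).trace =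
      ∑ x, star (star (B x)) ⬝ᵥ (C *ᵥ star (B x)) := fun C => by
    rw [← Matrix.mul_assoc, Matrix.trace_mul_comm]
    refine Finset.sum_congr rfl fun x _ => ?_
    simp only [Matrix.diag_apply, Matrix.mul_apply, dotProduct, Matrix.mulVec, Pi.star_apply,
      star_star, Matrix.star_apply]
  have hnorm : ∑ x, (star (star (B x)) ⬝ᵥ star (B x)).re = (star B * B).trace.re := by
    simpa only [Matrix.one_mulVec, Matrix.one_mul, Complex.re_sum] using
      congrArg Complex.re (htrace 1).symm
  rw [htrace, ← hnorm, Finset.mul_sum]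
  exact (norm_sum_le _ _).trans
    (Finset.sum_le_sum fun x _ => norm_star_dotProduct_mulVec_le A (star (B x)))

end TraceEstimates

section States

variable {Λ : Type} [Fintype Λ] [DecidableEq Λ]

theorem exists_traceNorm_eq_re_trace_mul {Δ : Op Λ} (hΔ : Δ.IsHermitian) :
    ∃ O : Op Λ, ‖O‖ ≤ 1 ∧ traceNorm Δ = (O * Δ).trace.re := by
  let sgn : ℝ → ℝ := fun x => if 0 ≤ x then 1 else -1
  have hsa : IsSelfAdjoint Δ := hΔ
  have hcont : ∀ φ : ℝ → ℝ, ContinuousOn φ (spectrum ℝ Δ) := fun φ =>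
    (Matrix.finite_real_spectrum (A := Δ)).continuousOn φ
  have habs : ∀ x, sgn x * x = ‖x‖ := fun x => by
    simp only [sgn, Real.norm_eq_abs]
    split_ifs with hx
    · rw [abs_of_nonneg hx, one_mul]
    · rw [abs_of_neg (not_le.1 hx), neg_one_mul]
  have hpolar : cfc sgn Δ * Δ = CFC.abs Δ := by
    calc cfc sgn Δ * Δ = cfc sgn Δ * cfc (fun x : ℝ => x) Δ := by rw [cfc_id' ℝ Δ]
      _ = cfc (fun x => sgn x * x) Δ := (cfc_mul sgn _ Δ (hcont _) (hcont _)).symm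
      _ = CFC.abs Δ := by simp only [habs, CFC.abs_eq_cfc_norm Δ hsa]
  refine ⟨cfc sgn Δ, norm_cfc_le zero_le_one fun x _ => ?_, ?_⟩
  · simp only [sgn]
    split_ifs <;> simp
  · rw [hpolar]
    rfl

theorem isState_pureState {ψ : (Λ → Fin 2) → ℂ} (hψ : star ψ ⬝ᵥ ψ = 1) :
    IsState (pureState ψ) :=
  ⟨Matrix.posSemidef_vecMulVec_self_star ψ, by
    rw [pureState, Matrix.trace_vecMulVec, dotProduct_comm, hψ]⟩

theorem IsState.norm_trace_mul_le {ρ : Op Λ} (hρ : IsState ρ) (O : Op Λ) :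
    ‖(O * ρ).trace‖ ≤ ‖O‖ := by
  simpa [hρ.2] using norm_trace_mul_le_of_posSemidef hρ.1 O

theorem IsState.norm_trace_mul_sub_le {ρ σ : Op Λ} (hρ : IsState ρ) (hσ : IsState σ) (O : Op Λ) :
    ‖(O * (ρ - σ)).trace‖ ≤ 2 * ∑ i, ‖osc (lower i) O‖ := by
  obtain ⟨O', hO', hnorm⟩ :=
    isSpinSystem_lower.exists_commutesWith_norm_sub_le (Finset.univ : Finset Λ) O
  obtain ⟨c, rfl⟩ := isSpinSystem_lower.irreducible O' fun i => hO' i (Finset.mem_univ i)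
  have hshift : (O * (ρ - σ)).trace = ((O - c • 1) * ρ).trace - ((O - c • 1) * σ).trace := by
    simp only [mul_sub, sub_mul, Matrix.trace_sub, smul_mul_assoc, one_mul, Matrix.trace_smul,
      hρ.2, hσ.2, sub_sub_sub_cancel_right]
  rw [hshift]
  linarith [norm_sub_le ((O - c • 1) * ρ).trace ((O - c • 1) * σ).trace,
    hρ.norm_trace_mul_le (O - c • 1), hσ.norm_trace_mul_le (O - c • 1)]

end States

section Generator

open Filter

variable {Λ : Type} [Fintype Λ] [DecidableEq Λ] {ι : Type*} [Fintype ι]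

/-- The Lindblad generator `ρ ↦ ∑ j, (K_j ρ K_j† - ½ {K_j† K_j, ρ})` with arbitrary jump operators;
`lindbladian f H` is the case `K_j = jumpOp f H (pauliX j)`. -/
def generator (K : ι → Op Λ) : Op Λ →L[ℂ] Op Λ :=
  LinearMap.toContinuousLinearMap (∑ j, dissipator (K j))

/-- The Heisenberg-picture Euler step of length `h` for the dynamics generated by `generator K`. -/
def eulerStep (K : ι → Op Λ) (h : ℝ) (O : Op Λ) : Op Λ :=
  O + (h : ℂ) • ∑ j, dualDissipator (K j) (K j) O

theorem generator_apply (K : ι → Op Λ) (ρ : Op Λ) :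
    generator K ρ = ∑ j, dissipator (K j) ρ := by
  simp [generator]

theorem dissipator_apply (K ρ : Op Λ) : dissipator K ρ =
    K * ρ * Kᴴ - (1 / 2 : ℂ) • (Kᴴ * K * ρ + ρ * (Kᴴ * K)) := by
  simp [dissipator, mul_assoc]

theorem trace_mul_dissipator (O K ρ : Op Λ) :
    (O * dissipator K ρ).trace = (dualDissipator K K O * ρ).trace := by
  have hjump : (O * (K * ρ * Kᴴ)).trace = (Kᴴ * O * K * ρ).trace := by
    rw [← Matrix.mul_assoc, Matrix.trace_mul_comm]
    simp only [Matrix.mul_assoc]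
  have hright : (O * (ρ * (Kᴴ * K))).trace = (Kᴴ * K * O * ρ).trace := by
    rw [← Matrix.mul_assoc, Matrix.trace_mul_comm]
    simp only [Matrix.mul_assoc]
  have hleft : O * (Kᴴ * K * ρ) = O * (Kᴴ * K) * ρ := by simp only [Matrix.mul_assoc]
  rw [dissipator_apply, dualDissipator, Matrix.star_eq_conjTranspose]
  simp only [mul_sub, sub_mul, mul_smul_comm, smul_mul_assoc, mul_add, add_mul,
    Matrix.trace_sub, Matrix.trace_smul, Matrix.trace_add, hjump, hleft, hright]
  rw [add_comm]

theorem trace_mul_one_add_smul_generator (K : ι → Op Λ) (h : ℝ) (O ρ : Op Λ) :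
    (O * (1 + (h : ℂ) • generator K) ρ).trace = (eulerStep K h O * ρ).trace := by
  simp only [add_apply, one_apply_eq_self, smul_apply, generator_apply, eulerStep, mul_add,
    add_mul, Matrix.trace_add, mul_smul_comm, smul_mul_assoc, Matrix.trace_smul, Finset.mul_sum,
    Finset.sum_mul, Matrix.trace_sum, trace_mul_dissipator]

theorem trace_mul_one_add_smul_generator_pow (K : ι → Op Λ) (h : ℝ) (n : ℕ) (O ρ : Op Λ) :
    (O * ((1 + (h : ℂ) • generator K) ^ n) ρ).trace = ((eulerStep K h)^[n] O * ρ).trace := by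
  induction n generalizing O with
  | zero => rfl
  | succ n ih =>
    rw [Function.iterate_succ_apply, ← ih, pow_succ', mul_apply_eq_comp,
      trace_mul_one_add_smul_generator]

theorem isHermitian_dissipator (K : Op Λ) {ρ : Op Λ} (hρ : ρ.IsHermitian) :
    (dissipator K ρ).IsHermitian := by
  rw [dissipator_apply, Matrix.IsHermitian]
  simp only [Matrix.conjTranspose_sub, Matrix.conjTranspose_smul, Matrix.conjTranspose_add,
    Matrix.conjTranspose_mul, Matrix.conjTranspose_conjTranspose, hρ.eq, Matrix.mul_assoc]
  rw [add_comm]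
  simp

theorem isHermitian_one_add_smul_generator_pow (K : ι → Op Λ) (h : ℝ) (n : ℕ) {ρ : Op Λ}
    (hρ : ρ.IsHermitian) : (((1 + (h : ℂ) • generator K) ^ n) ρ).IsHermitian := by
  induction n with
  | zero => exact hρ
  | succ n ih =>
    rw [pow_succ', mul_apply_eq_comp, add_apply, one_apply_eq_self, smul_apply, generator_apply]
    exact ih.add (IsSelfAdjoint.smul (by simp [IsSelfAdjoint])
      (isSelfAdjoint_sum _ fun j _ => isHermitian_dissipator (K j) ih))

theorem tendsto_one_add_smul_generator_pow (K : ι → Op Λ) (t : ℝ) (ρ : Op Λ) :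
    Tendsto (fun n : ℕ => ((1 + ((t / n : ℝ) : ℂ) • generator K) ^ n) ρ) atTop
      (nhds (NormedSpace.exp ((t : ℂ) • generator K) ρ)) := by
  have hpow := tendsto_one_add_smul_pow ((t : ℂ) • generator K)
  refine ((ContinuousLinearMap.apply ℂ (Op Λ) ρ).continuous.continuousAt.tendsto.comp hpow).congr
    fun n => ?_
  simp only [Function.comp_apply, ContinuousLinearMap.apply_apply, smul_smul]
  push_cast
  rw [div_eq_inv_mul]

theorem isHermitian_exp_smul_generator (K : ι → Op Λ) (t : ℝ) {ρ : Op Λ} (hρ : ρ.IsHermitian) :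
    (NormedSpace.exp ((t : ℂ) • generator K) ρ).IsHermitian := by
  have hlim := tendsto_one_add_smul_generator_pow K t ρ
  refine tendsto_nhds_unique ((continuous_star.tendsto _).comp hlim) (hlim.congr fun n => ?_)
  exact (isHermitian_one_add_smul_generator_pow K (t / n) n hρ).eq.symm

theorem generator_pureState_eq_zero {K : ι → Op Λ} {ψ : (Λ → Fin 2) → ℂ}
    (hψ : ∀ j, K j *ᵥ ψ = 0) : generator K (pureState ψ) = 0 := by
  rw [generator_apply]
  refine Finset.sum_eq_zero fun j _ => ?_
  have hleft : K j * pureState ψ = 0 := by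
    rw [pureState, Matrix.mul_vecMulVec, hψ j, Matrix.zero_vecMulVec]
  have hright : pureState ψ * (K j)ᴴ = 0 := by
    rw [pureState, Matrix.vecMulVec_mul, ← Matrix.star_mulVec, hψ j, star_zero,
      Matrix.vecMulVec_zero]
  rw [dissipator_apply, hleft, ← Matrix.mul_assoc, hright, Matrix.mul_assoc, hleft]
  simp

theorem one_add_smul_generator_pow_pureState {K : ι → Op Λ} {ψ : (Λ → Fin 2) → ℂ}
    (hψ : ∀ j, K j *ᵥ ψ = 0) (h : ℝ) (n : ℕ) :
    ((1 + (h : ℂ) • generator K) ^ n) (pureState ψ) = pureState ψ := by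
  induction n with
  | zero => rfl
  | succ n ih =>
    rw [pow_succ', mul_apply_eq_comp, ih, add_apply, one_apply_eq_self, smul_apply,
      generator_pureState_eq_zero hψ, smul_zero, add_zero]

end Generator

section Mixing

open Filter

variable {Λ : Type} [Fintype Λ] [DecidableEq Λ] {d : Λ → Λ → ℕ} {q : ℕ} {Γ x : ℝ}
  {K : Λ → Op Λ}

theorem sum_norm_osc_iterate_eulerStep_le (hd : HasPolyGrowth d q Γ)
    (hK : ∀ j, IsQuasilocal lower d (2 * q) j x (K j - lower j))
    (hsmall : 4 * Γ ^ 2 * (2 * x + x ^ 2) ≤ 1 / 4) {h : ℝ} (h0 : 0 ≤ h) (h1 : h ≤ 1 / 2)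
    (O : Op Λ) (n : ℕ) :
    ∑ i, ‖osc (lower i) ((eulerStep K h)^[n] O)‖ ≤
      Real.exp (-h / 4 + (∑ j, ‖K j‖ ^ 2) ^ 2 * h ^ 2) ^ n * ∑ i, ‖osc (lower i) O‖ := by
  induction n with
  | zero => simp
  | succ n ih =>
    rw [Function.iterate_succ_apply', pow_succ', mul_assoc]
    refine (isSpinSystem_lower.sum_norm_osc_add_smul_sum_dualDissipator_le hd hK hsmall h0 h1
      _).trans ?_
    gcongr
    linarith [Real.add_one_le_exp (-h / 4 + (∑ j, ‖K j‖ ^ 2) ^ 2 * h ^ 2)]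

theorem norm_trace_mul_one_add_smul_generator_pow_sub_le (hd : HasPolyGrowth d q Γ)
    (hK : ∀ j, IsQuasilocal lower d (2 * q) j x (K j - lower j))
    (hsmall : 4 * Γ ^ 2 * (2 * x + x ^ 2) ≤ 1 / 4) {t : ℝ} {n : ℕ} (hn : n ≠ 0) (ht : 0 ≤ t)
    (htn : 2 * t ≤ n) {ρ σ : Op Λ} (hρ : IsState ρ) (hσ : IsState σ) {O : Op Λ} (hO : ‖O‖ ≤ 1) :
    ‖(O * ((1 + ((t / n : ℝ) : ℂ) • generator K) ^ n) (ρ - σ)).trace‖ ≤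
      4 * Fintype.card Λ * Real.exp (-t / 4 + (∑ j, ‖K j‖ ^ 2) ^ 2 * t ^ 2 / n) := by
  have hn0 : (0 : ℝ) < n := by positivity
  have hstep : t / n ≤ 1 / 2 := by
    rw [div_le_iff₀ hn0]
    linarith
  have hexponent : n * (-(t / n) / 4 + (∑ j, ‖K j‖ ^ 2) ^ 2 * (t / n) ^ 2) =
      -t / 4 + (∑ j, ‖K j‖ ^ 2) ^ 2 * t ^ 2 / n := by
    field_simp
  have hosc : ∑ i, ‖osc (lower i) O‖ ≤ 2 * Fintype.card Λ := by
    calc _ ≤ ∑ _i : Λ, (2 : ℝ) := Finset.sum_le_sum fun i _ => by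
          linarith [(isLowering_lower i).norm_osc_le O]
      _ = _ := by simp [mul_comm]
  rw [trace_mul_one_add_smul_generator_pow]
  calc _ ≤ 2 * ∑ i, ‖osc (lower i) ((eulerStep K (t / n))^[n] O)‖ :=
        hρ.norm_trace_mul_sub_le hσ _
    _ ≤ 2 * (Real.exp (-(t / n) / 4 + (∑ j, ‖K j‖ ^ 2) ^ 2 * (t / n) ^ 2) ^ n *
        (2 * Fintype.card Λ)) := by
        grw [sum_norm_osc_iterate_eulerStep_le hd hK hsmall (by positivity) hstep O n, hosc]
    _ = _ := by
        rw [← Real.exp_nat_mul, hexponent]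
        ring

theorem traceNorm_exp_smul_generator_sub_pureState_le (hd : HasPolyGrowth d q Γ)
    (hK : ∀ j, IsQuasilocal lower d (2 * q) j x (K j - lower j))
    (hsmall : 4 * Γ ^ 2 * (2 * x + x ^ 2) ≤ 1 / 4) {ψ : (Λ → Fin 2) → ℂ}
    (hψ : star ψ ⬝ᵥ ψ = 1) (hKψ : ∀ j, K j *ᵥ ψ = 0) {t : ℝ} (ht : 0 ≤ t) {ρ : Op Λ}
    (hρ : IsState ρ) :
    traceNorm (NormedSpace.exp ((t : ℂ) • generator K) ρ - pureState ψ) ≤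
      4 * Fintype.card Λ * Real.exp (-t / 4) := by
  have hpure := isState_pureState hψ
  obtain ⟨O, hO, htrace⟩ := exists_traceNorm_eq_re_trace_mul
    ((isHermitian_exp_smul_generator K t hρ.1.isHermitian).sub hpure.1.isHermitian)
  rw [htrace]
  have hlim : Tendsto (fun n : ℕ => ((1 + ((t / n : ℝ) : ℂ) • generator K) ^ n)
      (ρ - pureState ψ)) atTop
      (nhds (NormedSpace.exp ((t : ℂ) • generator K) ρ - pureState ψ)) := by
    simpa only [map_sub, one_add_smul_generator_pow_pureState hKψ] using
      (tendsto_one_add_smul_generator_pow K t ρ).sub_const (pureState ψ)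
  have htraceCont : Continuous fun A : Op Λ => (O * A).trace.re :=
    Complex.continuous_re.comp (Matrix.traceLinearMap _ ℂ ℂ ∘ₗ
      LinearMap.mulLeft ℂ O).continuous_of_finiteDimensional
  have hexponent : Tendsto (fun n : ℕ => -t / 4 + (∑ j, ‖K j‖ ^ 2) ^ 2 * t ^ 2 / n) atTop
      (nhds (-t / 4)) := by
    simpa using (tendsto_const_div_atTop_nhds_zero_nat
      ((∑ j, ‖K j‖ ^ 2) ^ 2 * t ^ 2)).const_add (-t / 4)
  refine le_of_tendsto_of_tendsto ((htraceCont.tendsto _).comp hlim)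
    (((Real.continuous_exp.tendsto _).comp hexponent).const_mul _) ?_
  filter_upwards [eventually_ne_atTop 0, eventually_ge_atTop ⌈2 * t⌉₊] with n hn hnt
  exact (Complex.re_le_norm _).trans (norm_trace_mul_one_add_smul_generator_pow_sub_le hd hK hsmall
    hn ht (Nat.ceil_le.1 hnt) hρ hpure hO)

end Mixing

section Eigenvectors

variable {n : Type*} [Fintype n] [DecidableEq n] {M : Matrix n n ℂ} {φ : n → ℂ}

theorem pow_mulVec_of_eigenvector {μ : ℂ} (h : M *ᵥ φ = μ • φ) (m : ℕ) :
    M ^ m *ᵥ φ = μ ^ m • φ := by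
  induction m with
  | zero => simp
  | succ m ih =>
    rw [pow_succ, ← Matrix.mulVec_mulVec, h, Matrix.mulVec_smul, ih, smul_smul, pow_succ']

theorem exp_mulVec_of_eigenvector {μ : ℂ} (h : M *ᵥ φ = μ • φ) :
    NormedSpace.exp M *ᵥ φ = Complex.exp μ • φ := by
  have hleft := (NormedSpace.exp_series_hasSum_exp' (𝕂 := ℂ) M).mapL
    ((Matrix.mulVecBilin ℂ ℂ).flip φ).toContinuousLinearMap
  have hright := (NormedSpace.exp_series_hasSum_exp' (𝕂 := ℂ) μ).smul_const φ
  have hterm : ∀ m : ℕ, (((m.factorial : ℂ)⁻¹) • M ^ m) *ᵥ φ =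
      (((m.factorial : ℂ)⁻¹) • μ ^ m) • φ := fun m => by
    rw [Matrix.smul_mulVec, pow_mulVec_of_eigenvector h, smul_eq_mul, smul_smul]
  simp only [← hterm] at hright
  rw [Complex.exp_eq_exp_ℂ]
  exact hleft.unique hright

theorem exp_smul_mulVec_of_eigenvector {μ : ℂ} (h : M *ᵥ φ = μ • φ) (z : ℂ) :
    NormedSpace.exp (z • M) *ᵥ φ = Complex.exp (z * μ) • φ :=
  exp_mulVec_of_eigenvector (by rw [Matrix.smul_mulVec, h, smul_smul])

theorem star_dotProduct_exp_smul_mulVec (hM : M.IsHermitian) {μ : ℝ} (h : M *ᵥ φ = (μ : ℂ) • φ)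
    (z : ℂ) (w : n → ℂ) :
    star φ ⬝ᵥ (NormedSpace.exp (z • M) *ᵥ w) = Complex.exp (z * μ) * (star φ ⬝ᵥ w) := by
  have hadjoint : (NormedSpace.exp (z • M))ᴴ = NormedSpace.exp (star z • M) := by
    rw [← Matrix.exp_conjTranspose, Matrix.conjTranspose_smul, hM.eq]
  have hexp : Complex.exp (z * μ) = star (Complex.exp (star z * μ)) := by
    simp [← Complex.exp_conj]
  rw [Matrix.dotProduct_mulVec, ← Matrix.conjTranspose_conjTranspose (NormedSpace.exp (z • M)),
    ← Matrix.star_mulVec, hadjoint, exp_smul_mulVec_of_eigenvector h, star_smul, smul_dotProduct,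
    smul_eq_mul, hexp]

omit [DecidableEq n] in
theorem eq_zero_of_forall_eigenvector_dotProduct_eq_zero (hM : M.IsHermitian) {w : n → ℂ}
    (h : ∀ (μ : ℝ) (φ : n → ℂ), φ ≠ 0 → M *ᵥ φ = (μ : ℂ) • φ → star φ ⬝ᵥ w = 0) : w = 0 := by
  classical
  refine (WithLp.toLp_eq_zero 2).1 (InnerProductSpace.ext_inner_left_basis (𝕜 := ℂ)
    hM.eigenvectorBasis.toBasis fun i => ?_)
  rw [inner_zero_right, OrthonormalBasis.coe_toBasis, EuclideanSpace.inner_eq_star_dotProduct,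
    dotProduct_comm]
  refine h (hM.eigenvalues i) _ (fun hzero => ?_) (by simpa using hM.mulVec_eigenvectorBasis i)
  exact hM.eigenvectorBasis.orthonormal.ne_zero i ((WithLp.ofLp_eq_zero 2).1 hzero)

end Eigenvectors

section GroundState

open MeasureTheory

variable {Λ : Type} [Fintype Λ] [DecidableEq Λ]

theorem star_dotProduct_jumpOp_mulVec {f : ℝ → ℂ} (hf : Integrable f) {H : Op Λ}
    (hH : H.IsHermitian) {φ ψ : (Λ → Fin 2) → ℂ} {μ E : ℝ} (hφ : H *ᵥ φ = (μ : ℂ) • φ)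
    (hψ : H *ᵥ ψ = (E : ℂ) • ψ) (A : Op Λ) :
    star φ ⬝ᵥ (jumpOp f H A *ᵥ ψ) =
      (∫ s, f s * Complex.exp (Complex.I * (μ - E : ℝ) * s)) * (star φ ⬝ᵥ (A *ᵥ ψ)) := by
  have hintegrable : Integrable fun s => f s • heisEvo H s A :=
    hf.smul_bdd ‖A‖ (continuous_heisEvo H A).aestronglyMeasurable
      (Filter.Eventually.of_forall fun s => norm_heisEvo_le hH s A)
  let T : Op Λ →ₗ[ℂ] ℂ :=
    dotProductBilin ℂ ℂ (star φ) ∘ₗ (Matrix.mulVecBilin ℂ ℂ).flip ψ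
  have hmatrixElement : ∀ s : ℝ, T (f s • heisEvo H s A) =
      f s * Complex.exp (Complex.I * (μ - E : ℝ) * s) * (star φ ⬝ᵥ (A *ᵥ ψ)) := fun s => by
    have hphase : Complex.I * (μ - E : ℝ) * s =
        Complex.I * s * μ + -(Complex.I * s) * E := by push_cast; ring
    change star φ ⬝ᵥ ((f s • heisEvo H s A) *ᵥ ψ) = _
    rw [Matrix.smul_mulVec, dotProduct_smul, heisEvo, ← Matrix.mulVec_mulVec,
      ← Matrix.mulVec_mulVec, exp_smul_mulVec_of_eigenvector hψ,
      star_dotProduct_exp_smul_mulVec hH hφ, Matrix.mulVec_smul, dotProduct_smul, hphase,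
      Complex.exp_add]
    simp only [smul_eq_mul]
    ring
  calc _ = ∫ s, T (f s • heisEvo H s A) :=
        (T.toContinuousLinearMap.integral_comp_comm hintegrable).symm
    _ = _ := by simp only [hmatrixElement, integral_mul_const]

-- `K ψ` has no component along eigenvectors of energy `μ ≥ E`, as the filter vanishes at `μ - E`.
theorem jumpOp_mulVec_groundState {f : ℝ → ℂ} (hf : Integrable f)
    (hvanish : ∀ ν : ℝ, 0 ≤ ν → ∫ s, f s * Complex.exp (Complex.I * ν * s) = 0) {H : Op Λ}
    (hH : H.IsHermitian) {ψ : (Λ → Fin 2) → ℂ} (hψ : IsGroundState H ψ) (A : Op Λ) :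
    jumpOp f H A *ᵥ ψ = 0 := by
  obtain ⟨-, E, hE, hmin⟩ := hψ
  refine eq_zero_of_forall_eigenvector_dotProduct_eq_zero hH fun μ φ hφ0 hφ => ?_
  rw [star_dotProduct_jumpOp_mulVec hf hH hφ hE, hvanish _ (sub_nonneg.2 (hmin μ φ hφ0 hφ)),
    zero_mul]

end GroundState

section LatticeHamiltonian

variable {D L r l : ℕ} {periodic : Bool} {h : Site D L → Op (Site D L)}

theorem IsGeometricallyLocal.isWeaklyCoupled_hamiltonian
    (hh : IsGeometricallyLocal periodic r l h) (hnorm : ∀ j, ‖h j‖ ≤ 1) (ε : ℝ) :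
    IsWeaklyCoupled lower (manhattanDist periodic) (hamiltonian ε h) (fun j => (ε : ℂ) • h j)
      |ε| l r where
  eq := by simp only [hamiltonian, pauliZ_eq_parity, Finset.smul_sum]
  selfAdjoint j := IsSelfAdjoint.smul (by simp [IsSelfAdjoint]) (hh.hermitian j)
  interaction :=
    { localized := fun j i hi => commutesWith_lower_iff.2 fun M =>
        ((hh.supported j).commute_onSite (fun hball => hi (mem_ballOf.2 hball)) M).smul_left _
      norm_le := fun j => by
        rw [norm_smul, Complex.norm_real, Real.norm_eq_abs]
        exact mul_le_of_le_one_right (abs_nonneg _) (hnorm j)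
      overlap := fun m => by
        classical
        refine ⟨Finset.univ.filter fun j => ActsOn m (h j), ?_, fun j hj => ?_⟩
        · rw [← Set.ncard_coe_finset]
          simpa using hh.overlap m
        · have hsupported : IsSupportedOn {m}ᶜ (h j) :=
            not_not.1 fun hacts => hj (Finset.mem_filter.2 ⟨Finset.mem_univ j, hacts⟩)
          exact commutesWith_lower_iff.2 fun M =>
            (hsupported.commute_onSite (by simp) M).smul_left _ }

end LatticeHamiltonian

section RapidMixing

/-- The constant for which the jump operators are quasi-local perturbations of the lowering
operators, with moments of order `2 * q`, under couplings as in `IsWeaklyCoupled` and a filter as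
in `IsLoweringFilter`. -/
def jumpPerturbation (M Γ : ℝ) (q : ℕ) (e : ℝ) (l r : ℕ) : ℝ :=
  M * (12 * e * l + Γ * (2 * Real.exp 1 * (2 * q + q).factorial * lrVelocity Γ q e l r *
    (2 * r) ^ (2 * q + q)))

section Threshold

variable {M Γ e : ℝ} {q l r : ℕ}

theorem jumpPerturbation_nonneg (hM : 0 ≤ M) (hΓ : 0 ≤ Γ) (q : ℕ) (he : 0 ≤ e) (l r : ℕ) :
    0 ≤ jumpPerturbation M Γ q e l r := by
  have := lrVelocity_nonneg hΓ q he l r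
  unfold jumpPerturbation
  positivity

theorem lrVelocity_le_mul_pow (hΓ : 0 ≤ Γ) (he : 0 ≤ e) (l : ℕ) (hr : 1 ≤ r) :
    lrVelocity Γ q e l r ≤ 4 * Real.exp 1 * Γ * 2 ^ q * (e * (l * (r : ℝ) ^ q)) := by
  have hr' : (1 : ℝ) ≤ r := by exact_mod_cast hr
  have hpow : (1 + (r : ℝ)) ^ q ≤ 2 ^ q * (r : ℝ) ^ q := by
    rw [← mul_pow]
    gcongr
    linarith
  calc lrVelocity Γ q e l r ≤ 4 * Real.exp 1 * e * l * (Γ * (2 ^ q * (r : ℝ) ^ q)) := by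
        unfold lrVelocity
        gcongr
    _ = _ := by ring

theorem mul_pow_le_mul_pow_four_mul (hq : q ≠ 0) (hl : 1 ≤ l) (hr : 1 ≤ r) {p : ℕ}
    (hp : p ≤ 4 * q) : (l : ℝ) * (r : ℝ) ^ p ≤ ((r : ℝ) * l) ^ (4 * q) := by
  have hr' : (1 : ℝ) ≤ r := by exact_mod_cast hr
  have hl' : (1 : ℝ) ≤ l := by exact_mod_cast hl
  rw [mul_pow, mul_comm]
  gcongr
  exact le_self_pow₀ hl' (by omega)

theorem jumpPerturbation_le_mul_pow (hM : 0 ≤ M) (hΓ : 0 ≤ Γ) (hq : q ≠ 0) (he : 0 ≤ e)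
    (hl : 1 ≤ l) (hr : 1 ≤ r) :
    jumpPerturbation M Γ q e l r ≤
      M * (12 + 8 * Real.exp 1 ^ 2 * Γ ^ 2 * (2 * q + q).factorial * 2 ^ (4 * q)) *
        (e * ((r : ℝ) * l) ^ (4 * q)) := by
  have hlow : (l : ℝ) ≤ ((r : ℝ) * l) ^ (4 * q) := by
    simpa using mul_pow_le_mul_pow_four_mul hq hl hr (Nat.zero_le (4 * q))
  have htop := mul_pow_le_mul_pow_four_mul hq hl hr le_rfl
  have hsplit : ∀ y : ℝ, y ^ (4 * q) = y ^ q * y ^ (2 * q + q) := fun y => by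
    rw [← pow_add]
    congr 1
    omega
  calc jumpPerturbation M Γ q e l r
      ≤ M * (12 * e * l + Γ * (2 * Real.exp 1 * (2 * q + q).factorial *
          (4 * Real.exp 1 * Γ * 2 ^ q * (e * (l * (r : ℝ) ^ q))) * (2 * r) ^ (2 * q + q))) := by
        unfold jumpPerturbation
        gcongr
        exact lrVelocity_le_mul_pow hΓ he l hr
    _ = M * (12 * (e * l) + 8 * Real.exp 1 ^ 2 * Γ ^ 2 * (2 * q + q).factorial * 2 ^ (4 * q) *
          (e * (l * (r : ℝ) ^ (4 * q)))) := by
        rw [mul_pow, hsplit 2, hsplit r]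
        ring
    _ ≤ M * (12 * (e * ((r : ℝ) * l) ^ (4 * q)) + 8 * Real.exp 1 ^ 2 * Γ ^ 2 *
          (2 * q + q).factorial * 2 ^ (4 * q) * (e * ((r : ℝ) * l) ^ (4 * q))) := by gcongr
    _ = _ := by ring

theorem exists_coupling_threshold (hM : 0 ≤ M) (hΓ : 0 ≤ Γ) (hq : q ≠ 0) :
    ∃ c : ℝ, 0 < c ∧ ∀ r l : ℕ, 1 ≤ r → 1 ≤ l → ∀ e : ℝ, 0 ≤ e →
      e * ((r : ℝ) * l) ^ (4 * q) ≤ c →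
      lrVelocity Γ q e l r ≤ 1 ∧
      4 * Γ ^ 2 * (2 * jumpPerturbation M Γ q e l r + jumpPerturbation M Γ q e l r ^ 2) ≤
        1 / 4 := by
  set a := 4 * Real.exp 1 * Γ * 2 ^ q
  set b := M * (12 + 8 * Real.exp 1 ^ 2 * Γ ^ 2 * (2 * q + q).factorial * 2 ^ (4 * q))
  have : 0 ≤ a := by positivity
  have : 0 ≤ b := by positivity
  refine ⟨(1 + a + b + 48 * Γ ^ 2 * b)⁻¹, by positivity, fun r l hr hl e he hc => ?_⟩
  set y := e * ((r : ℝ) * l) ^ (4 * q) with hy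
  have hy0 : 0 ≤ y := by positivity
  have hvelocity : lrVelocity Γ q e l r ≤ a * y :=
    (lrVelocity_le_mul_pow hΓ he l hr).trans (by
      rw [hy]
      gcongr
      exact mul_pow_le_mul_pow_four_mul hq hl hr (by omega))
  have hperturbation : jumpPerturbation M Γ q e l r ≤ b * y :=
    jumpPerturbation_le_mul_pow hM hΓ hq he hl hr
  have hsum : y + a * y + b * y + 48 * Γ ^ 2 * (b * y) ≤ 1 := by
    rw [← one_div, le_div_iff₀ (by positivity)] at hc
    linarith
  have hby : 0 ≤ b * y := by positivity
  have hay : 0 ≤ a * y := by positivity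
  have hΓby : 0 ≤ Γ ^ 2 * (b * y) := by positivity
  set x := jumpPerturbation M Γ q e l r
  have hx0 : 0 ≤ x := jumpPerturbation_nonneg hM hΓ q he l r
  have hx2 : x ^ 2 ≤ x := by nlinarith
  refine ⟨by linarith, ?_⟩
  calc 4 * Γ ^ 2 * (2 * x + x ^ 2) ≤ 4 * Γ ^ 2 * (3 * (b * y)) := by
        gcongr
        linarith
    _ ≤ 1 / 4 := by linarith

end Threshold

variable {α A₁u A₂u A₁v A₂v : ℝ} {u : ℝ → ℝ} {v : ℝ → ℂ}

theorem filterMomentBound_nonneg (α : ℝ) (hu₁ : 0 ≤ A₁u) (hu₂ : 0 ≤ A₂u) (hv₁ : 0 ≤ A₁v)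
    (hv₂ : 0 ≤ A₂v) (p : ℕ) : 0 ≤ filterMomentBound α A₁u A₂u A₁v A₂v p := by
  unfold filterMomentBound filterDerivBound
  positivity

theorem FilterAssumption.integral_filterTime_mul_exp_of_nonneg
    (hf : FilterAssumption α A₁u A₂u A₁v A₂v u v) {ν : ℝ} (hν : 0 ≤ ν) :
    ∫ s, filterTime u v s * Complex.exp (Complex.I * ν * s) = 0 :=
  (hf.integral_filterTime_mul_exp ν).trans (hf.filterHat_of_nonneg hν)

theorem IsLoweringFilter.traceNorm_evolve_sub_groundState_le {D L r l : ℕ} {f : ℝ → ℂ} {M : ℝ}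
    (hf : IsLoweringFilter f (2 * (2 * D) + 2 * D + 1) M)
    (hvanish : ∀ ν : ℝ, 0 ≤ ν → ∫ s, f s * Complex.exp (Complex.I * ν * s) = 0)
    {periodic : Bool} {h : Site D L → Op (Site D L)} (hh : IsGeometricallyLocal periodic r l h)
    (hnorm : ∀ j, ‖h j‖ ≤ 1) (hr : 1 ≤ r) {ε : ℝ}
    (hvelocity : lrVelocity (8 ^ D) (2 * D) |ε| l r ≤ 1)
    (hsmall : 4 * (8 ^ D : ℝ) ^ 2 * (2 * jumpPerturbation M (8 ^ D) (2 * D) |ε| l r +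
      jumpPerturbation M (8 ^ D) (2 * D) |ε| l r ^ 2) ≤ 1 / 4)
    {ψ : (Site D L → Fin 2) → ℂ} (hψ : IsGroundState (hamiltonian ε h) ψ) {t : ℝ} (ht : 0 ≤ t)
    {ρ : Op (Site D L)} (hρ : IsState ρ) :
    traceNorm (evolve f (hamiltonian ε h) t ρ - pureState ψ) ≤
      4 * ((L : ℝ) + 1) ^ D * Real.exp (-t / 4) := by
  have hd := hasPolyGrowth_manhattanDist periodic D L
  have hw := hh.isWeaklyCoupled_hamiltonian hnorm ε
  have hquasilocal : ∀ j, IsQuasilocal lower (manhattanDist periodic) (2 * (2 * D)) j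
      (jumpPerturbation M (8 ^ D) (2 * D) |ε| l r)
      (jumpOp f (hamiltonian ε h) (pauliX j) - lower j) := fun j => by
    rw [pauliX_eq]
    exact hw.isQuasilocal_integral_smul_heisEvo_sub isSpinSystem_lower hd hr hvelocity _ hf j
  have hstationary : ∀ j, jumpOp f (hamiltonian ε h) (pauliX j) *ᵥ ψ = 0 :=
    fun j => jumpOp_mulVec_groundState hf.integrable hvanish hw.isSelfAdjoint hψ (pauliX j)
  simpa using! traceNorm_exp_smul_generator_sub_pureState_le hd hquasilocal hsmall hψ.1 hstationary
    ht hρ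

theorem four_mul_mul_exp_neg_div_four_le {N η t : ℝ} (hη : 0 < η) (hN : 2 * η ≤ N)
    (ht : 12 * Real.log (N / η) ≤ t) : 4 * N * Real.exp (-t / 4) ≤ η := by
  have hratio : 2 ≤ N / η := (le_div_iff₀ hη).2 hN
  have hratio0 : 0 < N / η := by linarith
  have hexp : Real.exp (-t / 4) ≤ ((N / η) ^ 3)⁻¹ := by
    calc Real.exp (-t / 4) ≤ Real.exp (-(3 * Real.log (N / η))) := by
          gcongr
          linarith
      _ = ((N / η) ^ 3)⁻¹ := by
          rw [Real.exp_neg, ← Real.rpow_natCast, Real.rpow_def_of_pos hratio0]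
          push_cast
          ring_nf
  have hcube : 4 * (N / η) ≤ (N / η) ^ 3 := by
    nlinarith [mul_nonneg (mul_nonneg hratio0.le (sub_nonneg.2 hratio))
      (add_pos hratio0 two_pos).le]
  calc 4 * N * Real.exp (-t / 4) ≤ 4 * N * ((N / η) ^ 3)⁻¹ := by
        gcongr
        linarith
    _ = η * (4 * (N / η) / (N / η) ^ 3) := by field_simp
    _ ≤ η := mul_le_of_le_one_right hη.le (div_le_one_of_le₀ hcube (by positivity))

theorem two_mul_le_card_sites {L D : ℕ} (hL : 1 ≤ L) (hD : 1 ≤ D) {η : ℝ} (hη : η ≤ 1) :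
    2 * η ≤ ((L : ℝ) + 1) ^ D := by
  have hL' : (1 : ℝ) ≤ L := by exact_mod_cast hL
  have hpow : (L : ℝ) + 1 ≤ ((L : ℝ) + 1) ^ D := le_self_pow₀ (by linarith) (by omega)
  linarith

theorem mul_pow_le_of_lt_mul_rpow_neg {e c x : ℝ} (hx : 0 < x) (n D : ℕ)
    (he : e < c * x ^ (-((n : ℝ) * D))) : e * x ^ (n * D) ≤ c := by
  rw [Real.rpow_neg hx.le, ← Nat.cast_mul, Real.rpow_natCast, ← div_eq_mul_inv] at he
  exact ((lt_div_iff₀ (pow_pos hx _)).1 he).le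

end RapidMixing

end GroundStatePrep

end

theorem mainTheorem1 :
    ∃ a C : ℝ, 0 < a ∧ 0 < C ∧
      ∀ α A₁u A₂u A₁v A₂v : ℝ, 1 < α → 0 < A₁u → 0 < A₂u → 0 < A₁v → 0 < A₂v →
      ∀ D : ℕ, 1 ≤ D → ∃ c : ℝ, 0 < c ∧
      ∀ r₀ l : ℕ, 1 ≤ r₀ → 1 ≤ l → ∃ εstar : ℝ,
        εstar = c * ((r₀ : ℝ) * (l : ℝ)) ^ (-(a * (D : ℝ))) ∧
        ∀ (u : ℝ → ℝ) (v : ℝ → ℂ),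
          GroundStatePrep.FilterAssumption α A₁u A₂u A₁v A₂v u v →
        ∀ L : ℕ, 1 ≤ L → ∀ (periodic : Bool)
          (h : GroundStatePrep.Site D L → GroundStatePrep.Op (GroundStatePrep.Site D L)),
          GroundStatePrep.IsGeometricallyLocal periodic r₀ l h → (∀ j, ‖h j‖ ≤ 1) →
        ∀ ε : ℝ, |ε| < εstar →
        ∀ ψ₀, GroundStatePrep.IsGroundState (GroundStatePrep.hamiltonian ε h) ψ₀ →
        ∀ η : ℝ, 0 < η → η ≤ 1 →
        ∀ t : ℝ, C * Real.log (((L : ℝ) + 1) ^ D / η) ≤ t →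
        ∀ ρ, GroundStatePrep.IsState ρ →
          GroundStatePrep.traceNorm
            (GroundStatePrep.evolve (GroundStatePrep.filterTime u v)
                (GroundStatePrep.hamiltonian ε h) t ρ
              - GroundStatePrep.pureState ψ₀) ≤ η := by
  refine ⟨8, 12, by norm_num, by norm_num, fun α A₁u A₂u A₁v A₂v _ hu₁ hu₂ hv₁ hv₂ D hD => ?_⟩
  obtain ⟨c, hc, hthreshold⟩ := GroundStatePrep.exists_coupling_threshold (Γ := 8 ^ D) (q := 2 * D)
    (GroundStatePrep.filterMomentBound_nonneg α hu₁.le hu₂.le hv₁.le hv₂.le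
      (2 * (2 * D) + 2 * D + 1)) (by positivity) (by omega)
  refine ⟨c, hc, fun r₀ l hr hl => ⟨_, rfl, ?_⟩⟩
  intro u v hf L hL periodic h hh hnorm ε hε ψ₀ hψ₀ η hη hη₁ t ht ρ hρ
  have hcoupling : |ε| * ((r₀ : ℝ) * l) ^ (4 * (2 * D)) ≤ c := by
    rw [show 4 * (2 * D) = 8 * D by ring]
    exact GroundStatePrep.mul_pow_le_of_lt_mul_rpow_neg (by positivity) 8 D (by exact_mod_cast hε)
  obtain ⟨hvelocity, hsmall⟩ := hthreshold r₀ l hr hl |ε| (abs_nonneg ε) hcoupling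
  have hsites := GroundStatePrep.two_mul_le_card_sites hL hD hη₁
  have ht₀ : 0 ≤ t := by
    have hlog : 0 ≤ Real.log (((L : ℝ) + 1) ^ D / η) :=
      Real.log_nonneg ((one_le_div hη).2 (by linarith))
    linarith
  exact ((hf.isLoweringFilter_filterTime _).traceNorm_evolve_sub_groundState_le
    (fun _ => hf.integral_filterTime_mul_exp_of_nonneg) hh hnorm hr hvelocity hsmall hψ₀ ht₀
      hρ).trans (GroundStatePrep.four_mul_mul_exp_neg_div_four_le hη hsites ht)
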